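/- **Setting.** Fix $d\in\mathbb N$, $d\ge1$, and a Lipschitz function $\sigma:\mathbb R\to\mathbb R$ (the activation function). A *network* $f$ with $L\ge1$ hidden layers ($\mathrm{depth}(f)=L$) and widths $p_0=d$, $p_1,\dots,p_L\ge1$, $p_{L+1}=1$ is given by weight matrices $W_\ell\in\mathbb R^{p_\ell\times p_{\ell-1}}$ and shifts $b_\ell\in\mathbb R^{p_\ell}$, $1\le\ell\le L+1$, and computes $A_{L+1}\circ\sigma\circ A_L\circ\cdots\circ\sigma\circ A_1$ with $A_\ell(x)=W_\ell x+b_\ell$ and $\sigma$ applied coordinatewise; $\mathrm{width}(f)=\max_{1\le\ell\le L}p_\ell$ and $\theta(f)$ is the vector of all entries of the $W_\ell$ and $b_\ell$. Let $\mathcal F_\sigma(L,N,B,F)$ be the class of all networks $f$ with $\mathrm{depth}(f)\le L$, $\mathrm{width}(f)\le N$, $|\theta(f)|_\infty\le B$ and $\sup_{[0,1]^d}|f|\le F$; an element $f$ of this class is always used as the function $f\mathbf 1_{[0,1]^d}$. For $\lambda,\tau>0$ put $J_{\lambda,\tau}(f)=\lambda\sum_j\bigl(|\theta_j(f)|/\tau\wedge1\bigr)$.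 For σ-fields $\mathcal A,\mathcal B$ let $\beta(\mathcal A,\mathcal B)=\frac12\sup\sum_{i,j}|P(A_i\cap B_j)-P(A_i)P(B_j)|$ over finite partitions $(A_i)\subset\mathcal A$, $(B_j)\subset\mathcal B$ of $\Omega$, and for a process $X=(X_t)_{t=1}^T$ let $\beta_X(t)=\sup_k\beta(\sigma(X_s:s\le k),\sigma(X_s:s\ge k+t))$. **Model.** Let $T\ge3$, let $(\Omega,\mathcal G,(\mathcal G_t)_{t\ge0},P)$ be a filtered probability space, $m,\eta:\mathbb R^d\to\mathbb R$ measurable, and $$Y_t=m(X_t)+\eta(X_t)v_t,\qquad t=1,\dots,T,$$ where, for $1\le t\le T$, $v_t$ is $\mathcal G_t$-measurable, $X_t\in\mathbb R^d$ is $\mathcal G_{t-1}$-measurable, $E[v_t\mid\mathcal G_{t-1}]=0$, $E[v_t^2\mid\mathcal G_{t-1}]=1$, and $E[\exp(v_t^2/K_t^2)\mid\mathcal G_{t-1}]\le2$ for constants $0<K_t\le K$; $\sup_{[0,1]^d}|\eta|\le C_\eta$; and $\beta_X(t)\le C_{1,\beta}\exp(-C_{2,\beta}t)$ for all $t\ge1$,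 where $C_{1,\beta},C_{2,\beta}>0$. Let $F\ge1$ and $f_0=m\mathbf 1_{[0,1]^d}$ with $\sup_{[0,1]^d}|f_0|\le F$. **Theorem.** Let $C_L,C_N,C_B,C_\tau,\nu_0,\nu_1,\nu_2>0$, and let $\iota_\lambda$ be a strictly increasing function with $\iota_\lambda(x)/\log x\to\infty$ as $x\to\infty$. There is a constant $C>0$ depending only on $d$, $\sigma$ and $(C_\eta,C_{1,\beta},C_{2,\beta},C_L,C_N,C_B,C_\tau,\nu_0,\nu_1,\nu_2,K,\iota_\lambda)$ such that the following holds for every $T\ge3$ and every model as above. Let $L_T,N_T,B_T$ be positive reals with $$L_T\le C_L\log^{\nu_0}T,\qquad N_T\le C_NT^{\nu_1},\qquad 1\le B_T\le C_BT^{\nu_2},$$ and let $\lambda_T,\tau_T>0$ satisfy $$\lambda_T=\frac{F^2\,\iota_\lambda(T)\log^{2+\nu_0}T}{T},\qquad \tau_T(L_T+1)\bigl((N_T+1)B_T\bigr)^{L_T+1}\le C_\tau T^{-1}.$$ Put $\mathcal F=\mathcal F_\sigma(L_T,N_T,B_T,F)$, $J_T=J_{\lambda_T,\tau_T}$ and $\bar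 Q_T(f)=\frac1T\sum_{t=1}^T(Y_t-f(X_t))^2+J_T(f)$. Let $\hat f_T$ be any estimator with values in $\mathcal F$, i.e. a random element of $\mathcal F$ such that $(\omega,x)\mapsto\hat f_T(\omega,x)$ is measurable for the product of $\sigma((Y_t,X_t)_{t\le T})$ and the Borel σ-field and $J_T(\hat f_T)$ is a random variable. With $$R(\hat f_T,f_0)=E\Bigl[\frac1T\sum_{t=1}^T\bigl(\hat f_T(X_t^*)-f_0(X_t^*)\bigr)^2\Bigr],\qquad \bar\Psi_T^{\mathcal F}(\hat f_T)=E\Bigl[\bar Q_T(\hat f_T)-\inf_{f\in\mathcal F}\bar Q_T(f)\Bigr],$$ where $(X_t^*)_{t=1}^T$ is a copy of $(X_t)_{t=1}^T$ independent of everything else, one has $$R(\hat f_T,f_0)\le6\Bigl(\bar\Psi_T^{\mathcal F}(\hat f_T)+\inf_{f\in\mathcal F}\bigl(R(f,f_0)+J_T(f)\bigr)\Bigr)+C\,F^2\,\frac{1+\log T}{T}.$$ -/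

import Mathlib

open MeasureTheory ProbabilityTheory Filter Topology
open scoped ENNReal NNReal Matrix

noncomputable section

namespace SparseDNN

/-! ### Deep neural networks -/

/-- Real-valued feed-forward networks `A_{L+1} ∘ σ_L ∘ A_L ∘ ⋯ ∘ σ_1 ∘ A_1` with input dimension
`n`, given by their parameters. `output W b` is the last affine map `A_{L+1}`, and
`hidden m hm W b f` puts the affine map `x ↦ W x + b` into `ℝ^m`, followed by the coordinatewise
activation, in front of the network `f`. -/
inductive DNN : ℕ → Type
  | output {n : ℕ} (W : Matrix (Fin 1) (Fin n) ℝ) (b : Fin 1 → ℝ) : DNN n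
  | hidden {n : ℕ} (m : ℕ) (hm : 0 < m) (W : Matrix (Fin m) (Fin n) ℝ) (b : Fin m → ℝ)
      (f : DNN m) : DNN n

namespace DNN

/-- The function `ℝ^n → ℝ` computed by a network with activation function `σ`. -/
def eval (σ : ℝ → ℝ) : {n : ℕ} → DNN n → (Fin n → ℝ) → ℝ
  | _, output W b, x => (W *ᵥ x + b) 0
  | _, hidden _ _ W b f, x => eval σ f (fun i => σ ((W *ᵥ x + b) i))

/-- The number `L` of hidden layers. -/
def depth : {n : ℕ} → DNN n → ℕ
  | _, output _ _ => 0
  | _, hidden _ _ _ _ f => depth f + 1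

/-- The largest dimension of a hidden layer. -/
def width : {n : ℕ} → DNN n → ℕ
  | _, output _ _ => 0
  | _, hidden m _ _ _ f => max m (width f)

/-- The entries of a matrix, column after column. -/
def vec {m n : ℕ} (W : Matrix (Fin m) (Fin n) ℝ) : List ℝ :=
  (List.finRange n).flatMap fun j => (List.finRange m).map fun i => W i j

/-- The parameter vector `θ(f) = (vec W_1, b_1, …, vec W_{L+1}, b_{L+1})`. -/
def params : {n : ℕ} → DNN n → List ℝ
  | _, output W b => vec W ++ List.ofFn b
  | _, hidden _ _ W b f => vec W ++ List.ofFn b ++ params f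

end DNN

/-- The clipped `L₁` norm `∑ⱼ min (|θⱼ| / τ) 1`. -/
def clipNorm (τ : ℝ) (θ : List ℝ) : ℝ := (θ.map fun a => min (|a| / τ) 1).sum

/-- The sparse penalty `J_{lam, τ}(f) = lam ‖θ(f)‖_{clip, τ}`. -/
def penalty (lam τ : ℝ) {d : ℕ} (f : DNN d) : ℝ := lam * clipNorm τ f.params

/-- The cube `[0,1]^d`. -/
def cube (d : ℕ) : Set (Fin d → ℝ) := Set.Icc 0 1

/-- The function `f · 1_{[0,1]^d}`. -/
def DNN.fn (σ : ℝ → ℝ) {d : ℕ} (f : DNN d) : (Fin d → ℝ) → ℝ := (cube d).indicator (f.eval σ)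

/-- The class `F_σ(L, N, B, F)`: networks with at least one hidden layer, depth at most `L`, width
at most `N`, parameters bounded by `B`, and values on the cube bounded by `F`. The function
attached to an element `f` of the class is `f.fn σ`, that is `f · 1_{[0,1]^d}`. -/
def dnnClass (σ : ℝ → ℝ) (d : ℕ) (L N B F : ℝ) : Set (DNN d) :=
  {f | 1 ≤ f.depth ∧ (f.depth : ℝ) ≤ L ∧ (f.width : ℝ) ≤ N ∧ (∀ a ∈ f.params, |a| ≤ B) ∧
    ∀ x ∈ cube d, |f.eval σ x| ≤ F}

/-! ### Mixing -/

/-- The β-mixing coefficient of two σ-fields,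
`(1/2) sup ∑ᵢ ∑ⱼ |P(Aᵢ ∩ Bⱼ) - P(Aᵢ) P(Bⱼ)|` over all finite partitions `(Aᵢ)` of the space into
sets of `𝒜` and `(Bⱼ)` into sets of `ℬ`. -/
def betaCoeff {Ω : Type*} {mΩ : MeasurableSpace Ω} (P : Measure Ω) (𝒜 ℬ : MeasurableSpace Ω) :
    ℝ≥0∞ :=
  ⨆ (k : ℕ) (l : ℕ) (A : Fin k → Set Ω) (B : Fin l → Set Ω)
    (_ : (∀ i, MeasurableSet[𝒜] (A i)) ∧ Pairwise (Function.onFun Disjoint A) ∧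
      ⋃ i, A i = Set.univ)
    (_ : (∀ j, MeasurableSet[ℬ] (B j)) ∧ Pairwise (Function.onFun Disjoint B) ∧
      ⋃ j, B j = Set.univ),
    ENNReal.ofReal ((1 / 2) * ∑ i, ∑ j, |P.real (A i ∩ B j) - P.real (A i) * P.real (B j)|)

/-- The σ-field generated by `X_t`, `t ∈ I`. -/
abbrev sigmaOf {Ω E : Type*} [MeasurableSpace E] (X : ℕ → Ω → E) (I : Finset ℕ) :
    MeasurableSpace Ω :=
  ⨆ t ∈ I, MeasurableSpace.comap (X t) inferInstance

/-- The β-mixing coefficient of lag `t` of the process `X_1, …, X_T`,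
`sup_k β(σ(X_1, …, X_k), σ(X_{k+t}, …, X_T))`. -/
def betaMixing {Ω E : Type*} {mΩ : MeasurableSpace Ω} [MeasurableSpace E] (P : Measure Ω) (T : ℕ)
    (X : ℕ → Ω → E) (t : ℕ) : ℝ≥0∞ :=
  ⨆ k : ℕ, betaCoeff P (sigmaOf X (Finset.Icc 1 k ∩ Finset.Icc 1 T))
    (sigmaOf X (Finset.Icc (k + t) T ∩ Finset.Icc 1 T))

/-! ### The regression model -/

/-- The nonparametric time series regression model `Y_t = m(X_t) + η(X_t) v_t`, `t = 1, …, T`, with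
a volatility function bounded by `Cη` on the cube, a predictable covariate process `X` that is
β-mixing with exponential rate, and noise variables that are conditionally centered, conditionally
of variance one and conditionally sub-Gaussian with constants `K_t ≤ K`. The values of the processes
at times outside `{1, …, T}` are irrelevant. -/
structure RegressionModel {Ω : Type*} {mΩ : MeasurableSpace Ω} (P : Measure Ω)
    (𝒢 : Filtration ℕ mΩ) {d : ℕ} (T : ℕ) (m η : (Fin d → ℝ) → ℝ) (X : ℕ → Ω → Fin d → ℝ)
    (Y v : ℕ → Ω → ℝ) (Cη C₁ C₂ K : ℝ) : Prop where
  measurable_m : Measurable m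
  measurable_η : Measurable η
  model : ∀ t ∈ Finset.Icc 1 T, ∀ ω, Y t ω = m (X t ω) + η (X t ω) * v t ω
  η_le : ∀ x ∈ cube d, |η x| ≤ Cη
  adapted : ∀ t ∈ Finset.Icc 1 T, Measurable[𝒢 t] (v t)
  predictable : ∀ t ∈ Finset.Icc 1 T, Measurable[𝒢 (t - 1)] (X t)
  centered : ∀ t ∈ Finset.Icc 1 T, P[v t | 𝒢 (t - 1)] =ᵐ[P] 0
  variance_one : ∀ t ∈ Finset.Icc 1 T, P[fun ω => v t ω ^ 2 | 𝒢 (t - 1)] =ᵐ[P] 1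
  subgaussian : ∀ t ∈ Finset.Icc 1 T, ∃ Kt : ℝ, 0 < Kt ∧ Kt ≤ K ∧
    Integrable (fun ω => Real.exp (v t ω ^ 2 / Kt ^ 2)) P ∧
    ∀ᵐ ω ∂P, (P[fun ω' => Real.exp (v t ω' ^ 2 / Kt ^ 2) | 𝒢 (t - 1)]) ω ≤ 2
  mixing : ∀ t : ℕ, 1 ≤ t → betaMixing P T X t ≤ ENNReal.ofReal (C₁ * Real.exp (-C₂ * t))

/-! ### Risks -/

/-- The generalization error
`R(f̂, f₀) = E[(1/T) ∑ₜ (f̂(X*_t) - f₀(X*_t))²]` of a random function `f̂`, where `X*` is an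
independent copy of `X`: it is realized on the product space `Ω × Ω` as `X` evaluated at the second
coordinate, whereas `f̂` is evaluated at the first one. -/
def risk {Ω : Type*} {mΩ : MeasurableSpace Ω} (P : Measure Ω) {d : ℕ} (T : ℕ)
    (X : ℕ → Ω → Fin d → ℝ) (fhat : Ω → (Fin d → ℝ) → ℝ) (f₀ : (Fin d → ℝ) → ℝ) : ℝ :=
  ∫ q : Ω × Ω, (1 / (T : ℝ)) *
    ∑ t ∈ Finset.Icc 1 T, (fhat q.1 (X t q.2) - f₀ (X t q.2)) ^ 2 ∂(P.prod P)

/-- The penalized empirical risk `Q̄_T(f)` of a network at the outcome `ω`. -/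
def penRisk {Ω : Type*} {d : ℕ} (T : ℕ) (X : ℕ → Ω → Fin d → ℝ) (Y : ℕ → Ω → ℝ) (σ : ℝ → ℝ)
    (lam τ : ℝ) (ω : Ω) (f : DNN d) : ℝ :=
  (1 / (T : ℝ)) * ∑ t ∈ Finset.Icc 1 T, (Y t ω - f.fn σ (X t ω)) ^ 2 + penalty lam τ f

/-- The expected optimization gap `E[Q̄_T(f̂) - inf_{f ∈ 𝓕} Q̄_T(f)]`. -/
def optGap {Ω : Type*} {mΩ : MeasurableSpace Ω} (P : Measure Ω) {d : ℕ} (T : ℕ)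
    (X : ℕ → Ω → Fin d → ℝ) (Y : ℕ → Ω → ℝ) (σ : ℝ → ℝ) (lam τ : ℝ) (𝓕 : Set (DNN d))
    (fhat : Ω → DNN d) : ℝ :=
  ∫ ω, (penRisk T X Y σ lam τ ω (fhat ω) - ⨅ f : 𝓕, penRisk T X Y σ lam τ ω f) ∂P

/-- A network estimator with values in `𝓕`: the random function `(ω, x) ↦ f̂(ω)(x)` is measurable
for the product of the σ-field generated by the data `(Y_t, X_t)`, `t = 1, …, T`, and the Borel
σ-field, and its penalty is a random variable. -/
structure IsEstimator {Ω : Type*} [MeasurableSpace Ω] {d : ℕ} (T : ℕ) (X : ℕ → Ω → Fin d → ℝ)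
    (Y : ℕ → Ω → ℝ) (σ : ℝ → ℝ) (lam τ : ℝ) (𝓕 : Set (DNN d)) (fhat : Ω → DNN d) : Prop where
  mem : ∀ ω, fhat ω ∈ 𝓕
  measurable_fn :
    Measurable[(sigmaOf Y (Finset.Icc 1 T) ⊔ sigmaOf X (Finset.Icc 1 T)).prod inferInstance]
      (fun q : Ω × (Fin d → ℝ) => (fhat q.1).fn σ q.2)
  measurable_penalty : Measurable fun ω => penalty lam τ (fhat ω)

end SparseDNN

end

open SparseDNN MeasureTheory

/-!
The stochastic error of a network is, up to terms of order `F² log T / T`, absorbed by its penalty.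

* Cut the time axis into blocks of length `a ≍ log T`. By β-mixing, blocks of the same parity can
  be replaced one after the other by independent copies. For independent blocks, a suitable
  exponential moment of population risk minus twice empirical risk is at most one: nonnegativity
  and the factor two make a variance term superfluous. A union bound with weights `exp (-p i)` over
  a finite family then bounds the population risk of its members by twice the empirical risk plus
  `O(a F² / T) · p i`, up to a common error with expectation `O(a F² / T)`.
* The noise enters through its cross term with the regression error. Compensated by a multiple of
  the empirical squared distance, the exponential of this sub-Gaussian martingale is a
  supermartingale, and the same weights bound the cross term by half the empirical squared distance
  plus `O(F² / T) · p i`.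
* Setting small parameters to zero and rounding the others to a grid changes a network of the class
  by `O(1 / T)` on the cube and leaves `O(clipNorm τ f.params)` nonzero parameters. With weights
  exponential in the number of nonzero parameters the price of an approximant of `f` is
  `p i = O(log^{1 + ν₀} T) · clipNorm τ f.params`.

The total price is thus `O(F² log^{2 + ν₀} T / T) · clipNorm τ f.params`, which is at most the
penalty of `f` as soon as `ι T` exceeds a constant. For the finitely many remaining `T` the trivial
bound `4 F²` on the risk is enough.
-/

noncomputable section

namespace SparseDNN

/-! ### Decoupling under β-mixing -/

section Decoupling

variable {Ω : Type*} {𝒜 𝒜' ℬ ℬ' mΩ : MeasurableSpace Ω} {P : Measure Ω}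

lemma le_betaCoeff_of_fintype {α β : Type*} [Fintype α] [MeasurableSpace α]
    [MeasurableSingletonClass α] [Fintype β] [MeasurableSpace β] [MeasurableSingletonClass β]
    {A : Ω → α} {B : Ω → β} (hA : Measurable[𝒜] A) (hB : Measurable[ℬ] B) :
    ENNReal.ofReal ((1 / 2) * ∑ x, ∑ y,
      |P.real (A ⁻¹' {x} ∩ B ⁻¹' {y}) - P.real (A ⁻¹' {x}) * P.real (B ⁻¹' {y})|)
      ≤ betaCoeff P 𝒜 ℬ := by
  set e := (Fintype.equivFin α).symm
  set e' := (Fintype.equivFin β).symm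
  simp only [← e.sum_comp, ← e'.sum_comp]
  exact le_iSup_of_le _ <| le_iSup_of_le _ <|
    le_iSup_of_le (fun i => A ⁻¹' {e i}) <| le_iSup_of_le (fun j => B ⁻¹' {e' j}) <|
    le_iSup_of_le ⟨fun i => hA (measurableSet_singleton _),
      fun i j hij => Disjoint.preimage A (by simpa using hij),
      Set.eq_univ_of_forall fun ω => Set.mem_iUnion.2 ⟨e.symm (A ω), by simp⟩⟩ <|
    le_iSup_of_le ⟨fun i => hB (measurableSet_singleton _),
      fun i j hij => Disjoint.preimage B (by simpa using hij),
      Set.eq_univ_of_forall fun ω => Set.mem_iUnion.2 ⟨e'.symm (B ω), by simp⟩⟩ le_rfl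

lemma betaCoeff_mono (h : 𝒜 ≤ 𝒜') (h' : ℬ ≤ ℬ') : betaCoeff P 𝒜 ℬ ≤ betaCoeff P 𝒜' ℬ' :=
  iSup_mono fun _ => iSup_mono fun _ => iSup_mono fun _ => iSup_mono fun _ =>
    iSup_le fun hA => iSup_le fun hB => le_iSup_of_le ⟨fun i => h _ (hA.1 i), hA.2⟩ <|
      le_iSup_of_le ⟨fun j => h' _ (hB.1 j), hB.2⟩ le_rfl

lemma betaCoeff_bot_left [IsProbabilityMeasure P] : betaCoeff P ⊥ ℬ = 0 := by
  simp only [betaCoeff, ENNReal.iSup_eq_zero]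
  intro k l A B hA _
  rw [ENNReal.ofReal_eq_zero, Finset.sum_eq_zero, mul_zero]
  refine fun i _ => Finset.sum_eq_zero fun j _ => ?_
  rcases MeasurableSpace.measurableSet_bot_iff.1 (hA.1 i) with h | h <;> simp [h]

lemma integral_decouple_le_of_finite [IsProbabilityMeasure P] {α β : Type*}
    [Finite α] [MeasurableSpace α] [DiscreteMeasurableSpace α]
    [Finite β] [MeasurableSpace β] [DiscreteMeasurableSpace β]
    (h𝒜 : 𝒜 ≤ mΩ) (hℬ : ℬ ≤ mΩ) {A : Ω → α} {B : Ω → β}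
    (hA : Measurable[𝒜] A) (hB : Measurable[ℬ] B) {b : ℝ} (hb : 0 ≤ b)
    (hβ : betaCoeff P 𝒜 ℬ ≤ ENNReal.ofReal b) {h : α × β → ℝ}
    (h_nonneg : ∀ x, 0 ≤ h x) (h_le_one : ∀ x, h x ≤ 1) :
    ∫ ω, h (A ω, B ω) ∂P ≤ ∫ q, h (A q.1, B q.2) ∂(P.prod P) + 2 * b := by
  have := Fintype.ofFinite α
  have := Fintype.ofFinite β
  have hAm : Measurable A := hA.mono h𝒜 le_rfl
  have hBm : Measurable B := hB.mono hℬ le_rfl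
  have hmix := (le_betaCoeff_of_fintype (P := P) hA hB).trans hβ
  rw [ENNReal.ofReal_le_ofReal_iff hb] at hmix
  have hh : Measurable h := Measurable.of_discrete
  have joint : ∫ ω, h (A ω, B ω) ∂P = ∑ x, ∑ y, P.real (A ⁻¹' {x} ∩ B ⁻¹' {y}) * h (x, y) := by
    have := Measure.isProbabilityMeasure_map (μ := P) (hAm.prodMk hBm).aemeasurable
    rw [← integral_map (hAm.prodMk hBm).aemeasurable hh.aestronglyMeasurable,
      integral_fintype .of_finite, Fintype.sum_prod_type]
    refine Finset.sum_congr rfl fun x _ => Finset.sum_congr rfl fun y _ => ?_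
    rw [map_measureReal_apply (hAm.prodMk hBm) (measurableSet_singleton _), smul_eq_mul,
      ← Set.singleton_prod_singleton, Set.mk_preimage_prod]
  have indep : ∫ q, h (A q.1, B q.2) ∂(P.prod P)
      = ∑ x, ∑ y, P.real (A ⁻¹' {x}) * P.real (B ⁻¹' {y}) * h (x, y) := by
    have hAB : Measurable (Prod.map A B) := hAm.prodMap hBm
    have := Measure.isProbabilityMeasure_map (μ := P.prod P) hAB.aemeasurable
    change ∫ q, h (Prod.map A B q) ∂(P.prod P) = _
    rw [← integral_map hAB.aemeasurable hh.aestronglyMeasurable,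
      integral_fintype .of_finite, Fintype.sum_prod_type]
    refine Finset.sum_congr rfl fun x _ => Finset.sum_congr rfl fun y _ => ?_
    rw [map_measureReal_apply hAB (measurableSet_singleton _), smul_eq_mul,
      ← Set.singleton_prod_singleton, Set.preimage_prod_map_prod, measureReal_prod_prod]
  have hdiff : ∑ x, ∑ y, P.real (A ⁻¹' {x} ∩ B ⁻¹' {y}) * h (x, y)
      - ∑ x, ∑ y, P.real (A ⁻¹' {x}) * P.real (B ⁻¹' {y}) * h (x, y)
      ≤ ∑ x, ∑ y, |P.real (A ⁻¹' {x} ∩ B ⁻¹' {y}) - P.real (A ⁻¹' {x}) * P.real (B ⁻¹' {y})| := by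
    simp only [← Finset.sum_sub_distrib, ← sub_mul]
    gcongr with x _ y _
    refine (mul_le_mul_of_nonneg_right (le_abs_self _) (h_nonneg _)).trans ?_
    exact mul_le_of_le_one_right (abs_nonneg _) (h_le_one _)
  linarith

lemma integral_decouple_le [IsProbabilityMeasure P] {E E' : Type*}
    [EMetricSpace E] [SecondCountableTopology E] [MeasurableSpace E] [BorelSpace E] [Nonempty E]
    [EMetricSpace E'] [SecondCountableTopology E'] [MeasurableSpace E'] [BorelSpace E']
    [Nonempty E'] (h𝒜 : 𝒜 ≤ mΩ) (hℬ : ℬ ≤ mΩ) {A : Ω → E} {B : Ω → E'}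
    (hA : Measurable[𝒜] A) (hB : Measurable[ℬ] B) {b : ℝ} (hb : 0 ≤ b)
    (hβ : betaCoeff P 𝒜 ℬ ≤ ENNReal.ofReal b) {h : E × E' → ℝ} (hc : Continuous h)
    (h_nonneg : ∀ x, 0 ≤ h x) (h_le_one : ∀ x, h x ≤ 1) :
    ∫ ω, h (A ω, B ω) ∂P ≤ ∫ q, h (A q.1, B q.2) ∂(P.prod P) + 2 * b := by
  have hAm : Measurable A := hA.mono h𝒜 le_rfl
  have hBm : Measurable B := hB.mono hℬ le_rfl
  let x₀ : E := Classical.arbitrary E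
  let y₀ : E' := Classical.arbitrary E'
  let φ : ℕ → SimpleFunc E E := SimpleFunc.approxOn id measurable_id Set.univ x₀ trivial
  let ψ : ℕ → SimpleFunc E' E' := SimpleFunc.approxOn id measurable_id Set.univ y₀ trivial
  have hφ (x : E) : Tendsto (φ · x) atTop (𝓝 x) :=
    SimpleFunc.tendsto_approxOn measurable_id (Set.mem_univ _) (by simp)
  have hψ (y : E') : Tendsto (ψ · y) atTop (𝓝 y) :=
    SimpleFunc.tendsto_approxOn measurable_id (Set.mem_univ _) (by simp)
  have norm_le_one (x) : ‖h x‖ ≤ 1 := by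
    rw [Real.norm_of_nonneg (h_nonneg x)]; exact h_le_one x
  have tendsto_integral {S : Type _} [MeasurableSpace S] (ρ : Measure S) [IsProbabilityMeasure ρ]
      {f : S → E} {g : S → E'} (hf : Measurable f) (hg : Measurable g) :
      Tendsto (fun n => ∫ s, h (φ n (f s), ψ n (g s)) ∂ρ) atTop
        (𝓝 (∫ s, h (f s, g s) ∂ρ)) := by
    refine tendsto_integral_of_dominated_convergence 1 (fun n => ?_) (integrable_const _)
      (fun n => ae_of_all _ fun _ => norm_le_one _)
      (ae_of_all _ fun s => (hc.tendsto _).comp ((hφ _).prodMk_nhds (hψ _)))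
    exact (hc.measurable.comp (((φ n).measurable.comp hf).prodMk
      ((ψ n).measurable.comp hg))).aestronglyMeasurable
  refine le_of_tendsto_of_tendsto' (tendsto_integral P hAm hBm)
    ((tendsto_integral (P.prod P) (hAm.comp measurable_fst)
      (hBm.comp measurable_snd)).add_const (2 * b)) fun n => ?_
  exact integral_decouple_le_of_finite (P := P) h𝒜 hℬ
    (A := fun ω => (⟨φ n (A ω), SimpleFunc.mem_range_self _ _⟩ : (φ n).range))
    (B := fun ω => (⟨ψ n (B ω), SimpleFunc.mem_range_self _ _⟩ : (ψ n).range))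
    (((φ n).measurable.comp hA).subtype_mk) (((ψ n).measurable.comp hB).subtype_mk) hb hβ
    (h := fun q => h (q.1, q.2)) (fun _ => h_nonneg _) (fun _ => h_le_one _)

lemma integral_min_one_sum_mul_exp_le [IsProbabilityMeasure P] {I : Type*} [Fintype I]
    {w : I → ℝ} (hw : ∀ i, 0 ≤ w i) {U : Ω → I → ℝ}
    (hU : ∀ i, Integrable (fun ω => Real.exp (U ω i)) P)
    (hU_le : ∀ i, ∫ ω, Real.exp (U ω i) ∂P ≤ 1) (s : I → ℝ) :
    ∫ ω, min 1 (∑ i, w i * Real.exp (s i + U ω i)) ∂P ≤ min 1 (∑ i, w i * Real.exp (s i)) := by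
  have hsummand (i : I) : Integrable (fun ω => w i * Real.exp (s i + U ω i)) P := by
    simp only [Real.exp_add]
    exact ((hU i).const_mul _).const_mul _
  have hsum : Integrable (fun ω => ∑ i, w i * Real.exp (s i + U ω i)) P :=
    integrable_finsetSum _ fun i _ => hsummand i
  have hmin : Integrable (fun ω => min 1 (∑ i, w i * Real.exp (s i + U ω i))) P :=
    (integrable_const 1).inf hsum
  refine le_min ?_ ?_
  · simpa using integral_mono hmin (integrable_const 1) fun _ => min_le_left _ _
  · refine (integral_mono hmin hsum fun _ => min_le_right _ _).trans ?_
    rw [integral_finsetSum _ fun i _ => hsummand i]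
    gcongr with i
    simp only [Real.exp_add, integral_const_mul]
    exact mul_le_mul_of_nonneg_left
      (mul_le_of_le_one_right (Real.exp_pos _).le (hU_le i)) (hw i)

/-- Clipping the exponential sum at `1` keeps the decoupling error of each step bounded. -/
lemma integral_min_one_sum_mul_exp_sum_le [IsProbabilityMeasure P] {I : Type*} [Fintype I]
    {𝒜 ℬ : ℕ → MeasurableSpace Ω} (h𝒜 : ∀ k, 𝒜 k ≤ mΩ) (hℬ : ∀ k, ℬ k ≤ mΩ)
    {U : ℕ → Ω → I → ℝ} (hpast : ∀ k, ∀ j < k, Measurable[𝒜 k] (U j))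
    (hpresent : ∀ k, Measurable[ℬ k] (U k))
    (hU : ∀ k i, Integrable (fun ω => Real.exp (U k ω i)) P)
    (hU_le : ∀ k i, ∫ ω, Real.exp (U k ω i) ∂P ≤ 1) {b : ℝ} (hb : 0 ≤ b)
    (hβ : ∀ k, betaCoeff P (𝒜 k) (ℬ k) ≤ ENNReal.ofReal b)
    {w : I → ℝ} (hw : ∀ i, 0 ≤ w i) (n : ℕ) :
    ∫ ω, min 1 (∑ i, w i * Real.exp (∑ k ∈ Finset.range n, U k ω i)) ∂P
      ≤ 2 * b * n + ∑ i, w i := by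
  induction n with
  | zero => simp
  | succ n ih =>
    let S : Ω → I → ℝ := fun ω i => ∑ k ∈ Finset.range n, U k ω i
    let Φ : (I → ℝ) → ℝ := fun s => min 1 (∑ i, w i * Real.exp (s i))
    have hΦ : Continuous Φ := by fun_prop
    have hΦ_nonneg (s) : 0 ≤ Φ s :=
      le_min zero_le_one (Finset.sum_nonneg fun i _ => mul_nonneg (hw i) (Real.exp_pos _).le)
    have hΦ_le_one (s) : Φ s ≤ 1 := min_le_left _ _
    have integrable_Φ {S' : Type _} [MeasurableSpace S'] (ρ : Measure S') [IsProbabilityMeasure ρ]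
        {f : S' → I → ℝ} (hf : Measurable f) : Integrable (fun s => Φ (f s)) ρ :=
      .of_bound (hΦ.measurable.comp hf).aestronglyMeasurable 1 (ae_of_all _ fun s => by
        rw [Real.norm_of_nonneg (hΦ_nonneg _)]; exact hΦ_le_one _)
    have hS_past : Measurable[𝒜 n] S := by
      refine @measurable_pi_lambda _ _ _ (𝒜 n) _ _ fun i =>
        @Finset.measurable_fun_sum _ _ _ _ _ _ (𝒜 n) _ _ fun k hk => ?_
      exact (measurable_pi_apply i).comp (hpast n k (Finset.mem_range.1 hk))
    have hS : Measurable S := hS_past.mono (h𝒜 n) le_rfl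
    have hUn : Measurable (U n) := (hpresent n).mono (hℬ n) le_rfl
    have decoupled : ∫ ω, Φ (S ω + U n ω) ∂P
        ≤ ∫ q, Φ (S q.1 + U n q.2) ∂(P.prod P) + 2 * b :=
      integral_decouple_le (h𝒜 n) (hℬ n) hS_past (hpresent n) hb (hβ n)
        (h := fun q => Φ (q.1 + q.2)) (hΦ.comp continuous_add) (fun _ => hΦ_nonneg _)
        (fun _ => hΦ_le_one _)
    have contracted : ∫ q, Φ (S q.1 + U n q.2) ∂(P.prod P) ≤ ∫ ω, Φ (S ω) ∂P := by
      have hint : Integrable (fun q : Ω × Ω => Φ (S q.1 + U n q.2)) (P.prod P) :=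
        integrable_Φ _ ((hS.comp measurable_fst).add (hUn.comp measurable_snd))
      rw [integral_prod _ hint]
      exact integral_mono hint.integral_prod_left (integrable_Φ P hS) fun ω =>
        integral_min_one_sum_mul_exp_le hw (hU n) (hU_le n) (S ω)
    simp only [Finset.sum_range_succ]
    calc ∫ ω, Φ (S ω + U n ω) ∂P ≤ (2 * b * n + ∑ i, w i) + 2 * b := by linarith
      _ = 2 * b * (n + 1 : ℕ) + ∑ i, w i := by push_cast; ring

end Decoupling

/-! ### Population means against empirical means under β-mixing -/

lemma exp_neg_le_one_sub_half {u : ℝ} (h0 : 0 ≤ u) (h1 : u ≤ 1) : Real.exp (-u) ≤ 1 - u / 2 := by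
  have hpos : 0 < 1 + u + u ^ 2 / 2 := by positivity
  rw [Real.exp_neg]
  calc (Real.exp u)⁻¹ ≤ (1 + u + u ^ 2 / 2)⁻¹ :=
        inv_anti₀ hpos (Real.quadratic_le_exp_of_nonneg h0)
    _ ≤ 1 - u / 2 := by
      rw [inv_le_iff_one_le_mul₀ hpos]
      nlinarith [mul_nonneg h0 h0, mul_nonneg h0 (sub_nonneg.2 h1),
        mul_nonneg (mul_nonneg h0 h0) (sub_nonneg.2 h1)]

lemma sub_div_le_sum_exp {I : Type*} [Fintype I] {θ : ℝ} (hθ : 0 < θ) (s p : I → ℝ) (i : I) :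
    s i - p i / θ ≤ ∑ j, Real.exp (-p j) / θ * Real.exp (θ * s j) :=
  calc s i - p i / θ ≤ Real.exp (θ * s i - p i) / θ := by
        rw [le_div_iff₀ hθ, sub_mul, div_mul_cancel₀ _ hθ.ne']
        linarith [Real.add_one_le_exp (θ * s i - p i)]
    _ = Real.exp (-p i) / θ * Real.exp (θ * s i) := by
        rw [sub_eq_add_neg, Real.exp_add]; ring
    _ ≤ _ := Finset.single_le_sum (f := fun j => Real.exp (-p j) / θ * Real.exp (θ * s j))
        (fun j _ => by positivity) (Finset.mem_univ i)

lemma sub_div_le_mul_min_one_sum_exp {I : Type*} [Fintype I] {M θ : ℝ} (hM : 0 < M) (hθ : 0 < θ)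
    {s p : I → ℝ} (hp : ∀ i, 0 ≤ p i) (hs : ∀ i, s i ≤ M) (i : I) :
    s i - p i / θ ≤ M * min 1 (∑ j, Real.exp (-p j) / (M * θ) * Real.exp (θ * s j)) := by
  rw [mul_min_of_nonneg _ _ hM.le, mul_one]
  refine le_min (by linarith [hs i, div_nonneg (hp i) hθ.le]) ?_
  refine (sub_div_le_sum_exp hθ s p i).trans_eq ?_
  rw [Finset.mul_sum]
  refine Finset.sum_congr rfl fun j _ => ?_
  field_simp

lemma integrable_of_nonneg_of_le {Ω : Type*} {mΩ : MeasurableSpace Ω} {P : Measure Ω}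
    [IsFiniteMeasure P] {f : Ω → ℝ} {M : ℝ} (hf : Measurable f) (h0 : ∀ ω, 0 ≤ f ω)
    (hM : ∀ ω, f ω ≤ M) : Integrable f P :=
  .of_bound hf.aestronglyMeasurable M (ae_of_all _ fun ω => by
    rw [Real.norm_of_nonneg (h0 ω)]; exact hM ω)

section Excess

variable {Ω : Type*} {𝒜 mΩ : MeasurableSpace Ω} {P : Measure Ω} {E : Type*} [MeasurableSpace E]
  {X : ℕ → Ω → E} {s : Finset ℕ} {g : E → ℝ} {M : ℝ}

/-- The excess of the mean of `∑ t ∈ s, g (X t)` over twice the sum itself. Because of the factor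
two, its exponential moments need no variance term when `g` is nonnegative and bounded. -/
def excess (P : Measure Ω) (X : ℕ → Ω → E) (s : Finset ℕ) (g : E → ℝ) (ω : Ω) : ℝ :=
  ∑ t ∈ s, (∫ ω', g (X t ω') ∂P - 2 * g (X t ω))

lemma measurable_excess (hX : ∀ t ∈ s, Measurable[𝒜] (X t)) (hg : Measurable g) :
    Measurable[𝒜] (excess P X s g) :=
  @Finset.measurable_fun_sum _ _ _ _ _ _ 𝒜 _ _ fun t ht =>
    (measurable_const.sub (measurable_id.const_mul 2)).comp (hg.comp (hX t ht))

lemma excess_eq_integral_sum_sub [IsFiniteMeasure P] (hX : ∀ t ∈ s, Measurable (X t))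
    (hg : Measurable g) (hg_nonneg : ∀ x, 0 ≤ g x) (hg_le : ∀ x, g x ≤ M) (ω : Ω) :
    excess P X s g ω = ∫ ω', ∑ t ∈ s, g (X t ω') ∂P - 2 * ∑ t ∈ s, g (X t ω) := by
  rw [excess, Finset.sum_sub_distrib, ← Finset.mul_sum, integral_finsetSum]
  exact fun t ht => integrable_of_nonneg_of_le (hg.comp (hX t ht)) (fun _ => hg_nonneg _)
    fun _ => hg_le _

lemma excess_le [IsProbabilityMeasure P] (hX : ∀ t ∈ s, Measurable (X t)) (hg : Measurable g)
    (hg_nonneg : ∀ x, 0 ≤ g x) (hg_le : ∀ x, g x ≤ M) (ω : Ω) :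
    excess P X s g ω ≤ s.card * M := by
  rw [← nsmul_eq_mul]
  refine Finset.sum_le_card_nsmul _ _ _ fun t ht => ?_
  have hmean : ∫ ω', g (X t ω') ∂P ≤ M := by
    simpa using integral_mono (μ := P) (integrable_of_nonneg_of_le (hg.comp (hX t ht))
      (fun _ => hg_nonneg _) fun _ => hg_le _) (integrable_const M) fun _ => hg_le _
  linarith [hg_nonneg (X t ω)]

lemma integral_exp_integral_sub_two_mul_le_one [IsProbabilityMeasure P] {V : Ω → ℝ}
    (hV : Measurable V) (hM : 0 < M) (hV_nonneg : ∀ ω, 0 ≤ V ω) (hV_le : ∀ ω, V ω ≤ M) :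
    ∫ ω, Real.exp (1 / (2 * M) * (∫ ω', V ω' ∂P - 2 * V ω)) ∂P ≤ 1 := by
  set μ := ∫ ω, V ω ∂P with hμ
  have hVi : Integrable V P := integrable_of_nonneg_of_le hV hV_nonneg hV_le
  have laplace : ∫ ω, Real.exp (-(V ω / M)) ∂P ≤ Real.exp (-(1 / (2 * M) * μ)) :=
    calc ∫ ω, Real.exp (-(V ω / M)) ∂P ≤ ∫ ω, (1 - V ω / M / 2) ∂P :=
          integral_mono_of_nonneg (ae_of_all _ fun _ => (Real.exp_pos _).le)
            ((integrable_const _).sub ((hVi.div_const _).div_const _))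
            (ae_of_all _ fun ω => exp_neg_le_one_sub_half (div_nonneg (hV_nonneg ω) hM.le)
              ((div_le_one hM).2 (hV_le ω)))
      _ = 1 - μ / M / 2 := by
          rw [integral_sub (integrable_const _) ((hVi.div_const _).div_const _), integral_div,
            integral_div]
          simp [hμ]
      _ = -(1 / (2 * M) * μ) + 1 := by field_simp; ring
      _ ≤ _ := Real.add_one_le_exp _
  calc ∫ ω, Real.exp (1 / (2 * M) * (μ - 2 * V ω)) ∂P
      = Real.exp (1 / (2 * M) * μ) * ∫ ω, Real.exp (-(V ω / M)) ∂P := by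
        rw [← integral_const_mul]
        congr 1 with ω
        rw [← Real.exp_add]; congr 1; field_simp; ring
    _ ≤ Real.exp (1 / (2 * M) * μ) * Real.exp (-(1 / (2 * M) * μ)) := by gcongr
    _ = 1 := by rw [← Real.exp_add]; simp

lemma integral_exp_excess_le_one [IsProbabilityMeasure P] (hX : ∀ t ∈ s, Measurable (X t))
    (hg : Measurable g) (hg_nonneg : ∀ x, 0 ≤ g x) (hg_le : ∀ x, g x ≤ M) (hM : 0 < M)
    {a : ℕ} (ha : 0 < a) (hs : s.card ≤ a) :
    ∫ ω, Real.exp (1 / (2 * (a * M)) * excess P X s g ω) ∂P ≤ 1 := by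
  simp only [excess_eq_integral_sum_sub hX hg hg_nonneg hg_le]
  refine integral_exp_integral_sub_two_mul_le_one (V := fun ω => ∑ t ∈ s, g (X t ω))
    (Finset.measurable_fun_sum _ fun t ht => hg.comp (hX t ht)) (by positivity)
    (fun ω => Finset.sum_nonneg fun t _ => hg_nonneg _) fun ω => ?_
  calc ∑ t ∈ s, g (X t ω) ≤ s.card * M := by
        simpa using Finset.sum_le_card_nsmul s _ M fun t _ => hg_le _
    _ ≤ a * M := by gcongr

lemma integrable_exp_excess [IsProbabilityMeasure P] (hX : ∀ t ∈ s, Measurable (X t))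
    (hg : Measurable g) (hg_nonneg : ∀ x, 0 ≤ g x) (hg_le : ∀ x, g x ≤ M) {θ : ℝ} (hθ : 0 ≤ θ) :
    Integrable (fun ω => Real.exp (θ * excess P X s g ω)) P :=
  .of_bound ((measurable_excess hX hg).const_mul θ).exp.aestronglyMeasurable
    (Real.exp (θ * (s.card * M))) (ae_of_all _ fun ω => by
      rw [Real.norm_of_nonneg (Real.exp_pos _).le]
      have := excess_le (P := P) hX hg hg_nonneg hg_le ω
      gcongr)

end Excess

section Blocks

/-- The times in `{1, …, T}` of the `q`-th block of length `a`. -/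
def block (T a q : ℕ) : Finset ℕ := {t ∈ Finset.Icc 1 T | t / a = q}

/-- The union of the blocks of length `a` whose index is congruent to `r` modulo `2`; distinct
blocks in it are at distance more than `a`. -/
def parityClass (T a r : ℕ) : Finset ℕ := {t ∈ Finset.Icc 1 T | t / a % 2 = r}

lemma block_subset (T a q : ℕ) : block T a q ⊆ Finset.Icc 1 T := Finset.filter_subset _ _

lemma parityClass_subset (T a r : ℕ) : parityClass T a r ⊆ Finset.Icc 1 T :=
  Finset.filter_subset _ _

lemma card_block_le (T : ℕ) {a : ℕ} (ha : 0 < a) (q : ℕ) : (block T a q).card ≤ a := by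
  have : block T a q ⊆ Finset.Ico (q * a) (q * a + a) := by
    intro t ht
    obtain rfl := (Finset.mem_filter.1 ht).2
    exact Finset.mem_Ico.2 ⟨Nat.div_mul_le_self t a, Nat.lt_div_mul_add ha⟩
  simpa using Finset.card_le_card this

lemma add_le_of_mem_block {T a q q' s t : ℕ} (ha : 0 < a) (hs : s ∈ block T a q)
    (ht : t ∈ block T a q') (hq : q + 2 ≤ q') : s + a ≤ t := by
  obtain rfl := (Finset.mem_filter.1 hs).2
  obtain rfl := (Finset.mem_filter.1 ht).2
  have h1 : s < s / a * a + a := Nat.lt_div_mul_add ha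
  have h2 : t / a * a ≤ t := Nat.div_mul_le_self t a
  nlinarith [Nat.mul_le_mul_right a hq]

lemma sum_parityClass_zero_add_sum_parityClass_one {R : Type*} [AddCommMonoid R] (T a : ℕ)
    (f : ℕ → R) :
    ∑ t ∈ parityClass T a 0, f t + ∑ t ∈ parityClass T a 1, f t = ∑ t ∈ Finset.Icc 1 T, f t := by
  rw [← Finset.sum_filter_add_sum_filter_not (Finset.Icc 1 T) (fun t => t / a % 2 = 0) f]
  congr 1
  refine Finset.sum_congr (Finset.filter_congr fun t _ => ?_) fun _ _ => rfl
  omega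

lemma sum_parityClass_eq_sum_block {R : Type*} [AddCommMonoid R] (T a : ℕ) {r : ℕ} (hr : r < 2)
    (f : ℕ → R) :
    ∑ t ∈ parityClass T a r, f t
      = ∑ k ∈ Finset.range (T + 1), ∑ t ∈ block T a (2 * k + r), f t := by
  have half_index_mem : ∀ t ∈ parityClass T a r, t / a / 2 ∈ Finset.range (T + 1) := by
    intro t ht
    have hle : t / a / 2 ≤ t := (Nat.div_le_self _ _).trans (Nat.div_le_self _ _)
    simp only [parityClass, Finset.mem_filter, Finset.mem_Icc, Finset.mem_range] at ht ⊢
    omega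
  rw [← Finset.sum_fiberwise_of_maps_to half_index_mem]
  refine Finset.sum_congr rfl fun k _ => Finset.sum_congr ?_ fun _ _ => rfl
  ext t
  simp only [parityClass, block, Finset.mem_filter, Finset.mem_Icc]
  omega

variable {Ω : Type*} {mΩ : MeasurableSpace Ω} {E : Type*} [MeasurableSpace E] {X : ℕ → Ω → E}
  {T : ℕ}

lemma measurable_sigmaOf (X : ℕ → Ω → E) {s : Finset ℕ} {t : ℕ} (ht : t ∈ s) :
    Measurable[sigmaOf X s] (X t) :=
  (comap_measurable (X t)).mono (le_iSup₂_of_le t ht le_rfl) le_rfl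

lemma sigmaOf_le {s : Finset ℕ} (hX : ∀ t ∈ s, Measurable (X t)) : sigmaOf X s ≤ mΩ :=
  iSup₂_le fun t ht => (hX t ht).comap_le

variable {P : Measure Ω} [IsProbabilityMeasure P]

lemma betaCoeff_sigmaOf_le_betaMixing {a : ℕ} {s s' : Finset ℕ} (hs : s ⊆ Finset.Icc 1 T)
    (hs' : s' ⊆ Finset.Icc 1 T) (hsep : ∀ i ∈ s, ∀ j ∈ s', i + a ≤ j) :
    betaCoeff P (sigmaOf X s) (sigmaOf X s') ≤ betaMixing P T X a := by
  rcases s.eq_empty_or_nonempty with rfl | hne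
  · simp [sigmaOf, betaCoeff_bot_left]
  refine le_trans (betaCoeff_mono ?_ ?_) (le_iSup (fun k => betaCoeff P
    (sigmaOf X (Finset.Icc 1 k ∩ Finset.Icc 1 T))
    (sigmaOf X (Finset.Icc (k + a) T ∩ Finset.Icc 1 T))) (s.max' hne))
  · refine biSup_mono fun t ht => ?_
    exact Finset.mem_inter.2
      ⟨Finset.mem_Icc.2 ⟨(Finset.mem_Icc.1 (hs ht)).1, s.le_max' t ht⟩, hs ht⟩
  · refine biSup_mono fun t ht => ?_
    exact Finset.mem_inter.2 ⟨Finset.mem_Icc.2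
      ⟨hsep _ (s.max'_mem hne) t ht, (Finset.mem_Icc.1 (hs' ht)).2⟩, hs' ht⟩

variable {I : Type*} [Fintype I] {g : I → E → ℝ} {M b : ℝ} {a : ℕ}

lemma integral_min_one_sum_mul_exp_excess_le (hX : ∀ t ∈ Finset.Icc 1 T, Measurable (X t))
    (hg : ∀ i, Measurable (g i)) (hg_nonneg : ∀ i x, 0 ≤ g i x) (hg_le : ∀ i x, g i x ≤ M)
    (hM : 0 < M) (ha : 0 < a) (hb : 0 ≤ b) (hβ : betaMixing P T X a ≤ ENNReal.ofReal b)
    {w : I → ℝ} (hw : ∀ i, 0 ≤ w i) {r : ℕ} (hr : r < 2) :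
    ∫ ω, min 1 (∑ i, w i *
        Real.exp (1 / (2 * (a * M)) * excess P X (parityClass T a r) (g i) ω)) ∂P
      ≤ 2 * b * (T + 1) + ∑ i, w i := by
  let past (k : ℕ) : Finset ℕ := (Finset.range k).biUnion fun j => block T a (2 * j + r)
  have hpast (k : ℕ) : past k ⊆ Finset.Icc 1 T :=
    Finset.biUnion_subset.2 fun j _ => block_subset _ _ _
  have hXs {s : Finset ℕ} (hs : s ⊆ Finset.Icc 1 T) : ∀ t ∈ s, Measurable (X t) :=
    fun t ht => hX t (hs ht)
  have measurable_scaled_excess {𝒜 : MeasurableSpace Ω} {s : Finset ℕ}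
      (hXs : ∀ t ∈ s, Measurable[𝒜] (X t)) :
      Measurable[𝒜] fun ω i => 1 / (2 * (a * M)) * excess P X s (g i) ω :=
    @measurable_pi_lambda _ _ _ 𝒜 _ _ fun i =>
      (measurable_const_mul _).comp (measurable_excess hXs (hg i))
  have key := integral_min_one_sum_mul_exp_sum_le (P := P)
    (𝒜 := fun k => sigmaOf X (past k)) (ℬ := fun k => sigmaOf X (block T a (2 * k + r)))
    (U := fun k ω i => 1 / (2 * (a * M)) * excess P X (block T a (2 * k + r)) (g i) ω)
    (fun k => sigmaOf_le (hXs (hpast k)))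
    (fun k => sigmaOf_le (hXs (block_subset _ _ _)))
    (fun k j hj => measurable_scaled_excess fun t ht =>
      measurable_sigmaOf X (Finset.mem_biUnion.2 ⟨j, Finset.mem_range.2 hj, ht⟩))
    (fun k => measurable_scaled_excess fun t ht => measurable_sigmaOf X ht)
    (fun k i => integrable_exp_excess (hXs (block_subset _ _ _)) (hg i) (hg_nonneg i) (hg_le i)
      (by positivity))
    (fun k i => integral_exp_excess_le_one (hXs (block_subset _ _ _)) (hg i) (hg_nonneg i)
      (hg_le i) hM ha (card_block_le T ha _))
    hb (fun k => (betaCoeff_sigmaOf_le_betaMixing (hpast k) (block_subset _ _ _) ?_).trans hβ)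
    hw (T + 1)
  · simpa only [excess, sum_parityClass_eq_sum_block T a hr, Finset.mul_sum, Nat.cast_add_one]
      using key
  · intro s hs t ht
    obtain ⟨j, hj, hs⟩ := Finset.mem_biUnion.1 hs
    exact add_le_of_mem_block ha hs ht (by have := Finset.mem_range.1 hj; omega)

lemma exists_excess_parityClass_le (hT : 0 < T) (hX : ∀ t ∈ Finset.Icc 1 T, Measurable (X t))
    (hg : ∀ i, Measurable (g i)) (hg_nonneg : ∀ i x, 0 ≤ g i x) (hg_le : ∀ i x, g i x ≤ M)
    (hM : 0 < M) (ha : 0 < a) (hb : 0 ≤ b) (hβ : betaMixing P T X a ≤ ENNReal.ofReal b)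
    {p : I → ℝ} (hp : ∀ i, 0 ≤ p i) {r : ℕ} (hr : r < 2) :
    ∃ Z : Ω → ℝ, Integrable Z P ∧
      ∫ ω, Z ω ∂P ≤ 2 * T * M * b * (T + 1) + 2 * a * M * ∑ i, Real.exp (-p i) ∧
      ∀ i ω, excess P X (parityClass T a r) (g i) ω ≤ 2 * a * M * p i + Z ω := by
  set θ : ℝ := 1 / (2 * (a * M)) with hθ_def
  have hθ : 0 < θ := by positivity
  have hXr : ∀ t ∈ parityClass T a r, Measurable (X t) := fun t ht =>
    hX t (parityClass_subset _ _ _ ht)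
  have hS_le (i : I) (ω : Ω) : excess P X (parityClass T a r) (g i) ω ≤ T * M := by
    refine (excess_le hXr (hg i) (hg_nonneg i) (hg_le i) ω).trans ?_
    gcongr
    simpa using Finset.card_le_card (parityClass_subset T a r)
  set w : I → ℝ := fun i => Real.exp (-p i) / (T * M * θ) with hw_def
  have hw (i : I) : 0 ≤ w i := by positivity
  set Φ : Ω → ℝ := fun ω =>
    min 1 (∑ i, w i * Real.exp (θ * excess P X (parityClass T a r) (g i) ω)) with hΦ_def
  have hΦ : Measurable Φ := measurable_const.min <| Finset.measurable_fun_sum _ fun i _ =>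
    ((measurable_excess hXr (hg i)).const_mul θ).exp.const_mul (w i)
  have hΦi : Integrable Φ P := integrable_of_nonneg_of_le hΦ
    (fun ω => le_min zero_le_one (Finset.sum_nonneg fun i _ => by positivity))
    fun ω => min_le_left _ _
  refine ⟨fun ω => T * M * Φ ω, hΦi.const_mul _, ?_, fun i ω => ?_⟩
  · rw [integral_const_mul]
    calc T * M * ∫ ω, Φ ω ∂P ≤ T * M * (2 * b * (T + 1) + ∑ i, w i) := by
          gcongr
          exact integral_min_one_sum_mul_exp_excess_le hX hg hg_nonneg hg_le hM ha hb hβ hw hr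
      _ = _ := by
          simp only [hw_def, ← Finset.sum_div, hθ_def]
          field_simp
  · have := sub_div_le_mul_min_one_sum_exp (M := T * M) (by positivity) hθ hp (hS_le · ω) i
    have hdiv : p i / θ = 2 * a * M * p i := by rw [hθ_def]; field_simp
    linarith

/-- The summands `p i` are the price of uniformity over the family: a union bound with weights
`exp (-p i)`. -/
lemma exists_integral_sum_le (hT : 0 < T) (hX : ∀ t ∈ Finset.Icc 1 T, Measurable (X t))
    (hg : ∀ i, Measurable (g i)) (hg_nonneg : ∀ i x, 0 ≤ g i x) (hg_le : ∀ i x, g i x ≤ M)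
    (hM : 0 < M) (ha : 0 < a) (hb : 0 ≤ b) (hβ : betaMixing P T X a ≤ ENNReal.ofReal b)
    {p : I → ℝ} (hp : ∀ i, 0 ≤ p i) :
    ∃ Z : Ω → ℝ, Integrable Z P ∧
      ∫ ω, Z ω ∂P ≤ 4 * T * M * b * (T + 1) + 4 * a * M * ∑ i, Real.exp (-p i) ∧
      ∀ i ω, ∫ ω', ∑ t ∈ Finset.Icc 1 T, g i (X t ω') ∂P
        ≤ 2 * ∑ t ∈ Finset.Icc 1 T, g i (X t ω) + 4 * a * M * p i + Z ω := by
  obtain ⟨Z₀, hZ₀, hZ₀_le, h₀⟩ := exists_excess_parityClass_le (P := P) hT hX hg hg_nonneg hg_le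
    hM ha hb hβ hp two_pos
  obtain ⟨Z₁, hZ₁, hZ₁_le, h₁⟩ := exists_excess_parityClass_le (P := P) hT hX hg hg_nonneg hg_le
    hM ha hb hβ hp one_lt_two
  refine ⟨fun ω => Z₀ ω + Z₁ ω, hZ₀.add hZ₁, ?_, fun i ω => ?_⟩
  · rw [integral_add hZ₀ hZ₁]
    linarith
  · have hsplit : excess P X (parityClass T a 0) (g i) ω + excess P X (parityClass T a 1) (g i) ω
        = excess P X (Finset.Icc 1 T) (g i) ω :=
      sum_parityClass_zero_add_sum_parityClass_one T a _
    rw [excess_eq_integral_sum_sub hX (hg i) (hg_nonneg i) (hg_le i)] at hsplit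
    linarith [h₀ i ω, h₁ i ω]

end Blocks

section SqDist

variable {Ω : Type*} {mΩ : MeasurableSpace Ω} {P : Measure Ω} {E : Type*} {T : ℕ}
  {X : ℕ → Ω → E} {f₀ h : E → ℝ} {F : ℝ}

/-- The empirical squared distance of `h` and `f₀` at the outcome `ω`. -/
def sqDist (T : ℕ) (X : ℕ → Ω → E) (f₀ h : E → ℝ) (ω : Ω) : ℝ :=
  (1 / (T : ℝ)) * ∑ t ∈ Finset.Icc 1 T, (h (X t ω) - f₀ (X t ω)) ^ 2

lemma sqDist_nonneg (ω : Ω) : 0 ≤ sqDist T X f₀ h ω :=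
  mul_nonneg (by positivity) (Finset.sum_nonneg fun _ _ => sq_nonneg _)

lemma sq_sub_le {F a b : ℝ} (ha : |a| ≤ F) (hb : |b| ≤ F) : (a - b) ^ 2 ≤ 4 * F ^ 2 := by
  have h1 : |a - b| ≤ 2 * F := (abs_sub a b).trans (by linarith)
  calc (a - b) ^ 2 ≤ (2 * F) ^ 2 := sq_le_sq' (by linarith [abs_le.1 h1]) (abs_le.1 h1).2
    _ = 4 * F ^ 2 := by ring

lemma mean_le (hT : 0 < T) {u : ℕ → ℝ} {c : ℝ} (h : ∀ t ∈ Finset.Icc 1 T, u t ≤ c) :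
    (1 / (T : ℝ)) * ∑ t ∈ Finset.Icc 1 T, u t ≤ c := by
  rw [one_div, inv_mul_le_iff₀ (by exact_mod_cast hT)]
  simpa using Finset.sum_le_card_nsmul _ _ c h

lemma sqDist_le (hT : 0 < T) (hf₀ : ∀ x, |f₀ x| ≤ F) (hh : ∀ x, |h x| ≤ F) (ω : Ω) :
    sqDist T X f₀ h ω ≤ 4 * F ^ 2 :=
  mean_le hT fun _ _ => sq_sub_le (hh _) (hf₀ _)

variable [MeasurableSpace E]

lemma measurable_sqDist (hX : ∀ t ∈ Finset.Icc 1 T, Measurable (X t)) (hf₀ : Measurable f₀)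
    (hh : Measurable h) : Measurable (sqDist T X f₀ h) :=
  Measurable.const_mul (Finset.measurable_fun_sum _ fun t ht =>
    ((hh.comp (hX t ht)).sub (hf₀.comp (hX t ht))).pow_const 2) _

lemma integrable_sqDist [IsFiniteMeasure P] (hT : 0 < T)
    (hX : ∀ t ∈ Finset.Icc 1 T, Measurable (X t)) (hf₀ : Measurable f₀) (hh : Measurable h)
    (hf₀_le : ∀ x, |f₀ x| ≤ F) (hh_le : ∀ x, |h x| ≤ F) : Integrable (sqDist T X f₀ h) P :=
  integrable_of_nonneg_of_le (measurable_sqDist hX hf₀ hh) sqDist_nonneg (sqDist_le hT hf₀_le hh_le)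

lemma exists_integral_sqDist_le [IsProbabilityMeasure P] {I : Type*} [Fintype I] (hT : 0 < T)
    (hX : ∀ t ∈ Finset.Icc 1 T, Measurable (X t)) (hf₀ : Measurable f₀) {h : I → E → ℝ}
    (hh : ∀ i, Measurable (h i)) (hF : 0 < F) (hf₀_le : ∀ x, |f₀ x| ≤ F)
    (hh_le : ∀ i x, |h i x| ≤ F) {a : ℕ} (ha : 0 < a) {b : ℝ} (hb : 0 ≤ b)
    (hβ : betaMixing P T X a ≤ ENNReal.ofReal b) {p : I → ℝ} (hp : ∀ i, 0 ≤ p i) :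
    ∃ Z : Ω → ℝ, Integrable Z P ∧
      ∫ ω, Z ω ∂P ≤ 16 * F ^ 2 * b * (T + 1) + 16 * a * F ^ 2 / T * ∑ i, Real.exp (-p i) ∧
      ∀ i ω, ∫ ω', sqDist T X f₀ (h i) ω' ∂P
        ≤ 2 * sqDist T X f₀ (h i) ω + 16 * a * F ^ 2 / T * p i + Z ω := by
  have hT' : (0 : ℝ) < T := by exact_mod_cast hT
  obtain ⟨Z, hZ, hZ_le, key⟩ := exists_integral_sum_le (P := P) (M := 4 * F ^ 2) hT hX
    (g := fun i x => (h i x - f₀ x) ^ 2) (fun i => ((hh i).sub hf₀).pow_const 2)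
    (fun i x => sq_nonneg _) (fun i x => sq_sub_le (hh_le i x) (hf₀_le x)) (by positivity) ha hb
    hβ hp
  refine ⟨fun ω => 1 / T * Z ω, hZ.const_mul _, ?_, fun i ω => ?_⟩
  · rw [integral_const_mul]
    exact (mul_le_mul_of_nonneg_left hZ_le (by positivity)).trans_eq (by field_simp; ring)
  · simp only [sqDist]
    rw [integral_const_mul]
    exact (mul_le_mul_of_nonneg_left (key i ω) (by positivity)).trans_eq (by field_simp; ring)

end SqDist

/-! ### The noise -/

section Supermartingale

variable {Ω : Type*} {𝒢₀ mΩ : MeasurableSpace Ω} {P : Measure Ω}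

lemma integral_mul_condExp_eq [IsFiniteMeasure P] (hle : 𝒢₀ ≤ mΩ) {g f : Ω → ℝ}
    (hg : Measurable[𝒢₀] g) {c : ℝ} (hgc : ∀ ω, |g ω| ≤ c) (hf : Integrable f P) :
    ∫ ω, g ω * f ω ∂P = ∫ ω, g ω * (P[f | 𝒢₀]) ω ∂P := by
  rw [← integral_condExp hle]
  exact integral_congr_ae (condExp_stronglyMeasurable_mul_of_bound hle hg.stronglyMeasurable hf c
    (ae_of_all _ hgc))

lemma lintegral_mul_ofReal_le [IsFiniteMeasure P] (hle : 𝒢₀ ≤ mΩ) {W : Ω → ℝ} (hW : Measurable W)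
    (hW_nonneg : ∀ ω, 0 ≤ W ω) (hWi : Integrable W P) (hW_le : P[W | 𝒢₀] ≤ᵐ[P] 1)
    {Z : Ω → ℝ≥0∞} (hZ : Measurable[𝒢₀] Z) :
    ∫⁻ ω, Z ω * ENNReal.ofReal (W ω) ∂P ≤ ∫⁻ ω, Z ω ∂P := by
  have trim_le : (P.withDensity fun ω => ENNReal.ofReal (W ω)).trim hle ≤ P.trim hle := by
    refine Measure.le_iff.2 fun s hs => ?_
    rw [trim_measurableSet_eq hle hs, trim_measurableSet_eq hle hs,
      withDensity_apply _ (hle _ hs), ← ofReal_integral_eq_lintegral_ofReal hWi.integrableOn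
        (ae_of_all _ hW_nonneg), ← setIntegral_condExp hle hWi hs]
    refine ENNReal.ofReal_le_of_le_toReal ?_
    calc ∫ ω in s, (P[W | 𝒢₀]) ω ∂P ≤ ∫ _ in s, (1 : ℝ) ∂P :=
          setIntegral_mono_ae integrable_condExp.integrableOn (integrable_const _).integrableOn
            hW_le
      _ = (P s).toReal := by simp [Measure.real]
  calc ∫⁻ ω, Z ω * ENNReal.ofReal (W ω) ∂P
      = ∫⁻ ω, Z ω ∂(P.withDensity fun ω => ENNReal.ofReal (W ω)).trim hle := by
        rw [lintegral_trim hle hZ, lintegral_withDensity_eq_lintegral_mul _ hW.ennreal_ofReal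
          (hZ.mono hle le_rfl)]
        simp only [Pi.mul_apply, mul_comm]
    _ ≤ ∫⁻ ω, Z ω ∂P.trim hle := lintegral_mono' trim_le le_rfl
    _ = ∫⁻ ω, Z ω ∂P := lintegral_trim hle hZ

lemma lintegral_prod_ofReal_le_one [IsProbabilityMeasure P] {𝒢 : Filtration ℕ mΩ} {T : ℕ}
    {W : ℕ → Ω → ℝ} (hW : ∀ t ∈ Finset.Icc 1 T, Measurable[𝒢 t] (W t))
    (hW_nonneg : ∀ t ∈ Finset.Icc 1 T, ∀ ω, 0 ≤ W t ω)
    (hWi : ∀ t ∈ Finset.Icc 1 T, Integrable (W t) P)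
    (hW_le : ∀ t ∈ Finset.Icc 1 T, P[W t | 𝒢 (t - 1)] ≤ᵐ[P] 1) :
    ∫⁻ ω, ∏ t ∈ Finset.Icc 1 T, ENNReal.ofReal (W t ω) ∂P ≤ 1 := by
  induction T with
  | zero => simp
  | succ n ih =>
    have hsub : Finset.Icc 1 n ⊆ Finset.Icc 1 (n + 1) := Finset.Icc_subset_Icc_right n.le_succ
    have hlast : n + 1 ∈ Finset.Icc 1 (n + 1) := by simp
    simp only [Finset.prod_Icc_succ_top (Nat.le_add_left 1 n)]
    refine (lintegral_mul_ofReal_le (𝒢.le n) ((hW _ hlast).mono (𝒢.le _) le_rfl)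
      (hW_nonneg _ hlast) (hWi _ hlast) (hW_le _ hlast) ?_).trans
      (ih (fun t ht => hW t (hsub ht)) (fun t ht => hW_nonneg t (hsub ht))
        (fun t ht => hWi t (hsub ht)) fun t ht => hW_le t (hsub ht))
    exact Finset.measurable_fun_prod _ fun t ht =>
      ((hW t (hsub ht)).mono (𝒢.mono (Finset.mem_Icc.1 ht).2) le_rfl).ennreal_ofReal

lemma exp_le_add_exp_sq (x : ℝ) : Real.exp x ≤ x + Real.exp (x ^ 2) := by
  rcases le_or_gt |x| 1 with h | h
  · have h1 := (abs_le.1 (Real.abs_exp_sub_one_sub_id_le h)).2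
    linarith [Real.add_one_le_exp (x ^ 2)]
  · rcases lt_abs.1 h with h | h
    · have : Real.exp x ≤ Real.exp (x ^ 2) := Real.exp_le_exp.2 (by nlinarith)
      linarith
    · have h1 : Real.exp x ≤ 1 := Real.exp_le_one_iff.2 (by linarith)
      nlinarith [Real.add_one_le_exp (x ^ 2)]

lemma exp_mul_le_one_add {q y : ℝ} (h0 : 0 ≤ q) (h1 : q ≤ 1) :
    Real.exp (q * y) ≤ 1 + q * (Real.exp y - 1) := by
  have := convexOn_exp.2 (Set.mem_univ y) (Set.mem_univ 0) h0 (sub_nonneg.2 h1) (by ring)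
  simp only [smul_eq_mul, mul_zero, add_zero, Real.exp_zero, mul_one] at this
  linarith

lemma sq_mul_sq_le_one {k c : ℝ} (hk : 0 < k) (hck : |c| * k ≤ 1) : k ^ 2 * c ^ 2 ≤ 1 := by
  have := pow_le_one₀ (n := 2) (by positivity) hck
  rwa [mul_pow, sq_abs, mul_comm] at this

lemma exp_mul_sub_le {k c v : ℝ} (hk : 0 < k) (hck : |c| * k ≤ 1) :
    Real.exp (c * v - k ^ 2 * c ^ 2)
      ≤ Real.exp (-(k ^ 2 * c ^ 2)) *
        (1 - k ^ 2 * c ^ 2 + c * v + k ^ 2 * c ^ 2 * Real.exp (v ^ 2 / k ^ 2)) := by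
  have hsq : (c * v) ^ 2 = k ^ 2 * c ^ 2 * (v ^ 2 / k ^ 2) := by field_simp
  rw [sub_eq_neg_add, Real.exp_add]
  gcongr
  calc Real.exp (c * v) ≤ c * v + Real.exp (k ^ 2 * c ^ 2 * (v ^ 2 / k ^ 2)) :=
        hsq ▸ exp_le_add_exp_sq _
    _ ≤ c * v + (1 + k ^ 2 * c ^ 2 * (Real.exp (v ^ 2 / k ^ 2) - 1)) := by
        gcongr; exact exp_mul_le_one_add (by positivity) (sq_mul_sq_le_one hk hck)
    _ = _ := by ring

lemma abs_le_mul_exp_sq_div {k : ℝ} (hk : 0 < k) (v : ℝ) :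
    |v| ≤ k * Real.exp (v ^ 2 / k ^ 2) := by
  have h : |v| / k ≤ v ^ 2 / k ^ 2 + 1 := by
    rw [← sq_abs, ← div_pow]; nlinarith [sq_nonneg (|v| / k - 1)]
  rw [div_le_iff₀' hk] at h
  exact h.trans (by gcongr; exact Real.add_one_le_exp _)

variable {v c : Ω → ℝ} {k : ℝ}

lemma integrable_of_integrable_exp_sq_div (hv : Measurable v) (hk : 0 < k)
    (hi : Integrable (fun ω => Real.exp (v ω ^ 2 / k ^ 2)) P) : Integrable v P :=
  (hi.const_mul k).mono' hv.aestronglyMeasurable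
    (ae_of_all _ fun _ => abs_le_mul_exp_sq_div hk _)

lemma integrable_exp_mul_sub (hv : Measurable v) (hk : 0 < k)
    (hi : Integrable (fun ω => Real.exp (v ω ^ 2 / k ^ 2)) P) (hc : Measurable c)
    (hck : ∀ ω, |c ω| * k ≤ 1) :
    Integrable (fun ω => Real.exp (c ω * v ω - k ^ 2 * c ω ^ 2)) P := by
  have hm : Measurable fun ω => Real.exp (c ω * v ω - k ^ 2 * c ω ^ 2) := by fun_prop
  refine (hi.const_mul (Real.exp 1)).mono' hm.aestronglyMeasurable (ae_of_all _ fun ω => ?_)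
  rw [Real.norm_of_nonneg (Real.exp_pos _).le, ← Real.exp_add, Real.exp_le_exp]
  have hcv : |c ω * v ω| ≤ |v ω| / k := by
    rw [abs_mul, le_div_iff₀ hk]
    nlinarith [mul_le_mul_of_nonneg_left (hck ω) (abs_nonneg (v ω))]
  have hvk : |v ω| / k ≤ 1 + v ω ^ 2 / k ^ 2 := by
    rw [← sq_abs (v ω), ← div_pow]; nlinarith [sq_nonneg (|v ω| / k - 1)]
  have : 0 ≤ k ^ 2 * c ω ^ 2 := by positivity
  linarith [le_abs_self (c ω * v ω)]

lemma condExp_add_mul_add_mul [IsFiniteMeasure P] (hle : 𝒢₀ ≤ mΩ) {A α β u e : Ω → ℝ}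
    (hA : Measurable[𝒢₀] A) (hα : Measurable[𝒢₀] α) (hβ : Measurable[𝒢₀] β) {a b : ℝ}
    (hα_le : ∀ ω, |α ω| ≤ a) (hβ_le : ∀ ω, |β ω| ≤ b) (hAi : Integrable A P) (hu : Integrable u P)
    (he : Integrable e P) :
    Integrable (fun ω => A ω + α ω * u ω + β ω * e ω) P ∧
      P[fun ω => A ω + α ω * u ω + β ω * e ω | 𝒢₀]
        =ᵐ[P] fun ω => A ω + α ω * (P[u | 𝒢₀]) ω + β ω * (P[e | 𝒢₀]) ω := by
  have hαu : Integrable (fun ω => α ω * u ω) P :=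
    hu.bdd_mul (hα.mono hle le_rfl).aestronglyMeasurable (ae_of_all _ hα_le)
  have hβe : Integrable (fun ω => β ω * e ω) P :=
    he.bdd_mul (hβ.mono hle le_rfl).aestronglyMeasurable (ae_of_all _ hβ_le)
  refine ⟨(hAi.add hαu).add hβe, (condExp_add (hAi.add hαu) hβe 𝒢₀).trans ?_⟩
  filter_upwards [condExp_add hAi hαu 𝒢₀,
    condExp_stronglyMeasurable_mul_of_bound hle hα.stronglyMeasurable hu _ (ae_of_all _ hα_le),
    condExp_stronglyMeasurable_mul_of_bound hle hβ.stronglyMeasurable he _ (ae_of_all _ hβ_le)]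
    with ω h_add h_α h_β
  rw [Pi.add_apply, h_add, Pi.add_apply,
    condExp_of_stronglyMeasurable hle hA.stronglyMeasurable hAi]
  exact congr_arg₂ _ (congr_arg _ h_α) h_β

/-- Conditional sub-Gaussianity: bound the exponential by an affine function of `v` and
`exp (v² / k²)`, whose conditional expectations are controlled. -/
lemma condExp_exp_mul_sub_le_one [IsFiniteMeasure P] (hle : 𝒢₀ ≤ mΩ) (hv : Measurable v)
    (hk : 0 < k) (hv_centered : P[v | 𝒢₀] =ᵐ[P] 0)
    (hi : Integrable (fun ω => Real.exp (v ω ^ 2 / k ^ 2)) P)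
    (hv_sub : ∀ᵐ ω ∂P, (P[fun ω' => Real.exp (v ω' ^ 2 / k ^ 2) | 𝒢₀]) ω ≤ 2)
    (hc : Measurable[𝒢₀] c) (hck : ∀ ω, |c ω| * k ≤ 1) :
    P[fun ω => Real.exp (c ω * v ω - k ^ 2 * c ω ^ 2) | 𝒢₀] ≤ᵐ[P] 1 := by
  set q : Ω → ℝ := fun ω => k ^ 2 * c ω ^ 2
  have hq : Measurable[𝒢₀] q := (hc.pow_const 2).const_mul _
  have hq_nonneg (ω : Ω) : 0 ≤ q ω := by positivity
  have hq_le (ω : Ω) : q ω ≤ 1 := sq_mul_sq_le_one hk (hck ω)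
  have hexp : Measurable[𝒢₀] fun ω => Real.exp (-q ω) := Real.measurable_exp.comp hq.neg
  have exp_mul_le (ω : Ω) {x y : ℝ} (h : |x| ≤ y) : |Real.exp (-q ω) * x| ≤ y := by
    rw [abs_mul, abs_of_pos (Real.exp_pos _)]
    exact (mul_le_of_le_one_left (abs_nonneg _)
      (Real.exp_le_one_iff.2 (by linarith [hq_nonneg ω]))).trans h
  have hAm : Measurable[𝒢₀] fun ω => Real.exp (-q ω) * (1 - q ω) :=
    hexp.mul (measurable_const.sub hq)
  obtain ⟨hR, hcond⟩ := condExp_add_mul_add_mul hle hAm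
    (α := fun ω => Real.exp (-q ω) * c ω) (β := fun ω => Real.exp (-q ω) * q ω)
    (hexp.mul hc) (hexp.mul hq)
    (fun ω => exp_mul_le ω ((le_div_iff₀ hk).2 (hck ω)))
    (fun ω => exp_mul_le ω ((abs_of_nonneg (hq_nonneg ω)).trans_le (hq_le ω)))
    (.of_bound (hAm.mono hle le_rfl).aestronglyMeasurable 1 (ae_of_all _ fun ω => exp_mul_le ω
      (abs_le.2 ⟨by linarith [hq_le ω], by linarith [hq_nonneg ω]⟩)))
    (integrable_of_integrable_exp_sq_div hv hk hi) hi
  have hbound := condExp_mono (m := 𝒢₀) (integrable_exp_mul_sub hv hk hi (hc.mono hle le_rfl) hck)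
    hR (ae_of_all _ fun ω => (exp_mul_sub_le hk (hck ω)).trans_eq (by ring))
  filter_upwards [hbound, hcond, hv_centered, hv_sub] with ω hω hω' h_centered h_sub
  refine hω.trans ?_
  rw [hω', h_centered, Pi.zero_apply, mul_zero, add_zero]
  calc Real.exp (-q ω) * (1 - q ω) + Real.exp (-q ω) * q ω * _
      ≤ Real.exp (-q ω) * (1 - q ω) + Real.exp (-q ω) * q ω * 2 := by
        have := hq_nonneg ω
        gcongr
    _ = Real.exp (-q ω) * (q ω + 1) := by ring
    _ ≤ Real.exp (-q ω) * Real.exp (q ω) := by gcongr; exact Real.add_one_le_exp _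
    _ = 1 := by rw [← Real.exp_add]; simp

end Supermartingale

section Noise

variable {Ω : Type*} {mΩ : MeasurableSpace Ω} {P : Measure Ω}

lemma integrable_and_integral_le_one_of_lintegral_le {f : Ω → ℝ} (hf : Measurable f)
    (hf_nonneg : ∀ ω, 0 ≤ f ω) (h : ∫⁻ ω, ENNReal.ofReal (f ω) ∂P ≤ 1) :
    Integrable f P ∧ ∫ ω, f ω ∂P ≤ 1 := by
  refine ⟨⟨hf.aestronglyMeasurable, ?_⟩, ?_⟩
  · rw [hasFiniteIntegral_iff_ofReal (ae_of_all _ hf_nonneg)]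
    exact h.trans_lt ENNReal.one_lt_top
  · rw [integral_eq_lintegral_of_nonneg_ae (ae_of_all _ hf_nonneg) hf.aestronglyMeasurable]
    exact ENNReal.toReal_le_of_le_ofReal zero_le_one (by simpa using h)

lemma exists_le_div_add_of_integral_exp_le_one {I : Type*} [Fintype I] {θ : ℝ} (hθ : 0 < θ)
    {s : I → Ω → ℝ} (hi : ∀ i, Integrable (fun ω => Real.exp (θ * s i ω)) P)
    (hs : ∀ i, ∫ ω, Real.exp (θ * s i ω) ∂P ≤ 1) (p : I → ℝ) :
    ∃ Z : Ω → ℝ, Integrable Z P ∧ ∫ ω, Z ω ∂P ≤ 1 / θ * ∑ i, Real.exp (-p i) ∧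
      ∀ i ω, s i ω ≤ p i / θ + Z ω := by
  refine ⟨fun ω => ∑ i, Real.exp (-p i) / θ * Real.exp (θ * s i ω),
    integrable_finsetSum _ fun i _ => (hi i).const_mul _, ?_, fun i ω => ?_⟩
  · rw [integral_finsetSum _ fun i _ => (hi i).const_mul _, Finset.mul_sum]
    refine Finset.sum_le_sum fun i _ => ?_
    rw [integral_const_mul, one_div_mul_eq_div]
    exact mul_le_of_le_one_right (by positivity) (hs i)
  · linarith [sub_div_le_sum_exp hθ (s · ω) p i]

lemma abs_mul_sub_mul_le_one {e a b F k C : ℝ} (hF : 1 ≤ F) (hk : 1 ≤ k) (hC : 1 ≤ C)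
    (he : |e| ≤ C) (ha : |a| ≤ F) (hb : |b| ≤ F) :
    |1 / (4 * F ^ 2 * k ^ 2 * C ^ 2) * (e * (a - b))| * k ≤ 1 := by
  calc |1 / (4 * F ^ 2 * k ^ 2 * C ^ 2) * (e * (a - b))| * k
      = 1 / (4 * F ^ 2 * k ^ 2 * C ^ 2) * (|e| * |a - b|) * k := by
        rw [abs_mul, abs_mul, abs_of_pos (by positivity)]
    _ ≤ 1 / (4 * F ^ 2 * k ^ 2 * C ^ 2) * (C * (F + F)) * k := by
        gcongr
        exact (abs_sub _ _).trans (add_le_add ha hb)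
    _ = 1 / (2 * (F * k * C)) := by field_simp; ring
    _ ≤ 1 := by
        have := one_le_mul_of_one_le_of_one_le (one_le_mul_of_one_le_of_one_le hF hk) hC
        rw [div_le_one (by positivity)]; linarith

lemma sq_mul_sq_mul_sub_le {e x F k C : ℝ} (hF : 1 ≤ F) (hk : 0 < k) (hC : 0 < C)
    (he : |e| ≤ C) :
    k ^ 2 * (1 / (4 * F ^ 2 * k ^ 2 * C ^ 2) * (e * x)) ^ 2
      ≤ 1 / (16 * F ^ 2 * k ^ 2 * C ^ 2) * x ^ 2 := by
  have he_sq : e ^ 2 ≤ F ^ 2 * C ^ 2 := by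
    rw [← sq_abs]
    exact (pow_le_pow_left₀ (abs_nonneg e) he 2).trans
      (le_mul_of_one_le_left (by positivity) (one_le_pow₀ hF))
  have hF₀ : 0 < F := zero_lt_one.trans_le hF
  calc k ^ 2 * (1 / (4 * F ^ 2 * k ^ 2 * C ^ 2) * (e * x)) ^ 2
      = 1 / (16 * F ^ 2 * k ^ 2 * C ^ 2) * x ^ 2 * (e ^ 2 / (F ^ 2 * C ^ 2)) := by
        field_simp; ring
    _ ≤ 1 / (16 * F ^ 2 * k ^ 2 * C ^ 2) * x ^ 2 * 1 := by
        gcongr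
        exact (div_le_one (by positivity)).2 he_sq
    _ = _ := mul_one _

variable {𝒢 : Filtration ℕ mΩ} {d T : ℕ} {m η : (Fin d → ℝ) → ℝ} {X : ℕ → Ω → Fin d → ℝ}
  {Y v : ℕ → Ω → ℝ} {Cη C₁ C₂ K : ℝ}

lemma measurableSet_cube (d : ℕ) : MeasurableSet (cube d) := measurableSet_Icc

lemma abs_indicator_cube_le {d : ℕ} {h : (Fin d → ℝ) → ℝ} {c : ℝ} (hc : 0 ≤ c)
    (hh : ∀ x ∈ cube d, |h x| ≤ c) (x : Fin d → ℝ) : |(cube d).indicator h x| ≤ c := by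
  by_cases hx : x ∈ cube d
  · rw [Set.indicator_of_mem hx]; exact hh x hx
  · rwa [Set.indicator_of_notMem hx, abs_zero]

/-- The cross term between the noise and `h - f₀` in the expansion of the empirical risk of `h`.
Only covariates in the cube matter, so that the volatility may be assumed to be bounded. -/
def noise (T : ℕ) (X : ℕ → Ω → Fin d → ℝ) (v : ℕ → Ω → ℝ) (η f₀ h : (Fin d → ℝ) → ℝ)
    (ω : Ω) : ℝ :=
  (2 / (T : ℝ)) * ∑ t ∈ Finset.Icc 1 T,
    (cube d).indicator η (X t ω) * v t ω * (h (X t ω) - f₀ (X t ω))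

namespace RegressionModel

variable (hm : RegressionModel P 𝒢 T m η X Y v Cη C₁ C₂ K)

include hm

lemma measurable_X : ∀ t ∈ Finset.Icc 1 T, Measurable (X t) := fun t ht =>
  (hm.predictable t ht).mono (𝒢.le _) le_rfl

lemma measurable_v : ∀ t ∈ Finset.Icc 1 T, Measurable (v t) := fun t ht =>
  (hm.adapted t ht).mono (𝒢.le _) le_rfl

lemma measurable_Y : ∀ t ∈ Finset.Icc 1 T, Measurable (Y t) := fun t ht => by
  rw [funext (hm.model t ht)]
  exact (hm.measurable_m.comp (hm.measurable_X t ht)).add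
    ((hm.measurable_η.comp (hm.measurable_X t ht)).mul (hm.measurable_v t ht))

lemma measurable_indicator_η : Measurable ((cube d).indicator η) :=
  hm.measurable_η.indicator (measurableSet_cube d)

lemma abs_indicator_η_le {C : ℝ} (hC : 0 ≤ C) (hCη : Cη ≤ C) (x : Fin d → ℝ) :
    |(cube d).indicator η x| ≤ C :=
  abs_indicator_cube_le hC (fun x hx => (hm.η_le x hx).trans hCη) x

lemma measurable_noise {f₀ h : (Fin d → ℝ) → ℝ} (hf₀ : Measurable f₀) (hh : Measurable h) :
    Measurable (noise T X v η f₀ h) :=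
  Measurable.const_mul (Finset.measurable_fun_sum _ fun t ht =>
    ((hm.measurable_indicator_η.comp (hm.measurable_X t ht)).mul (hm.measurable_v t ht)).mul
      ((hh.comp (hm.measurable_X t ht)).sub (hf₀.comp (hm.measurable_X t ht)))) _

section

variable {t : ℕ} (ht : t ∈ Finset.Icc 1 T)

include ht

lemma integrable_v : Integrable (v t) P := by
  obtain ⟨k, hk, -, hi, -⟩ := hm.subgaussian t ht
  exact integrable_of_integrable_exp_sq_div (hm.measurable_v t ht) hk hi

lemma condExp_exp_sq_div_le {K' : ℝ} (hK : K ≤ K') :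
    Integrable (fun ω => Real.exp (v t ω ^ 2 / K' ^ 2)) P ∧
      ∀ᵐ ω ∂P, (P[fun ω' => Real.exp (v t ω' ^ 2 / K' ^ 2) | 𝒢 (t - 1)]) ω ≤ 2 := by
  obtain ⟨k, hk, hkK, hi, hle⟩ := hm.subgaussian t ht
  have hexp (ω : Ω) : Real.exp (v t ω ^ 2 / K' ^ 2) ≤ Real.exp (v t ω ^ 2 / k ^ 2) := by
    gcongr; exact hkK.trans hK
  have hi' : Integrable (fun ω => Real.exp (v t ω ^ 2 / K' ^ 2)) P :=
    hi.mono' (((hm.measurable_v t ht).pow_const 2).div_const _).exp.aestronglyMeasurable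
      (ae_of_all _ fun ω => by rw [Real.norm_of_nonneg (Real.exp_pos _).le]; exact hexp ω)
  refine ⟨hi', ?_⟩
  filter_upwards [condExp_mono (m := 𝒢 (t - 1)) hi' hi (ae_of_all _ hexp), hle] with ω h₁ h₂
  exact h₁.trans h₂

variable [IsProbabilityMeasure P]

lemma integrable_v_sq : Integrable (fun ω => v t ω ^ 2) P := by
  by_contra h
  have h_var := hm.variance_one t ht
  rw [condExp_of_not_integrable h] at h_var
  obtain ⟨ω, hω⟩ := h_var.exists
  simp at hω

lemma integral_v_sq : ∫ ω, v t ω ^ 2 ∂P = 1 := by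
  rw [← integral_condExp (𝒢.le (t - 1)), integral_congr_ae (hm.variance_one t ht)]
  simp

lemma integral_abs_v_le : ∫ ω, |v t ω| ∂P ≤ 1 := by
  have hi := hm.integrable_v_sq ht
  calc ∫ ω, |v t ω| ∂P ≤ ∫ ω, (1 + v t ω ^ 2) / 2 ∂P :=
        integral_mono (hm.integrable_v ht).abs (((integrable_const 1).add hi).div_const 2)
          fun ω => by nlinarith [sq_nonneg (|v t ω| - 1), sq_abs (v t ω)]
    _ = 1 := by
      rw [integral_div, integral_add (integrable_const 1) hi, hm.integral_v_sq ht]; simp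

end

variable [IsProbabilityMeasure P]

lemma lintegral_exp_sum_mul_sub_le_one {c : (Fin d → ℝ) → ℝ} (hc : Measurable c) {k : ℝ}
    (hk : 0 < k) (hKk : K ≤ k) (hck : ∀ x, |c x| * k ≤ 1) :
    ∫⁻ ω, ENNReal.ofReal (Real.exp (∑ t ∈ Finset.Icc 1 T,
      (c (X t ω) * v t ω - k ^ 2 * c (X t ω) ^ 2))) ∂P ≤ 1 := by
  simp_rw [Real.exp_sum, ENNReal.ofReal_prod_of_nonneg fun _ _ => (Real.exp_pos _).le]
  refine lintegral_prod_ofReal_le_one (𝒢 := 𝒢) (fun t ht => ?_)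
    (fun _ _ _ => (Real.exp_pos _).le) (fun t ht => ?_) fun t ht => ?_
  · have hX : Measurable[𝒢 t] fun ω => c (X t ω) :=
      hc.comp ((hm.predictable t ht).mono (𝒢.mono (Nat.sub_le t 1)) le_rfl)
    exact Real.measurable_exp.comp
      ((hX.mul (hm.adapted t ht)).sub ((hX.pow_const 2).const_mul _))
  · exact integrable_exp_mul_sub (hm.measurable_v t ht) hk (hm.condExp_exp_sq_div_le ht hKk).1
      (hc.comp (hm.measurable_X t ht)) fun ω => hck _
  · obtain ⟨hi, hle⟩ := hm.condExp_exp_sq_div_le ht hKk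
    exact condExp_exp_mul_sub_le_one (𝒢.le _) (hm.measurable_v t ht) hk (hm.centered t ht) hi hle
      (hc.comp (hm.predictable t ht)) fun ω => hck _

variable {f₀ h : (Fin d → ℝ) → ℝ} (hf₀ : Measurable f₀) {F : ℝ} (hf₀_le : ∀ x, |f₀ x| ≤ F)

include hf₀ hf₀_le

section

variable (hh : Measurable h) (hh_le : ∀ x, |h x| ≤ F)

include hh hh_le

lemma integral_noise :
    Integrable (noise T X v η f₀ h) P ∧ ∫ ω, noise T X v η f₀ h ω ∂P = 0 := by
  set g : (Fin d → ℝ) → ℝ := fun x => (cube d).indicator η x * (h x - f₀ x) with hg_def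
  have hg : Measurable g := hm.measurable_indicator_η.mul (hh.sub hf₀)
  have hg_le (x : Fin d → ℝ) : |g x| ≤ max 0 Cη * (F + F) := by
    rw [hg_def, abs_mul]
    have := hm.abs_indicator_η_le (le_max_left _ _) (le_max_right _ _) x
    gcongr
    exact (abs_sub _ _).trans (add_le_add (hh_le x) (hf₀_le x))
  have hnoise : noise T X v η f₀ h
      = fun ω => (2 / (T : ℝ)) * ∑ t ∈ Finset.Icc 1 T, g (X t ω) * v t ω := by
    funext ω
    simp only [noise, hg_def, mul_right_comm]
  have hi : ∀ t ∈ Finset.Icc 1 T, Integrable (fun ω => g (X t ω) * v t ω) P := fun t ht =>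
    (hm.integrable_v ht).bdd_mul (hg.comp (hm.measurable_X t ht)).aestronglyMeasurable
      (ae_of_all _ fun ω => hg_le _)
  rw [hnoise]
  refine ⟨(integrable_finsetSum _ hi).const_mul _, ?_⟩
  rw [integral_const_mul, integral_finsetSum _ hi, Finset.sum_eq_zero, mul_zero]
  intro t ht
  rw [integral_mul_condExp_eq (𝒢.le (t - 1)) (g := fun ω => g (X t ω))
    (hg.comp (hm.predictable t ht)) (fun ω => hg_le _) (hm.integrable_v ht)]
  refine integral_eq_zero_of_ae ?_
  filter_upwards [hm.centered t ht] with ω hω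
  simp [hω]

lemma integral_exp_noise_sub_le_one (hF : 1 ≤ F) {C k : ℝ} (hC : 1 ≤ C)
    (hCη : Cη ≤ C) (hk : 1 ≤ k) (hKk : K ≤ k) :
    Integrable (fun ω => Real.exp (T / (8 * F ^ 2 * k ^ 2 * C ^ 2) *
        (noise T X v η f₀ h ω - 1 / 2 * sqDist T X f₀ h ω))) P ∧
      ∫ ω, Real.exp (T / (8 * F ^ 2 * k ^ 2 * C ^ 2) *
        (noise T X v η f₀ h ω - 1 / 2 * sqDist T X f₀ h ω)) ∂P ≤ 1 := by
  set c : (Fin d → ℝ) → ℝ := fun x =>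
    1 / (4 * F ^ 2 * k ^ 2 * C ^ 2) * ((cube d).indicator η x * (h x - f₀ x)) with hc_def
  have hη (x : Fin d → ℝ) := hm.abs_indicator_η_le (zero_le_one.trans hC) hCη x
  have hc : Measurable c := (hm.measurable_indicator_η.mul (hh.sub hf₀)).const_mul _
  have hexp_le (ω : Ω) : T / (8 * F ^ 2 * k ^ 2 * C ^ 2) *
      (noise T X v η f₀ h ω - 1 / 2 * sqDist T X f₀ h ω)
        ≤ ∑ t ∈ Finset.Icc 1 T, (c (X t ω) * v t ω - k ^ 2 * c (X t ω) ^ 2) := by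
    rcases T.eq_zero_or_pos with rfl | hT
    · simp
    have hsum : T / (8 * F ^ 2 * k ^ 2 * C ^ 2) *
        (noise T X v η f₀ h ω - 1 / 2 * sqDist T X f₀ h ω)
          = ∑ t ∈ Finset.Icc 1 T, (c (X t ω) * v t ω -
            1 / (16 * F ^ 2 * k ^ 2 * C ^ 2) * (h (X t ω) - f₀ (X t ω)) ^ 2) := by
      have hT' : (T : ℝ) ≠ 0 := by positivity
      simp only [noise, sqDist, mul_sub, Finset.mul_sum, ← Finset.sum_sub_distrib]
      refine Finset.sum_congr rfl fun t _ => ?_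
      simp only [hc_def]
      field_simp
      ring
    rw [hsum]
    exact Finset.sum_le_sum fun t _ =>
      sub_le_sub_left (sq_mul_sq_mul_sub_le hF (by positivity) (by positivity) (hη _)) _
  refine integrable_and_integral_le_one_of_lintegral_le
    (((hm.measurable_noise hf₀ hh).sub
      ((measurable_sqDist hm.measurable_X hf₀ hh).const_mul _)).const_mul _).exp
    (fun ω => (Real.exp_pos _).le) (le_trans (lintegral_mono fun ω => ?_)
      (hm.lintegral_exp_sum_mul_sub_le_one hc (by positivity) hKk fun x =>
        abs_mul_sub_mul_le_one hF hk hC (hη x) (hh_le x) (hf₀_le x)))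
  exact ENNReal.ofReal_le_ofReal (Real.exp_le_exp.2 (hexp_le ω))

end

lemma exists_noise_le (hT : 0 < T) (hF : 1 ≤ F) {C k : ℝ} (hC : 1 ≤ C) (hCη : Cη ≤ C)
    (hk : 1 ≤ k) (hKk : K ≤ k) {I : Type*} [Fintype I] {h : I → (Fin d → ℝ) → ℝ}
    (hh : ∀ i, Measurable (h i)) (hh_le : ∀ i x, |h i x| ≤ F) (p : I → ℝ) :
    ∃ Z : Ω → ℝ, Integrable Z P ∧
      ∫ ω, Z ω ∂P ≤ 8 * F ^ 2 * k ^ 2 * C ^ 2 / T * ∑ i, Real.exp (-p i) ∧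
      ∀ i ω, noise T X v η f₀ (h i) ω ≤
        1 / 2 * sqDist T X f₀ (h i) ω + 8 * F ^ 2 * k ^ 2 * C ^ 2 / T * p i + Z ω := by
  have hexp (i : I) := hm.integral_exp_noise_sub_le_one hf₀ hf₀_le (hh i) (hh_le i) hF hC hCη hk hKk
  obtain ⟨Z, hZi, hZ, hle⟩ := exists_le_div_add_of_integral_exp_le_one
    (θ := T / (8 * F ^ 2 * k ^ 2 * C ^ 2)) (by positivity) (fun i => (hexp i).1)
    (fun i => (hexp i).2) p
  refine ⟨Z, hZi, by simpa only [one_div_div] using hZ, fun i ω => ?_⟩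
  have := hle i ω
  rw [div_div_eq_mul_div, mul_comm (p i), ← div_mul_eq_mul_div] at this
  linarith

end RegressionModel

end Noise

/-! ### Perturbation of the parameters of a network -/

section Norms

variable {m n : ℕ}

/-- The Euclidean norm of a vector. The type `Fin n → ℝ` itself carries the maximum norm. -/
def l2 (x : Fin n → ℝ) : ℝ := ‖WithLp.toLp 2 x‖

lemma l2_nonneg (x : Fin n → ℝ) : 0 ≤ l2 x := norm_nonneg _

lemma l2_eq_sqrt (x : Fin n → ℝ) : l2 x = √(∑ i, x i ^ 2) := by
  simp [l2, EuclideanSpace.norm_eq]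

lemma l2_add_le (x y : Fin n → ℝ) : l2 (x + y) ≤ l2 x + l2 y := by
  simpa [l2] using norm_add_le (WithLp.toLp 2 x) (WithLp.toLp 2 y)

lemma l2_le_mul_l2 {x y : Fin n → ℝ} {c : ℝ} (hc : 0 ≤ c) (h : ∀ i, |x i| ≤ c * |y i|) :
    l2 x ≤ c * l2 y := by
  rw [l2_eq_sqrt, l2_eq_sqrt, Real.sqrt_le_left (by positivity), mul_pow,
    Real.sq_sqrt (by positivity), Finset.mul_sum]
  gcongr with i
  rw [← sq_abs (x i), ← sq_abs (y i), ← mul_pow]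
  gcongr
  exact h i

lemma l2_le_mul_sqrt {x : Fin n → ℝ} {c : ℝ} (hc : 0 ≤ c) (h : ∀ i, |x i| ≤ c) :
    l2 x ≤ c * √n := by
  refine (l2_le_mul_l2 (y := fun _ => 1) hc fun i => by simpa using h i).trans_eq ?_
  simp [l2_eq_sqrt]

lemma abs_apply_le_l2 (x : Fin n → ℝ) (i : Fin n) : |x i| ≤ l2 x := by
  rw [l2_eq_sqrt, ← Real.sqrt_sq_eq_abs]
  exact Real.sqrt_le_sqrt (Finset.single_le_sum (f := fun i => x i ^ 2)
    (fun _ _ => sq_nonneg _) (Finset.mem_univ i))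

lemma l2_le_sqrt_of_mem_cube {x : Fin n → ℝ} (hx : x ∈ cube n) : l2 x ≤ √n := by
  simpa using l2_le_mul_sqrt zero_le_one fun i => abs_le.2 ⟨by linarith [show 0 ≤ x i from hx.1 i],
    show x i ≤ 1 from hx.2 i⟩

/-- The Euclidean norm of a list of parameters. -/
def listNorm (l : List ℝ) : ℝ := √(l.map (· ^ 2)).sum

/-- The number of nonzero entries of a list of parameters. -/
def nnz (l : List ℝ) : ℕ := l.countP (· ≠ 0)

lemma nnz_le_length (l : List ℝ) : nnz l ≤ l.length := List.countP_le_length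

lemma nnz_append (l l' : List ℝ) : nnz (l ++ l') = nnz l + nnz l' := List.countP_append

lemma listNorm_le_mul_sqrt_nnz {l : List ℝ} {B : ℝ} (hB : 0 ≤ B) (h : ∀ a ∈ l, |a| ≤ B) :
    listNorm l ≤ B * √(nnz l) := by
  have key : (l.map (· ^ 2)).sum ≤ B ^ 2 * nnz l := by
    induction l with
    | nil => simp [nnz]
    | cons a l ih =>
      have ih' := ih fun x hx => h x (List.mem_cons_of_mem _ hx)
      have ha : a ^ 2 ≤ B ^ 2 := by
        rw [← sq_abs]; exact pow_le_pow_left₀ (abs_nonneg _) (h a List.mem_cons_self) 2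
      by_cases h0 : a = 0
      · simpa [nnz, h0] using ih'
      · simp only [nnz, List.map_cons, List.sum_cons, List.countP_cons, ne_eq, h0,
          not_false_eq_true, decide_true, if_true] at ih' ⊢
        push_cast
        linarith
  rw [listNorm, Real.sqrt_le_left (by positivity), mul_pow, Real.sq_sqrt (by positivity)]
  exact key

lemma listNorm_le_mul_sqrt_length {l : List ℝ} {B : ℝ} (hB : 0 ≤ B) (h : ∀ a ∈ l, |a| ≤ B) :
    listNorm l ≤ B * √l.length := by
  refine (listNorm_le_mul_sqrt_nnz hB h).trans ?_
  gcongr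
  exact nnz_le_length l

lemma listNorm_le_append_left (l l' : List ℝ) : listNorm l ≤ listNorm (l ++ l') := by
  refine Real.sqrt_le_sqrt ?_
  rw [List.map_append, List.sum_append]
  exact le_add_of_nonneg_right (List.sum_nonneg (by simp +contextual [sq_nonneg]))

lemma listNorm_le_append_right (l l' : List ℝ) : listNorm l' ≤ listNorm (l ++ l') := by
  refine Real.sqrt_le_sqrt ?_
  rw [List.map_append, List.sum_append]
  exact le_add_of_nonneg_left (List.sum_nonneg (by simp +contextual [sq_nonneg]))

lemma listNorm_vec (W : Matrix (Fin m) (Fin n) ℝ) :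
    listNorm (DNN.vec W) = √(∑ i, ∑ j, W i j ^ 2) := by
  rw [listNorm, Finset.sum_comm, DNN.vec, List.map_flatMap, List.flatMap, List.sum_flatten,
    List.map_map, Fin.sum_univ_def]
  simp only [Function.comp_def, List.map_map, Fin.sum_univ_def]

lemma listNorm_ofFn (b : Fin m → ℝ) : listNorm (List.ofFn b) = l2 b := by
  simp [listNorm, List.map_ofFn, List.sum_ofFn, l2_eq_sqrt]

lemma l2_mulVec_le (W : Matrix (Fin m) (Fin n) ℝ) (x : Fin n → ℝ) :
    l2 (W *ᵥ x) ≤ listNorm (DNN.vec W) * l2 x := by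
  rw [listNorm_vec, l2_eq_sqrt, l2_eq_sqrt, ← Real.sqrt_mul (by positivity), Finset.sum_mul]
  gcongr with i
  simpa only [Matrix.mulVec, dotProduct] using
    Finset.sum_mul_sq_le_sq_mul_sq Finset.univ (W i) x

end Norms

section Layers

variable {m n : ℕ} (W : Matrix (Fin m) (Fin n) ℝ) (b : Fin m → ℝ)

/-- The parameters of the affine map `x ↦ W x + b`. -/
abbrev layerParams : List ℝ := DNN.vec W ++ List.ofFn b

lemma length_vec : (DNN.vec W).length = n * m := by
  simp [DNN.vec, List.length_flatMap]

lemma length_layerParams : (layerParams W b).length = m * (n + 1) := by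
  simp only [List.length_append, length_vec, List.length_ofFn]
  ring

lemma forall_mem_layerParams {W : Matrix (Fin m) (Fin n) ℝ} {b : Fin m → ℝ} {p : ℝ → Prop} :
    (∀ a ∈ layerParams W b, p a) ↔ (∀ i j, p (W i j)) ∧ ∀ i, p (b i) := by
  simp only [DNN.vec, List.mem_append, List.mem_flatMap, List.mem_map, List.mem_finRange,
    true_and, List.mem_ofFn, or_imp, forall_and, forall_exists_index, forall_apply_eq_imp_iff]
  refine and_congr_left' ⟨fun h i j => h _ j i rfl, ?_⟩
  rintro h _ j i rfl
  exact h i j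

lemma vec_map (φ : ℝ → ℝ) : DNN.vec (W.map φ) = (DNN.vec W).map φ := by
  simp [DNN.vec, List.map_flatMap, Function.comp_def]

lemma layerParams_map (φ : ℝ → ℝ) :
    layerParams (W.map φ) (φ ∘ b) = (layerParams W b).map φ := by
  simp [vec_map, List.map_ofFn]

lemma l2_affine_le (x : Fin n → ℝ) :
    l2 (W *ᵥ x + b) ≤ listNorm (layerParams W b) * (l2 x + 1) := by
  have hW := listNorm_le_append_left (DNN.vec W) (List.ofFn b)
  have hb := listNorm_le_append_right (DNN.vec W) (List.ofFn b)
  rw [listNorm_ofFn] at hb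
  calc l2 (W *ᵥ x + b) ≤ listNorm (DNN.vec W) * l2 x + l2 b :=
        (l2_add_le _ _).trans (by gcongr; exact l2_mulVec_le W x)
    _ ≤ _ := by
      rw [mul_add, mul_one]
      have := l2_nonneg x
      gcongr

variable {W b} {φ : ℝ → ℝ} {ρ : ℝ} (hρ : 0 ≤ ρ)

include hρ

lemma l2_affine_sub_map_le (hφ : ∀ a ∈ layerParams W b, |a - φ a| ≤ ρ) (x : Fin n → ℝ) :
    l2 ((W - W.map φ) *ᵥ x + (b - φ ∘ b)) ≤ ρ * √(m * (n + 1) : ℕ) * (l2 x + 1) := by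
  refine (l2_affine_le _ _ x).trans ?_
  have := l2_nonneg x
  gcongr
  rw [← length_layerParams (W - W.map φ) (b - φ ∘ b)]
  exact listNorm_le_mul_sqrt_length hρ (forall_mem_layerParams.2 (forall_mem_layerParams.1 hφ))

lemma l2_layer_sub_map_le (hφ : ∀ a ∈ layerParams W b, |a - φ a| ≤ ρ) (x x' : Fin n → ℝ) :
    l2 ((W *ᵥ x + b) - ((W.map φ) *ᵥ x' + φ ∘ b)) ≤
      listNorm ((layerParams W b).map φ) * l2 (x - x') +
        ρ * √(m * (n + 1) : ℕ) * (l2 x + 1) := by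
  have hsplit : (W *ᵥ x + b) - ((W.map φ) *ᵥ x' + φ ∘ b)
      = (W.map φ) *ᵥ (x - x') + ((W - W.map φ) *ᵥ x + (b - φ ∘ b)) := by
    rw [Matrix.mulVec_sub, Matrix.sub_mulVec]; abel
  rw [hsplit]
  refine (l2_add_le _ _).trans (add_le_add ((l2_mulVec_le _ _).trans ?_)
    (l2_affine_sub_map_le hρ hφ x))
  have := l2_nonneg (x - x')
  gcongr
  exact layerParams_map W b φ ▸ listNorm_le_append_left _ _

lemma l2_layer_le_map (hφ : ∀ a ∈ layerParams W b, |a - φ a| ≤ ρ) (x : Fin n → ℝ) :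
    l2 (W *ᵥ x + b) ≤
      (listNorm ((layerParams W b).map φ) + ρ * √(m * (n + 1) : ℕ)) * (l2 x + 1) := by
  have hsplit : W *ᵥ x + b
      = ((W.map φ) *ᵥ x + φ ∘ b) + ((W - W.map φ) *ᵥ x + (b - φ ∘ b)) := by
    rw [Matrix.sub_mulVec]; abel
  rw [hsplit, add_mul]
  exact (l2_add_le _ _).trans (add_le_add
    (layerParams_map W b φ ▸ l2_affine_le (W.map φ) (φ ∘ b) x) (l2_affine_sub_map_le hρ hφ x))

end Layers

section Activation

variable {σ : ℝ → ℝ} {c : ℝ} (hc : 0 ≤ c) (hσ : ∀ x y, |σ x - σ y| ≤ c * |x - y|) {n : ℕ}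

include hc hσ

lemma l2_comp_sub_comp_le (y y' : Fin n → ℝ) : l2 (σ ∘ y - σ ∘ y') ≤ c * l2 (y - y') :=
  l2_le_mul_l2 hc fun _ => hσ _ _

lemma l2_comp_le (hσ₀ : |σ 0| ≤ c) (y : Fin n → ℝ) : l2 (σ ∘ y) ≤ c * (l2 y + √n) := by
  have hsplit : σ ∘ y = (σ ∘ y - σ ∘ (0 : Fin n → ℝ)) + σ ∘ (0 : Fin n → ℝ) := by abel
  rw [hsplit, mul_add]
  refine (l2_add_le _ _).trans (add_le_add ?_ (l2_le_mul_sqrt hc fun _ => hσ₀))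
  simpa using l2_comp_sub_comp_le hc hσ y 0

end Activation

namespace DNN

/-- The network obtained by applying `φ` to every parameter. -/
def map (φ : ℝ → ℝ) : {n : ℕ} → DNN n → DNN n
  | _, output W b => output (W.map φ) (φ ∘ b)
  | _, hidden m hm W b f => hidden m hm (W.map φ) (φ ∘ b) (f.map φ)

variable (φ : ℝ → ℝ) {n : ℕ} (f : DNN n)

lemma params_map : (f.map φ).params = f.params.map φ := by
  induction f with
  | output W b => exact layerParams_map W b φ
  | hidden m hm W b f ih =>
    simp only [map, params, List.map_append (l₂ := f.params), ih, ← layerParams_map]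

lemma depth_map : (f.map φ).depth = f.depth := by
  induction f with
  | output W b => rfl
  | hidden m hm W b f ih => simp only [map, depth, ih]

lemma width_map : (f.map φ).width = f.width := by
  induction f with
  | output W b => rfl
  | hidden m hm W b f ih => simp only [map, width, ih]

end DNN

/-- A bound for the factor by which a layer with `s` nonzero parameters, all of them bounded by
`B`, followed by a `c`-Lipschitz activation, can inflate an error; `w` exceeds the width of the
network. For `s` of smaller order than `w ^ 2` it gains a factor of almost `1 / 2` over the bound
`w * B` that ignores sparsity. -/
def layerGain (c w B : ℝ) (s : ℕ) : ℝ := w * B / 2 * Real.exp (8 * c ^ 2 * s / w ^ 2)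

section Gain

variable {c w B : ℝ} (hc : 1 ≤ c) (hw : 2 ≤ w) (hB : 1 ≤ B)

include hw hB in
lemma one_le_layerGain (s : ℕ) : 1 ≤ layerGain c w B s :=
  one_le_mul_of_one_le_of_one_le (by nlinarith) (Real.one_le_exp (by positivity))

include hc hw hB

lemma one_add_mul_sqrt_le_layerGain (s : ℕ) : 1 + c * B * √s ≤ layerGain c w B s := by
  rcases s.eq_zero_or_pos with rfl | hs
  · simpa using one_le_layerGain hw hB 0
  have hle : ∀ y : ℝ, y ≤ Real.exp (y ^ 2 / 2) := fun y => by
    nlinarith [Real.add_one_le_exp (y ^ 2 / 2), sq_nonneg (y - 1)]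
  have hcBs : 1 ≤ c * B * √s := one_le_mul_of_one_le_of_one_le
    (one_le_mul_of_one_le_of_one_le hc hB) (Real.one_le_sqrt.2 (by exact_mod_cast hs))
  calc 1 + c * B * √s ≤ w * B / 2 * (4 * c * √s / w) := by
        rw [show w * B / 2 * (4 * c * √s / w) = 2 * (c * B * √s) by field_simp; ring]
        linarith
    _ ≤ w * B / 2 * Real.exp ((4 * c * √s / w) ^ 2 / 2) := by gcongr; exact hle _
    _ = layerGain c w B s := by
      rw [layerGain, div_pow, mul_pow, Real.sq_sqrt (by positivity)]
      ring_nf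

end Gain

section Perturbation

variable {σ : ℝ → ℝ} {c : ℝ} (hc : 1 ≤ c) (hσ : ∀ x y, |σ x - σ y| ≤ c * |x - y|) (hσ₀ : |σ 0| ≤ c)
  {w : ℕ} (hw : 2 ≤ w) {B ρ : ℝ} (hB : 1 ≤ B) (hρ : 0 ≤ ρ) (hρw : 2 * c * ρ * w ≤ 1)
  {φ : ℝ → ℝ} (hφ : ∀ a, |a| ≤ B → |a - φ a| ≤ ρ) (hφ_abs : ∀ a, |φ a| ≤ |a|)

lemma listNorm_map_le (hB : 0 ≤ B) (hφ_abs : ∀ a, |φ a| ≤ |a|) {l : List ℝ}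
    (h : ∀ a ∈ l, |a| ≤ B) : listNorm (l.map φ) ≤ B * √(nnz (l.map φ)) :=
  listNorm_le_mul_sqrt_nnz hB <| List.forall_mem_map.2 fun a ha => (hφ_abs a).trans (h a ha)

lemma sqrt_mul_succ_le {m n : ℕ} (hm : m ≤ w) (hn : n + 1 ≤ w) : √(m * (n + 1) : ℕ) ≤ w := by
  rw [Real.sqrt_le_left (by positivity), sq]
  exact_mod_cast Nat.mul_le_mul hm hn

section Layer

variable {m n : ℕ} (hm : m ≤ w) (hn : n + 1 ≤ w) {W : Matrix (Fin m) (Fin n) ℝ} {b : Fin m → ℝ}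
  (hp : ∀ a ∈ layerParams W b, |a| ≤ B) {x x' : Fin n → ℝ} {M E : ℝ} (hx : l2 x + 1 ≤ M)

include hc hσ hw hB hρ hφ hφ_abs hm hn hp

include hx in
lemma l2_hidden_sub_map_le (hE : l2 (x - x') ≤ E) :
    l2 (σ ∘ (W *ᵥ x + b) - σ ∘ (W.map φ *ᵥ x' + φ ∘ b)) ≤
      layerGain c w B (nnz ((layerParams W b).map φ)) * E + c * ρ * w * M := by
  have hgain := one_add_mul_sqrt_le_layerGain hc (by exact_mod_cast hw : (2 : ℝ) ≤ w) hB
    (nnz ((layerParams W b).map φ))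
  have hx₀ := l2_nonneg x
  have hdiff₀ := l2_nonneg (x - x')
  have hE₀ := hdiff₀.trans hE
  calc _ ≤ c * (listNorm ((layerParams W b).map φ) * l2 (x - x') +
          ρ * √(m * (n + 1) : ℕ) * (l2 x + 1)) :=
        (l2_comp_sub_comp_le (by linarith) hσ _ _).trans
          (by gcongr; exact l2_layer_sub_map_le hρ (fun a ha => hφ a (hp a ha)) x x')
    _ ≤ c * (B * √(nnz ((layerParams W b).map φ)) * E + ρ * w * M) := by
        gcongr
        · exact listNorm_map_le (by linarith) hφ_abs hp
        · exact sqrt_mul_succ_le hm hn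
    _ = (c * B * √(nnz ((layerParams W b).map φ))) * E + c * ρ * w * M := by ring
    _ ≤ _ := by gcongr; linarith

include hσ₀ hρw hx in
lemma l2_hidden_add_one_le (hM : 4 * c * √w ≤ M) :
    l2 (σ ∘ (W *ᵥ x + b)) + 1 ≤ layerGain c w B (nnz ((layerParams W b).map φ)) * M := by
  have hgain := one_add_mul_sqrt_le_layerGain hc (by exact_mod_cast hw : (2 : ℝ) ≤ w) hB
    (nnz ((layerParams W b).map φ))
  have hx₀ := l2_nonneg x
  have hcw : 1 ≤ c * √w := one_le_mul_of_one_le_of_one_le hc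
    (Real.one_le_sqrt.2 (by exact_mod_cast (by omega : 1 ≤ w)))
  have hM₀ : 0 ≤ M := by linarith
  calc l2 (σ ∘ (W *ᵥ x + b)) + 1
      ≤ c * ((listNorm ((layerParams W b).map φ) + ρ * √(m * (n + 1) : ℕ)) * (l2 x + 1) + √m)
          + 1 := by
        gcongr
        refine (l2_comp_le (by linarith) hσ hσ₀ _).trans ?_
        gcongr
        exact l2_layer_le_map hρ (fun a ha => hφ a (hp a ha)) x
    _ ≤ c * ((B * √(nnz ((layerParams W b).map φ)) + ρ * w) * M + √w) + 1 := by
        gcongr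
        · exact listNorm_map_le (by linarith) hφ_abs hp
        · exact sqrt_mul_succ_le hm hn
    _ = c * B * √(nnz ((layerParams W b).map φ)) * M + c * ρ * w * M + c * √w + 1 := by ring
    _ ≤ (1 + c * B * √(nnz ((layerParams W b).map φ))) * M := by
        have : c * ρ * w * M ≤ 1 / 2 * M := by gcongr; linarith
        linarith
    _ ≤ _ := by gcongr

omit hσ hw hm in
include hx in
lemma abs_output_sub_map_le (i : Fin m) (hm : m = 1) (hE : l2 (x - x') ≤ E) :
    |(W *ᵥ x + b) i - (W.map φ *ᵥ x' + φ ∘ b) i| ≤ B * √w * (E + c * ρ * w * M) := by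
  have hx₀ := l2_nonneg x
  have hdiff₀ := l2_nonneg (x - x')
  have hE₀ := hdiff₀.trans hE
  have hw : (1 : ℝ) ≤ w := by exact_mod_cast (by omega : 1 ≤ w)
  have hnnz : √(nnz ((layerParams W b).map φ)) ≤ √w := by
    gcongr
    refine (nnz_le_length _).trans ?_
    rwa [List.length_map, length_layerParams, hm, one_mul]
  have hBw : 1 ≤ c * (B * √w) :=
    one_le_mul_of_one_le_of_one_le hc (one_le_mul_of_one_le_of_one_le hB (Real.one_le_sqrt.2 hw))
  calc _ ≤ listNorm ((layerParams W b).map φ) * l2 (x - x') +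
          ρ * √(m * (n + 1) : ℕ) * (l2 x + 1) :=
        (abs_apply_le_l2 _ i).trans
          (l2_layer_sub_map_le hρ (fun a ha => hφ a (hp a ha)) x x')
    _ ≤ B * √w * E + ρ * w * M := by
        gcongr
        · exact (listNorm_map_le (by linarith) hφ_abs hp).trans (by gcongr)
        · exact sqrt_mul_succ_le (by omega) hn
    _ ≤ B * √w * E + (c * (B * √w)) * (ρ * w * M) := by
        have hM₀ : 0 ≤ M := by linarith
        exact add_le_add le_rfl (le_mul_of_one_le_left (by positivity) hBw)
    _ = _ := by ring

end Layer

section FirstLayer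

variable {m d : ℕ} (hm : m + 1 ≤ w) {W : Matrix (Fin m) (Fin d) ℝ} {b : Fin m → ℝ} {x : Fin d → ℝ}
  (hx : x ∈ cube d)

include hm hx

lemma sqrt_mul_l2_add_one_le_of_mem_cube :
    √(m * (d + 1) : ℕ) * (l2 x + 1) ≤ 2 * (d + 1) * √w := by
  have hd : √(d + 1 : ℝ) * (l2 x + 1) ≤ 2 * (d + 1) := by
    have h₁ : l2 x ≤ √(d + 1 : ℝ) :=
      (l2_le_sqrt_of_mem_cube hx).trans (Real.sqrt_le_sqrt (by linarith))
    have h₂ : 1 ≤ √(d + 1 : ℝ) := Real.one_le_sqrt.2 (by linarith [d.cast_nonneg (α := ℝ)])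
    nlinarith [Real.mul_self_sqrt (by positivity : (0 : ℝ) ≤ d + 1)]
  have hmw : √(m : ℝ) ≤ √w := by gcongr; omega
  have hx₀ := l2_nonneg x
  calc √(m * (d + 1) : ℕ) * (l2 x + 1) = √m * (√(d + 1 : ℝ) * (l2 x + 1)) := by
        push_cast
        rw [Real.sqrt_mul (by positivity), mul_assoc]
    _ ≤ √w * (2 * (d + 1)) := mul_le_mul hmw hd (by positivity) (by positivity)
    _ = _ := by ring

include hc hσ

include hρ in
lemma l2_first_sub_map_le (hφ : ∀ a ∈ layerParams W b, |a - φ a| ≤ ρ) :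
    l2 (σ ∘ (W *ᵥ x + b) - σ ∘ (W.map φ *ᵥ x + φ ∘ b)) ≤ 2 * c * (d + 1) * ρ * √w := by
  have h := l2_layer_sub_map_le hρ hφ x x
  rw [sub_self, show l2 (0 : Fin d → ℝ) = 0 by simp [l2], mul_zero, zero_add, mul_assoc] at h
  calc _ ≤ c * (ρ * (2 * (d + 1) * √w)) := by
        refine (l2_comp_sub_comp_le (by linarith) hσ _ _).trans ?_
        gcongr
        exact h.trans (mul_le_mul_of_nonneg_left (sqrt_mul_l2_add_one_le_of_mem_cube hm hx) hρ)
    _ = _ := by ring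

include hσ₀ hB in
lemma l2_first_add_one_le (hp : ∀ a ∈ layerParams W b, |a| ≤ B) :
    l2 (σ ∘ (W *ᵥ x + b)) + 1 ≤ 4 * c * ((d + 1) * B * √w) := by
  have hcw : 1 ≤ c * √w :=
    one_le_mul_of_one_le_of_one_le hc (Real.one_le_sqrt.2 (by exact_mod_cast (by omega : 1 ≤ w)))
  have haffine : l2 (W *ᵥ x + b) ≤ B * (2 * (d + 1) * √w) := by
    have hx₀ := l2_nonneg x
    refine (l2_affine_le W b x).trans ((mul_le_mul_of_nonneg_right
      (listNorm_le_mul_sqrt_length (by linarith) hp) (by positivity)).trans ?_)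
    rw [length_layerParams, mul_assoc]
    exact mul_le_mul_of_nonneg_left (sqrt_mul_l2_add_one_le_of_mem_cube hm hx) (by linarith)
  have hdB : √w ≤ (d + 1) * B * √w :=
    le_mul_of_one_le_left (by positivity)
      (one_le_mul_of_one_le_of_one_le (by linarith [d.cast_nonneg (α := ℝ)]) hB)
  calc l2 (σ ∘ (W *ᵥ x + b)) + 1 ≤ c * (B * (2 * (d + 1) * √w) + √w) + c * √w := by
        gcongr
        refine (l2_comp_le (by linarith) hσ hσ₀ _).trans ?_
        gcongr
        omega
    _ ≤ c * (B * (2 * (d + 1) * √w) + (d + 1) * B * √w) + c * ((d + 1) * B * √w) := by gcongr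
    _ = _ := by ring

end FirstLayer

include hc hσ hσ₀ hw hB hρ hρw hφ hφ_abs

lemma abs_eval_sub_eval_map_le {n : ℕ} (f : DNN n) (hn : n + 1 ≤ w) (hf : f.width + 1 ≤ w)
    (hp : ∀ a ∈ f.params, |a| ≤ B) {x x' : Fin n → ℝ} {M E : ℝ} (hx : l2 x + 1 ≤ M)
    (hM : 4 * c * √w ≤ M) (hE : l2 (x - x') ≤ E) :
    |f.eval σ x - (f.map φ).eval σ x'| ≤
      B * √w * ((w * B / 2) ^ f.depth * Real.exp (8 * c ^ 2 * nnz (f.params.map φ) / w ^ 2)) *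
        (E + (f.depth + 1) * (c * ρ * w * M)) := by
  induction f generalizing M E with
  | output W b =>
    have hE₀ := (l2_nonneg _).trans hE
    have hM₀ := (add_nonneg (l2_nonneg x) zero_le_one).trans hx
    refine (abs_output_sub_map_le hc hB hρ hφ hφ_abs hn hp hx 0 rfl hE).trans ?_
    simp only [DNN.depth, pow_zero, one_mul, Nat.cast_zero, zero_add]
    refine mul_le_mul_of_nonneg_right ?_ (by positivity)
    exact le_mul_of_one_le_right (by positivity) (Real.one_le_exp (by positivity))
  | hidden m hm W b f ih =>
    have hE₀ := (l2_nonneg _).trans hE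
    have hM₀ := (add_nonneg (l2_nonneg x) zero_le_one).trans hx
    obtain ⟨hmw, hfw⟩ : m + 1 ≤ w ∧ f.width + 1 ≤ w := by
      simp only [DNN.width] at hf; omega
    obtain ⟨hpl, hpf⟩ := List.forall_mem_append.1 hp
    set q := layerGain c w B (nnz ((layerParams W b).map φ)) with hq
    have hq₁ : 1 ≤ q := one_le_layerGain (by exact_mod_cast hw) hB _
    refine (ih hmw hfw hpf
      (l2_hidden_add_one_le hc hσ hσ₀ hw hB hρ hρw hφ hφ_abs (by omega) hn hpl hx hM)
      (hM.trans (le_mul_of_one_le_left hM₀ hq₁))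
      (l2_hidden_sub_map_le hc hσ hw hB hρ hφ hφ_abs (by omega) hn hpl hx hE)).trans ?_
    calc _ ≤ B * √w * ((w * B / 2) ^ f.depth *
              Real.exp (8 * c ^ 2 * nnz (f.params.map φ) / w ^ 2)) *
            (q * (E + ((f.depth + 1 : ℕ) + 1) * (c * ρ * w * M))) := by
          gcongr
          have : c * ρ * w * M ≤ q * (c * ρ * w * M) :=
            le_mul_of_one_le_left (by positivity) hq₁
          push_cast
          linarith
      _ = _ := by
          rw [hq, layerGain]
          simp only [DNN.depth, DNN.params, List.map_append (l₂ := f.params), nnz_append,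
            Nat.cast_add, mul_add, add_div, Real.exp_add]
          push_cast
          ring

lemma abs_eval_sub_eval_map_le_of_mem_cube {d : ℕ} (f : DNN d) (hf₁ : 1 ≤ f.depth)
    (hf : f.width + 1 ≤ w) (hp : ∀ a ∈ f.params, |a| ≤ B) {x : Fin d → ℝ} (hx : x ∈ cube d) :
    |f.eval σ x - (f.map φ).eval σ x| ≤
      4 * c ^ 2 * (d + 1) * ((f.depth + 1) * ρ * (w * B) ^ (f.depth + 1)) *
        ((1 / 2) ^ (f.depth - 1) * Real.exp (8 * c ^ 2 * nnz (f.params.map φ) / w ^ 2)) := by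
  cases f with
  | output W b => simp [DNN.depth] at hf₁
  | hidden m hm W b f =>
    obtain ⟨hmw, hfw⟩ : m + 1 ≤ w ∧ f.width + 1 ≤ w := by
      simp only [DNN.width] at hf; omega
    obtain ⟨hpl, hpf⟩ := List.forall_mem_append.1 hp
    have hw₁ : (1 : ℝ) ≤ w := by exact_mod_cast (by omega : 1 ≤ w)
    have hwB : 1 ≤ w * B := one_le_mul_of_one_le_of_one_le hw₁ hB
    have hsq : √(w : ℝ) * √w = w := Real.mul_self_sqrt (by positivity)
    have hdB : 1 ≤ (d + 1) * B :=
      one_le_mul_of_one_le_of_one_le (by linarith [d.cast_nonneg (α := ℝ)]) hB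
    refine (abs_eval_sub_eval_map_le hc hσ hσ₀ hw hB hρ hρw hφ hφ_abs f hmw hfw hpf
      (l2_first_add_one_le hc hσ hσ₀ hB hmw hx hpl)
      (mul_le_mul_of_nonneg_left (le_mul_of_one_le_left (by positivity) hdB) (by positivity))
      (l2_first_sub_map_le hc hσ hρ hmw hx fun a ha => hφ a (hpl a ha))).trans ?_
    calc _ = 2 * c * (d + 1) * ρ * (w * B) * (1 + (f.depth + 1) * (2 * c * (w * B))) *
            ((w * B / 2) ^ f.depth *
              Real.exp (8 * c ^ 2 * nnz (f.params.map φ) / w ^ 2)) := by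
          linear_combination (2 * c * (d + 1) * ρ * B * (1 + (f.depth + 1) * (2 * c * (w * B))) *
            ((w * B / 2) ^ f.depth *
              Real.exp (8 * c ^ 2 * nnz (f.params.map φ) / w ^ 2))) * hsq
      _ ≤ 2 * c * (d + 1) * ρ * (w * B) * ((f.depth + 2) * (2 * c * (w * B))) *
            ((w * B / 2) ^ f.depth * Real.exp
              (8 * c ^ 2 * nnz ((layerParams W b ++ f.params).map φ) / w ^ 2)) := by
          gcongr
          · linarith [one_le_mul_of_one_le_of_one_le hc hwB]
          · rw [List.map_append, nnz_append]
            omega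
      _ = _ := by
          simp only [DNN.depth, DNN.params, Nat.add_sub_cancel, div_pow, one_pow]
          push_cast
          ring

end Perturbation

/-! ### Sparse approximation on a grid -/

/-- The integer `k` for which `g * k` is the rounding of `a` towards zero, where numbers below the
threshold `ρ` are rounded to zero. -/
def roundInt (ρ g a : ℝ) : ℤ := if |a| < ρ then 0 else SignType.sign a * ⌊|a| / g⌋

section Rounding

variable {ρ g : ℝ}

lemma roundInt_of_abs_lt {a : ℝ} (ha : |a| < ρ) : roundInt ρ g a = 0 := if_pos ha

lemma abs_mul_roundInt_le (hg : 0 < g) (a : ℝ) : |g * roundInt ρ g a| ≤ |a| := by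
  rw [roundInt]
  split_ifs with ha
  · simp
  have hfloor : g * ⌊|a| / g⌋ ≤ |a| := by
    have := Int.floor_le (|a| / g)
    rwa [le_div_iff₀' hg] at this
  have hfloor₀ : (0 : ℝ) ≤ ⌊|a| / g⌋ := by exact_mod_cast Int.floor_nonneg.2 (by positivity)
  rcases lt_trichotomy a 0 with h | rfl | h
  · simpa [sign_neg h, abs_mul, abs_of_pos hg, abs_of_nonneg hfloor₀] using hfloor
  · simp
  · simpa [sign_pos h, abs_mul, abs_of_pos hg, abs_of_nonneg hfloor₀] using hfloor

lemma abs_sub_mul_roundInt_le (hg : 0 < g) (a : ℝ) : |a - g * roundInt ρ g a| ≤ max ρ g := by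
  rw [roundInt]
  split_ifs with ha
  · simpa using Or.inl ha.le
  refine le_max_of_le_right ?_
  have hlow : g * ⌊|a| / g⌋ ≤ |a| := by
    have := Int.floor_le (|a| / g)
    rwa [le_div_iff₀' hg] at this
  have hupp : |a| ≤ g * ⌊|a| / g⌋ + g := by
    have := (Int.lt_floor_add_one (|a| / g)).le
    rw [div_le_iff₀' hg] at this
    linarith
  rcases lt_trichotomy a 0 with h | rfl | h
  · rw [abs_of_neg h] at hlow hupp ⊢
    simp only [sign_neg h, SignType.coe_neg, SignType.coe_one, neg_mul, one_mul, Int.cast_neg]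
    exact abs_le.2 ⟨by linarith, by linarith⟩
  · simpa using hg.le
  · rw [abs_of_pos h] at hlow hupp ⊢
    simp only [sign_pos h, SignType.coe_one, one_mul]
    exact abs_le.2 ⟨by linarith, by linarith⟩

end Rounding

section ClipNorm

variable {τ : ℝ} (hτ : 0 < τ)

include hτ

lemma clipNorm_nonneg (l : List ℝ) : 0 ≤ clipNorm τ l :=
  List.sum_nonneg <| List.forall_mem_map.2 fun _ _ => le_min (by positivity) zero_le_one

lemma nnz_map_le_clipNorm {φ : ℝ → ℝ} (hφ : ∀ a, |a| < τ → φ a = 0) (l : List ℝ) :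
    (nnz (l.map φ) : ℝ) ≤ clipNorm τ l := by
  induction l with
  | nil => simp [nnz, clipNorm]
  | cons a l ih =>
    rw [List.map_cons, ← List.singleton_append, nnz_append, Nat.cast_add, clipNorm, List.map_cons,
      List.sum_cons]
    refine add_le_add ?_ ih
    rcases lt_or_ge |a| τ with ha | ha
    · rw [hφ a ha]
      simp only [nnz, ne_eq, List.countP_singleton, not_true_eq_false, decide_false,
        Bool.false_eq_true, if_false, Nat.cast_zero]
      positivity
    · rw [min_eq_right ((one_le_div hτ).2 ha)]
      exact_mod_cast nnz_le_length [φ a]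

end ClipNorm

lemma one_le_width {n : ℕ} (f : DNN n) (h : 1 ≤ f.depth) : 1 ≤ f.width := by
  cases f with
  | output W b => simp [DNN.depth] at h
  | hidden m hm W b f => exact le_max_of_le_left hm

lemma length_params_le {w n : ℕ} (f : DNN n) (hf : f.width + 1 ≤ w) :
    f.params.length ≤ w * (n + 1) + f.depth * w ^ 2 := by
  induction f with
  | @output n W b =>
    simp only [DNN.width, DNN.depth, DNN.params, length_layerParams] at hf ⊢
    nlinarith
  | @hidden n m hm W b f ih =>
    obtain ⟨hmw, hfw⟩ : m + 1 ≤ w ∧ f.width + 1 ≤ w := by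
      simp only [DNN.width] at hf; omega
    simp only [DNN.depth, DNN.params, List.length_append (bs := f.params), length_layerParams]
    nlinarith [ih hfw]

section SparseApproximation

variable {σ : ℝ → ℝ} {c : ℝ} (hc : 1 ≤ c) (hσ : ∀ x y, |σ x - σ y| ≤ c * |x - y|) (hσ₀ : |σ 0| ≤ c)
  {d L w : ℕ} {B ρ ε : ℝ} (hB : 1 ≤ B) (hρ : 0 < ρ)
  (hρε : ρ * (L + 1) * (w * B) ^ (L + 1) ≤ ε) (hε : 2 * c * ε ≤ 1) {f : DNN d}
  (hf₁ : 1 ≤ f.depth) (hfL : f.depth ≤ L) (hfw : f.width + 1 ≤ w) (hfB : ∀ a ∈ f.params, |a| ≤ B)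

include hB hρ hρε hfL hfw in
lemma depth_add_one_mul_pow_le : (f.depth + 1) * ρ * (w * B) ^ (f.depth + 1) ≤ ε := by
  have hwB : 1 ≤ w * B :=
    one_le_mul_of_one_le_of_one_le (by exact_mod_cast (by omega : 1 ≤ w)) hB
  refine le_trans ?_ hρε
  rw [mul_comm ρ]
  gcongr

include hfw in
lemma length_params_div_le : (f.params.length / w ^ 2 : ℝ) ≤ d + 1 + f.depth := by
  have hw : 1 ≤ w := by omega
  rw [div_le_iff₀ (by positivity)]
  have : f.params.length ≤ (d + 1 + f.depth) * w ^ 2 :=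
    (length_params_le f hfw).trans (by nlinarith [Nat.le_self_pow two_ne_zero w])
  exact_mod_cast this

include hf₁ hfw in
lemma half_pow_mul_exp_le {k : ℝ} (hk : 16 * c ^ 2 * k ≤ f.params.length) :
    (1 / 2) ^ (f.depth - 1) * Real.exp (8 * c ^ 2 * k / w ^ 2) ≤ Real.exp ((d + 2) / 2) := by
  have hhalf : (1 / 2 : ℝ) ≤ Real.exp (-(1 / 2)) := by
    linarith [Real.add_one_le_exp (-(1 / 2))]
  have hexp : (8 * c ^ 2 * k / w ^ 2 : ℝ) ≤ (d + 1 + f.depth) / 2 := by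
    calc (8 * c ^ 2 * k / w ^ 2 : ℝ) = 16 * c ^ 2 * k / w ^ 2 / 2 := by ring
      _ ≤ f.params.length / w ^ 2 / 2 := by gcongr
      _ ≤ _ := by gcongr; exact length_params_div_le hfw
  calc _ ≤ Real.exp (-(1 / 2)) ^ (f.depth - 1) * Real.exp ((d + 1 + f.depth) / 2) := by gcongr
    _ = _ := by
        rw [← Real.exp_nat_mul, ← Real.exp_add, Nat.cast_sub hf₁]
        ring_nf

include hfL hfw in
lemma exp_neg_mul_half_pow_mul_exp_le {k : ℝ} (hk : k ≤ f.params.length) :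
    Real.exp (-(8 * c ^ 2 * L)) * ((1 / 2) ^ (f.depth - 1) *
      Real.exp (8 * c ^ 2 * k / w ^ 2)) ≤ Real.exp (8 * c ^ 2 * (d + 1)) := by
  have hdepth : (f.depth : ℝ) ≤ L := by exact_mod_cast hfL
  have hfrac : k / w ^ 2 ≤ d + 1 + L :=
    (div_le_div_of_nonneg_right hk (by positivity)).trans
      ((length_params_div_le hfw).trans (by gcongr))
  calc _ ≤ Real.exp (-(8 * c ^ 2 * L)) * (1 * Real.exp (8 * c ^ 2 * (d + 1 + L))) := by
        rw [mul_div_assoc]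
        gcongr
        exact pow_le_one₀ (by norm_num) (by norm_num)
    _ = _ := by
        rw [one_mul, ← Real.exp_add]
        ring_nf

include hc hσ hσ₀ hB hρ hρε hε hf₁ hfL hfw hfB

lemma abs_eval_sub_eval_map_le_exp {ρ' : ℝ} (hρ' : 0 ≤ ρ') (hρρ' : ρ' ≤ ρ) {φ : ℝ → ℝ}
    (hφ : ∀ a, |a - φ a| ≤ ρ') (hφ_abs : ∀ a, |φ a| ≤ |a|) {x : Fin d → ℝ} (hx : x ∈ cube d) :
    |f.eval σ x - (f.map φ).eval σ x| ≤ 4 * c ^ 2 * (d + 1) * ε *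
      (ρ' / ρ * ((1 / 2) ^ (f.depth - 1) *
        Real.exp (8 * c ^ 2 * nnz (f.params.map φ) / w ^ 2))) := by
  have hw : 2 ≤ w := by have := one_le_width f hf₁; omega
  have hsmall := depth_add_one_mul_pow_le hB hρ hρε hfL hfw
  have hwB : 1 ≤ w * B :=
    one_le_mul_of_one_le_of_one_le (by exact_mod_cast (by omega : 1 ≤ w)) hB
  have hρw : 2 * c * ρ' * w ≤ 1 := by
    have : ρ' * w ≤ (f.depth + 1) * ρ * (w * B) ^ (f.depth + 1) := by
      have h₁ : ρ' ≤ (f.depth + 1) * ρ :=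
        hρρ'.trans (le_mul_of_one_le_left hρ.le (by linarith [f.depth.cast_nonneg (α := ℝ)]))
      have h₂ : w ≤ (w * B) ^ (f.depth + 1) :=
        (le_mul_of_one_le_right (by positivity) hB).trans (le_self_pow₀ hwB (by omega))
      gcongr
    nlinarith
  refine (abs_eval_sub_eval_map_le_of_mem_cube hc hσ hσ₀ hw hB hρ' hρw (fun a _ => hφ a) hφ_abs f
    hf₁ hfw hfB hx).trans ?_
  calc _ = 4 * c ^ 2 * (d + 1) * ((f.depth + 1) * ρ * (w * B) ^ (f.depth + 1)) *
        (ρ' / ρ * ((1 / 2) ^ (f.depth - 1) *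
          Real.exp (8 * c ^ 2 * nnz (f.params.map φ) / w ^ 2))) := by
        field_simp
    _ ≤ _ := by gcongr

-- Thresholding at `ρ` leaves at most `clipNorm τ f.params` nonzero parameters. If they are a small
-- fraction of all parameters, the factors `1 / 2` gained in each layer compensate the exponential
-- factor; otherwise every parameter can be kept, and rounding to a grid that is exponentially finer
-- than `ρ` does the same.
lemma exists_round_approx {τ g : ℝ} (hτ : 0 < τ) (hτρ : τ ≤ ρ)
    (hg : g = ρ * Real.exp (-(8 * c ^ 2 * L))) :
    ∃ z : ℝ → ℤ, (∀ a, |g * z a| ≤ |a|) ∧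
      (∀ x ∈ cube d, |f.eval σ x - (f.map fun a => g * z a).eval σ x| ≤
        4 * c ^ 2 * (d + 1) * Real.exp (8 * c ^ 2 * (d + 1)) * ε) ∧
      (nnz (f.params.map fun a => g * z a) : ℝ) ≤ 16 * c ^ 2 * clipNorm τ f.params := by
  have hg₀ : 0 < g := hg ▸ by positivity
  have hgρ : g ≤ ρ := hg ▸ mul_le_of_le_one_right hρ.le
    (Real.exp_le_one_iff.2 (neg_nonpos.2 (by positivity)))
  have hc2 : 1 ≤ c ^ 2 := one_le_pow₀ hc
  have hε₀ : 0 ≤ ε := le_trans (by positivity) hρε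
  have hclip := clipNorm_nonneg hτ f.params
  have hsparse : (nnz (f.params.map fun a => g * roundInt ρ g a) : ℝ) ≤ clipNorm τ f.params :=
    nnz_map_le_clipNorm hτ (fun a ha => by simp [roundInt_of_abs_lt (ha.trans_le hτρ)]) _
  suffices h : ∃ ρ' ≤ ρ, (nnz (f.params.map fun a => g * roundInt ρ' g a) : ℝ) ≤
        16 * c ^ 2 * clipNorm τ f.params ∧
      max ρ' g / ρ * ((1 / 2) ^ (f.depth - 1) *
        Real.exp (8 * c ^ 2 * nnz (f.params.map fun a => g * roundInt ρ' g a) / w ^ 2)) ≤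
          Real.exp (8 * c ^ 2 * (d + 1)) by
    obtain ⟨ρ', hρ', hnnz, herr⟩ := h
    refine ⟨roundInt ρ' g, abs_mul_roundInt_le hg₀, fun x hx => ?_, hnnz⟩
    calc _ ≤ _ := abs_eval_sub_eval_map_le_exp hc hσ hσ₀ hB hρ hρε hε hf₁ hfL hfw hfB
          (le_max_of_le_right hg₀.le) (max_le hρ' hgρ) (abs_sub_mul_roundInt_le hg₀)
          (abs_mul_roundInt_le hg₀) hx
      _ ≤ 4 * c ^ 2 * (d + 1) * ε * Real.exp (8 * c ^ 2 * (d + 1)) := by gcongr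
      _ = _ := by ring
  rcases le_or_gt (16 * c ^ 2 * nnz (f.params.map fun a => g * roundInt ρ g a) : ℝ)
    f.params.length with hfew | hmany
  · refine ⟨ρ, le_rfl, hsparse.trans (le_mul_of_one_le_left hclip (by linarith)), ?_⟩
    rw [max_eq_left hgρ, div_self hρ.ne', one_mul]
    refine (half_pow_mul_exp_le hf₁ hfw hfew).trans (Real.exp_le_exp.2 ?_)
    nlinarith [d.cast_nonneg (α := ℝ)]
  · have hnnz : (nnz (f.params.map fun a => g * roundInt 0 g a) : ℝ) ≤ f.params.length := by
      exact_mod_cast (nnz_le_length _).trans_eq (List.length_map _)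
    refine ⟨0, hρ.le, hnnz.trans (hmany.le.trans (by gcongr)), ?_⟩
    rw [max_eq_right hg₀.le]
    nth_rw 1 [hg]
    rw [mul_div_cancel_left₀ _ hρ.ne']
    exact exp_neg_mul_half_pow_mul_exp_le hfL hfw hnnz

end SparseApproximation

/-! ### Weighted nets of the network class -/

lemma pow_mul_pow_layer_le {s r : ℝ} (hs : 1 ≤ s) (hr : 0 ≤ r) {m n w D : ℕ} (hm : m + 1 ≤ w) :
    s ^ (m * (n + 1)) * (r * s ^ (w * (m + 1) + D * w ^ 2)) ≤
      r * s ^ (w * (n + 1) + (D + 1) * w ^ 2) := by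
  rw [mul_left_comm, ← pow_add]
  refine mul_le_mul_of_nonneg_left (pow_le_pow_right₀ hs ?_) hr
  nlinarith [Nat.mul_le_mul_right (n + 1) (Nat.le_of_succ_le hm), Nat.mul_le_mul_left w hm]

section Counting

variable {α : Type} [Fintype α] (a : α → ℝ) (u : ℝ → ℝ)

lemma prod_map_layerParams {m n : ℕ} (W : Matrix (Fin m) (Fin n) ℝ) (b : Fin m → ℝ) :
    ((layerParams W b).map u).prod = (∏ j, ∏ i, u (W i j)) * ∏ i, u (b i) := by
  simp [layerParams, DNN.vec, List.prod_ofFn, List.flatMap, List.prod_flatten,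
    List.map_ofFn, Function.comp_def, ← List.ofFn_id]

lemma sum_prod_map_layerParams (m n : ℕ) :
    ∑ θ : (Fin m → Fin n → α) × (Fin m → α),
      ((layerParams (Matrix.of fun i j => a (θ.1 i j)) fun i => a (θ.2 i)).map u).prod =
        (∑ z, u (a z)) ^ (m * (n + 1)) := by
  classical
  have hvec (k : ℕ) : ∑ b : Fin k → α, ∏ i, u (a (b i)) = (∑ z, u (a z)) ^ k :=
    (Fintype.sum_pow (fun z => u (a z)) k).symm
  have hmat : ∑ W : Fin m → Fin n → α, ∏ i, ∏ j, u (a (W i j)) = (∑ z, u (a z)) ^ (n * m) := by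
    rw [pow_mul, ← hvec, Fintype.sum_pow]
  simp only [prod_map_layerParams, Matrix.of_apply, Fintype.sum_prod_type, ← Finset.mul_sum,
    ← Finset.sum_mul, hvec]
  simp_rw [Finset.prod_comm (s := (Finset.univ : Finset (Fin n))), hmat]
  ring

variable {a u}

omit [Fintype α] in
lemma exists_code_of_layerParams_mem_range {m n : ℕ} {W : Matrix (Fin m) (Fin n) ℝ}
    {b : Fin m → ℝ} (h : ∀ y ∈ layerParams W b, y ∈ Set.range a) :
    ∃ θ : (Fin m → Fin n → α) × (Fin m → α),
      (Matrix.of fun i j => a (θ.1 i j)) = W ∧ (fun i => a (θ.2 i)) = b := by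
  choose V hV using (forall_mem_layerParams.1 h).1
  choose β hβ using (forall_mem_layerParams.1 h).2
  exact ⟨(V, β), Matrix.ext hV, funext hβ⟩

variable (hs : 1 ≤ ∑ z, u (a z)) {w : ℕ} (hw : 1 ≤ w)

include hs

lemma sum_hidden_family_le {D n : ℕ} {I : ℕ → Type} [∀ k, Fintype (I k)]
    {net : ∀ k, I k → DNN k} (hsum : ∀ k, ∑ i, ((net k i).params.map u).prod ≤
      w ^ D * (∑ z, u (a z)) ^ (w * (k + 1) + D * w ^ 2)) :
    ∑ i : Σ k : Fin (w - 1),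
        ((Fin (k + 1) → Fin n → α) × (Fin (k + 1) → α)) × I (k + 1),
        ((DNN.hidden (i.1 + 1) (Nat.succ_pos _) (Matrix.of fun j l => a (i.2.1.1 j l))
          (fun j => a (i.2.1.2 j)) (net _ i.2.2)).params.map u).prod ≤
      w ^ (D + 1) * (∑ z, u (a z)) ^ (w * (n + 1) + (D + 1) * w ^ 2) := by
  have hterm (k : Fin (w - 1)) : (∑ z, u (a z)) ^ ((k + 1) * (n + 1)) *
      ∑ i, ((net (k + 1) i).params.map u).prod ≤
        w ^ D * (∑ z, u (a z)) ^ (w * (n + 1) + (D + 1) * w ^ 2) :=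
    (mul_le_mul_of_nonneg_left (hsum _) (by positivity)).trans
      (pow_mul_pow_layer_le hs (by positivity) (by omega))
  calc _ = ∑ k : Fin (w - 1), (∑ z, u (a z)) ^ ((k + 1) * (n + 1)) *
        ∑ i, ((net (k + 1) i).params.map u).prod := by
        rw [Fintype.sum_sigma]
        refine Finset.sum_congr rfl fun k _ => ?_
        rw [← sum_prod_map_layerParams, Finset.sum_mul_sum, Fintype.sum_prod_type]
        simp only [DNN.params, List.map_append (l₂ := DNN.params _), List.prod_append]
    _ ≤ (w - 1 : ℕ) * (w ^ D * (∑ z, u (a z)) ^ (w * (n + 1) + (D + 1) * w ^ 2)) := by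
        simpa using Finset.sum_le_card_nsmul Finset.univ _ _ fun k _ => hterm k
    _ ≤ w * (w ^ D * (∑ z, u (a z)) ^ (w * (n + 1) + (D + 1) * w ^ 2)) := by
        gcongr
        exact Nat.sub_le w 1
    _ = _ := by ring

include hw

-- Families instead of sets of networks: no injectivity has to be checked.
lemma exists_family_of_depth (D n : ℕ) :
    ∃ (I : Type) (_ : Fintype I) (net : I → DNN n),
      (∀ f : DNN n, f.depth = D → f.width + 1 ≤ w → (∀ y ∈ f.params, y ∈ Set.range a) →
        f ∈ Set.range net) ∧
      ∑ i, ((net i).params.map u).prod ≤ w ^ D * (∑ z, u (a z)) ^ (w * (n + 1) + D * w ^ 2) := by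
  induction D generalizing n with
  | zero =>
    refine ⟨(Fin 1 → Fin n → α) × (Fin 1 → α), inferInstance,
      fun θ => .output (Matrix.of fun i j => a (θ.1 i j)) fun i => a (θ.2 i), ?_, ?_⟩
    · rintro (⟨W, b⟩ | _) hD - hmem
      · obtain ⟨θ, hW, hb⟩ := exists_code_of_layerParams_mem_range hmem
        exact ⟨θ, by simp only [hW, hb]⟩
      · simp [DNN.depth] at hD
    · refine (sum_prod_map_layerParams a u 1 n).trans_le ?_
      rw [pow_zero, one_mul, one_mul]
      exact pow_le_pow_right₀ hs (by rw [zero_mul, add_zero]; exact Nat.le_mul_of_pos_left _ hw)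
  | succ D ih =>
    choose I hI net hmem hsum using ih
    refine ⟨Σ k : Fin (w - 1), ((Fin (k + 1) → Fin n → α) × (Fin (k + 1) → α)) × I (k + 1),
      inferInstance, fun i => .hidden (i.1 + 1) (Nat.succ_pos _)
        (Matrix.of fun j l => a (i.2.1.1 j l)) (fun j => a (i.2.1.2 j)) (net _ i.2.2), ?_, ?_⟩
    · rintro (_ | ⟨m, hm, W, b, f⟩) hD hfw hfmem
      · simp [DNN.depth] at hD
      obtain ⟨k, rfl⟩ : ∃ k, m = k + 1 := ⟨m - 1, by omega⟩
      obtain ⟨hkw, hfw⟩ : k + 1 < w ∧ f.width + 1 ≤ w := by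
        simp only [DNN.width] at hfw; omega
      obtain ⟨θ, hW, hb⟩ := exists_code_of_layerParams_mem_range fun y hy =>
        hfmem y (List.mem_append_left _ hy)
      obtain ⟨i, hi⟩ := hmem (k + 1) f (by simpa [DNN.depth] using hD) hfw
        fun y hy => hfmem y (List.mem_append_right _ hy)
      exact ⟨⟨⟨k, by omega⟩, θ, i⟩, by simp only [hW, hb, hi]⟩
    · exact sum_hidden_family_le hs fun k => hsum k

lemma exists_family_of_depth_le (L n : ℕ) :
    ∃ (I : Type) (_ : Fintype I) (net : I → DNN n),
      (∀ f : DNN n, f.depth ≤ L → f.width + 1 ≤ w → (∀ y ∈ f.params, y ∈ Set.range a) →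
        f ∈ Set.range net) ∧
      ∑ i, ((net i).params.map u).prod ≤
        (L + 1) * w ^ L * (∑ z, u (a z)) ^ (w * (n + 1) + L * w ^ 2) := by
  choose I hI net hmem hsum using fun D => exists_family_of_depth hs hw D n
  refine ⟨Σ D : Fin (L + 1), I D, inferInstance, fun i => net i.1 i.2,
    fun f hfL hfw hfmem => ?_, ?_⟩
  · obtain ⟨i, hi⟩ := hmem _ f rfl hfw hfmem
    exact ⟨⟨⟨f.depth, by omega⟩, i⟩, hi⟩
  · have hterm (D : Fin (L + 1)) : ∑ i, ((net D i).params.map u).prod ≤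
        w ^ L * (∑ z, u (a z)) ^ (w * (n + 1) + L * w ^ 2) := by
      refine (hsum D).trans ?_
      have hD : (D : ℕ) ≤ L := by omega
      have hw' : (1 : ℝ) ≤ w := by exact_mod_cast hw
      gcongr
    rw [Fintype.sum_sigma, mul_assoc]
    simpa using Finset.sum_le_card_nsmul Finset.univ _ _ fun D _ => hterm D

end Counting

section Grid

variable {d L w : ℕ} {g : ℝ} (hg : g ≠ 0)

lemma prod_map_ite_eq_exp (E : ℝ) (l : List ℝ) :
    (l.map fun y => if y = 0 then 1 else Real.exp (-E)).prod = Real.exp (-(E * nnz l)) := by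
  induction l with
  | nil => simp [nnz]
  | cons y l ih =>
    rw [← List.singleton_append, nnz_append, List.map_append, List.prod_append, ih]
    by_cases hy : y = 0
    · simp [hy, nnz]
    · simp [hy, nnz, ← Real.exp_add]
      ring

include hg

lemma sum_grid_ite (K : ℕ) (q : ℝ) :
    ∑ z : Finset.Icc (-(K : ℤ)) K, (if g * (z : ℤ) = 0 then 1 else q) = 1 + 2 * K * q := by
  have hmem : (0 : ℤ) ∈ Finset.Icc (-(K : ℤ)) K := by simp
  have hcard : (Finset.Icc (-(K : ℤ)) K).card - 1 = 2 * K := by rw [Int.card_Icc]; omega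
  rw [Finset.sum_coe_sort (Finset.Icc (-(K : ℤ)) K) fun z => if g * (z : ℝ) = 0 then 1 else q,
    ← Finset.add_sum_erase _ _ hmem,
    Finset.sum_congr rfl fun z hz => if_neg (by simpa [hg] using Finset.ne_of_mem_erase hz),
    Finset.sum_const, Finset.card_erase_of_mem hmem, hcard]
  simp

lemma exists_grid_family (hw : 1 ≤ w) {K : ℕ} {E : ℝ} (hE₁ : (L + 1) * w ^ L ≤ Real.exp E)
    (hE₂ : 2 * K * ((d + 1 + L) * w ^ 2) ≤ Real.exp E) :
    ∃ (I : Type) (_ : Fintype I) (net : I → DNN d),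
      (∀ f : DNN d, f.depth ≤ L → f.width + 1 ≤ w →
        (∀ y ∈ f.params, ∃ z : ℤ, |z| ≤ K ∧ g * z = y) → f ∈ Set.range net) ∧
      ∑ i, Real.exp (-(E * nnz (net i).params)) ≤ Real.exp (E + 1) := by
  have hsum := sum_grid_ite hg K (Real.exp (-E))
  obtain ⟨I, hI, net, hmem, hle⟩ := exists_family_of_depth_le
    (a := fun z : Finset.Icc (-(K : ℤ)) K => g * (z : ℤ)) (w := w)
    (u := fun y => if y = 0 then 1 else Real.exp (-E))
    (by rw [hsum]; linarith [show 0 ≤ 2 * K * Real.exp (-E) by positivity]) hw L d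
  refine ⟨I, hI, net, fun f hfL hfw hf => hmem f hfL hfw fun y hy => ?_, ?_⟩
  · obtain ⟨z, hz, rfl⟩ := hf y hy
    exact ⟨⟨z, Finset.mem_Icc.2 (abs_le.1 hz)⟩, rfl⟩
  simp only [prod_map_ite_eq_exp, hsum] at hle
  have hlen : ((w * (d + 1) + L * w ^ 2 : ℕ) : ℝ) ≤ (d + 1 + L) * w ^ 2 := by
    exact_mod_cast (by nlinarith [Nat.le_self_pow two_ne_zero w] :
      w * (d + 1) + L * w ^ 2 ≤ (d + 1 + L) * w ^ 2)
  calc _ ≤ _ := hle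
    _ ≤ Real.exp E * Real.exp (2 * K * Real.exp (-E)) ^ (w * (d + 1) + L * w ^ 2) := by
        gcongr
        linarith [Real.add_one_le_exp (2 * K * Real.exp (-E))]
    _ ≤ Real.exp E * Real.exp 1 := by
        rw [← Real.exp_nat_mul]
        gcongr
        calc _ ≤ (d + 1 + L) * w ^ 2 * (2 * K * Real.exp (-E)) := by gcongr
          _ = 2 * K * ((d + 1 + L) * w ^ 2) * Real.exp (-E) := by ring
          _ ≤ Real.exp E * Real.exp (-E) := by gcongr
          _ = 1 := by rw [← Real.exp_add, add_neg_cancel, Real.exp_zero]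
    _ = _ := (Real.exp_add _ _).symm

end Grid

lemma eval_eq_zero_of_forall_params {σ : ℝ → ℝ} {n : ℕ} {f : DNN n} (h : ∀ y ∈ f.params, y = 0)
    (x : Fin n → ℝ) : f.eval σ x = 0 := by
  induction f with
  | output W b =>
    have hWb := forall_mem_layerParams.1 h
    rw [DNN.eval, show W = 0 from Matrix.ext hWb.1, show b = 0 from funext hWb.2]
    simp
  | hidden m hm W b f ih => exact ih (fun y hy => h y (List.mem_append_right _ hy)) _

lemma continuous_eval {σ : ℝ → ℝ} (hσ : Continuous σ) {n : ℕ} (f : DNN n) :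
    Continuous (f.eval σ) := by
  induction f with
  | output W b => exact (by fun_prop : Continuous fun x => (W *ᵥ x + b) 0)
  | hidden m _ W b f ih =>
    exact (by fun_prop : Continuous fun x => f.eval σ fun i => σ ((W *ᵥ x + b) i))

lemma abs_max_min_le {F : ℝ} (hF : 0 ≤ F) (y : ℝ) : |max (-F) (min F y)| ≤ F :=
  abs_le.2 ⟨le_max_left _ _, max_le (by linarith) (min_le_left _ _)⟩

lemma abs_sub_max_min_le {F y : ℝ} (hy : |y| ≤ F) (y' : ℝ) :
    |y - max (-F) (min F y')| ≤ |y - y'| := by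
  obtain ⟨h₁, h₂⟩ := abs_le.1 hy
  have := abs_max_sub_max_le_abs (min F y) (min F y') (-F)
  calc _ = |max (-F) (min F y) - max (-F) (min F y')| := by
        rw [min_eq_right h₂, max_eq_right h₁]
    _ ≤ |min F y - min F y'| := by simpa [max_comm] using this
    _ ≤ |y - y'| := by simpa using abs_min_sub_min_le_max F y F y'

lemma exp_neg_mul_max_one_le {E : ℝ} (hE : 0 ≤ E) (k : ℕ) :
    Real.exp (-(E * max 1 (k : ℝ))) ≤ Real.exp (-(E / 2)) * Real.exp (-(E / 2 * k)) := by
  rw [← Real.exp_add]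
  gcongr
  nlinarith [le_max_left (1 : ℝ) k, le_max_right (1 : ℝ) k]

lemma measurable_fn {σ : ℝ → ℝ} (hσ : Continuous σ) {d : ℕ} (f : DNN d) :
    Measurable (f.fn σ) :=
  (continuous_eval hσ f).measurable.indicator (measurableSet_cube d)

lemma abs_fn_sub_fn_le {σ : ℝ → ℝ} {d : ℕ} {f f' : DNN d} {δ : ℝ} (hδ : 0 ≤ δ)
    (h : ∀ x ∈ cube d, |f.eval σ x - f'.eval σ x| ≤ δ) (x : Fin d → ℝ) :
    |f.fn σ x - f'.fn σ x| ≤ δ := by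
  simpa only [DNN.fn, Set.indicator_sub] using abs_indicator_cube_le hδ h x

lemma abs_fn_le {σ : ℝ → ℝ} {d : ℕ} {L N B F : ℝ} (hF : 0 ≤ F) {f : DNN d}
    (hf : f ∈ dnnClass σ d L N B F) (x : Fin d → ℝ) : |f.fn σ x| ≤ F :=
  abs_indicator_cube_le hF hf.2.2.2.2 x

section Net

variable {σ : ℝ → ℝ} {c : ℝ} (hc : 1 ≤ c) (hσ : ∀ x y, |σ x - σ y| ≤ c * |x - y|)
  (hσ₀ : |σ 0| ≤ c) {d L N : ℕ} {B F ρ τ ε g : ℝ} (hB : 1 ≤ B) (hτ : 0 < τ) (hτρ : τ ≤ ρ)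
  (hρε : ρ * (L + 1) * ((N + 1) * B) ^ (L + 1) ≤ ε) (hε : 2 * c * ε ≤ 1)
  (hg : g = ρ * Real.exp (-(8 * c ^ 2 * L)))

include hc hσ hσ₀ hB hτ hτρ hρε hε hg

lemma exists_grid_approx {f : DNN d} (hf : f ∈ dnnClass σ d L N B F) :
    ∃ f' : DNN d, f'.depth ≤ L ∧ f'.width ≤ N ∧
      (∀ y ∈ f'.params, ∃ z : ℤ, |z| ≤ ⌈B / g⌉₊ ∧ g * z = y) ∧
      (nnz f'.params : ℝ) ≤ 16 * c ^ 2 * clipNorm τ f.params ∧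
      ∀ x, |f.fn σ x - f'.fn σ x| ≤
        4 * c ^ 2 * (d + 1) * Real.exp (8 * c ^ 2 * (d + 1)) * ε := by
  obtain ⟨hf₁, hfL, hfN, hfB, -⟩ := hf
  have hfL : f.depth ≤ L := by exact_mod_cast hfL
  have hfN : f.width ≤ N := by exact_mod_cast hfN
  have hρ : 0 < ρ := hτ.trans_le hτρ
  have hg₀ : 0 < g := hg ▸ by positivity
  have hε₀ : 0 ≤ ε := le_trans (by positivity) hρε
  obtain ⟨z, hz_le, happrox, hnnz⟩ := exists_round_approx hc hσ hσ₀ hB hρ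
    (by exact_mod_cast hρε) hε hf₁ hfL (Nat.succ_le_succ hfN) hfB hτ hτρ hg
  refine ⟨f.map fun a => g * z a, by rwa [DNN.depth_map], by rwa [DNN.width_map], ?_,
    by rwa [DNN.params_map], abs_fn_sub_fn_le (by positivity) happrox⟩
  rw [DNN.params_map]
  refine List.forall_mem_map.2 fun y hy => ⟨z y, ?_, rfl⟩
  have hz := (hz_le y).trans (hfB y hy)
  rw [abs_mul, abs_of_pos hg₀, ← le_div_iff₀' hg₀] at hz
  exact_mod_cast hz.trans (Nat.le_ceil _)

-- Giving a network the weight `exp (-E * nnz)` makes the total weight of the net bounded although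
-- its cardinality is not. The zero function has the weight one and represents all networks
-- without nonzero parameters.
lemma exists_net (hF : 0 ≤ F) {E : ℝ} (hE : 0 ≤ E)
    (hE₁ : (L + 1) * (N + 1) ^ L ≤ Real.exp (E / 2))
    (hE₂ : 2 * (B / g + 1) * ((d + 1 + L) * (N + 1) ^ 2) ≤ Real.exp (E / 2)) :
    ∃ (I : Type) (_ : Fintype I) (G : I → (Fin d → ℝ) → ℝ) (p : I → ℝ),
      (∀ i, Measurable (G i)) ∧ (∀ i x, |G i x| ≤ F) ∧ (∀ i, 0 ≤ p i) ∧
      ∑ i, Real.exp (-p i) ≤ 4 ∧ ∀ f ∈ dnnClass σ d L N B F, ∃ i,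
        p i ≤ 16 * c ^ 2 * E * clipNorm τ f.params ∧
        ∀ x, |f.fn σ x - G i x| ≤ 4 * c ^ 2 * (d + 1) * Real.exp (8 * c ^ 2 * (d + 1)) * ε := by
  have hg₀ : 0 < g := by have := hτ.trans_le hτρ; rw [hg]; positivity
  obtain ⟨I, hI, net, hnet, hsum⟩ := exists_grid_family (d := d) hg₀.ne' (Nat.le_add_left 1 N)
    (K := ⌈B / g⌉₊) (by exact_mod_cast hE₁) (hE₂.trans' (by
      push_cast
      gcongr
      exact (Nat.ceil_lt_add_one (by positivity)).le))
  refine ⟨Option I, inferInstance,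
    fun o => o.elim 0 fun i x => max (-F) (min F ((net i).fn σ x)),
    fun o => o.elim 0 fun i => E * max 1 (nnz (net i).params : ℝ), ?_, ?_, ?_, ?_,
    fun f hf => ?_⟩
  · have hσc : Continuous σ := (LipschitzWith.of_dist_le' hσ).continuous
    rintro (_ | i)
    exacts [measurable_const,
      measurable_const.max (measurable_const.min (measurable_fn hσc (net i)))]
  · rintro (_ | i) x
    exacts [by simpa using hF, abs_max_min_le hF _]
  · rintro (_ | i)
    exacts [le_rfl, mul_nonneg hE (zero_le_one.trans (le_max_left _ _))]
  · rw [Fintype.sum_option]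
    calc _ ≤ 1 + ∑ i, Real.exp (-(E / 2)) * Real.exp (-(E / 2 * nnz (net i).params)) := by
          gcongr
          exacts [by simp, exp_neg_mul_max_one_le hE _]
      _ ≤ 1 + Real.exp (-(E / 2)) * Real.exp (E / 2 + 1) := by rw [← Finset.mul_sum]; gcongr
      _ = 1 + Real.exp 1 := by rw [← Real.exp_add]; ring_nf
      _ ≤ 4 := by linarith [Real.exp_one_lt_d9]
  obtain ⟨f', hfL, hfN, hgrid, hnnz, happrox⟩ :=
    exists_grid_approx hc hσ hσ₀ hB hτ hτρ hρε hε hg hf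
  rcases (nnz f'.params).eq_zero_or_pos with h₀ | h₀
  · have hfn (x) : f'.fn σ x = 0 := Set.indicator_apply_eq_zero.2 fun _ =>
      eval_eq_zero_of_forall_params (by simpa [nnz] using h₀) x
    have := clipNorm_nonneg hτ f.params
    exact ⟨none, by dsimp; positivity, by simpa [hfn] using happrox⟩
  · obtain ⟨i, rfl⟩ := hnet f' hfL (Nat.succ_le_succ hfN) hgrid
    refine ⟨some i, ?_, fun x => (abs_sub_max_min_le (abs_fn_le hF hf x) _).trans (happrox x)⟩
    have : max 1 (nnz (net i).params : ℝ) ≤ 16 * c ^ 2 * clipNorm τ f.params :=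
      max_le (hnnz.trans' (by exact_mod_cast h₀)) hnnz
    dsimp
    nlinarith

end Net

/-! ### The oracle inequality -/

section PenalizedRisk

variable {Ω : Type*} {mΩ : MeasurableSpace Ω} {P : Measure Ω} {d T : ℕ}
  {X : ℕ → Ω → Fin d → ℝ} {Y : ℕ → Ω → ℝ} {σ : ℝ → ℝ} {lam τ : ℝ} (hlam : 0 ≤ lam) (hτ : 0 < τ)

lemma clipNorm_le_length (l : List ℝ) : clipNorm τ l ≤ l.length := by
  simpa [clipNorm] using List.sum_le_card_nsmul (l.map fun a => min (|a| / τ) 1) 1 (by simp)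

include hlam

lemma exists_penalty_le (σ : ℝ → ℝ) (d : ℕ) (L N B F τ : ℝ) :
    ∃ J : ℝ, ∀ f ∈ dnnClass σ d L N B F, penalty lam τ f ≤ J := by
  refine ⟨lam * ((⌊N⌋₊ + 1) * (d + 1) + ⌊L⌋₊ * (⌊N⌋₊ + 1) ^ 2 : ℕ), fun f hf => ?_⟩
  refine mul_le_mul_of_nonneg_left ((clipNorm_le_length _).trans ?_) hlam
  have hL : f.depth ≤ ⌊L⌋₊ := Nat.le_floor hf.2.1
  exact_mod_cast (length_params_le f (Nat.succ_le_succ (Nat.le_floor hf.2.2.1))).trans (by gcongr)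

include hτ

lemma penalty_nonneg (f : DNN d) : 0 ≤ penalty lam τ f :=
  mul_nonneg hlam (clipNorm_nonneg hτ _)

lemma penRisk_nonneg (ω : Ω) (f : DNN d) : 0 ≤ penRisk T X Y σ lam τ ω f :=
  add_nonneg (mul_nonneg (by positivity) (Finset.sum_nonneg fun _ _ => sq_nonneg _))
    (penalty_nonneg hlam hτ f)

lemma iInf_penRisk_le {𝓕 : Set (DNN d)} {f : DNN d} (hf : f ∈ 𝓕) (ω : Ω) :
    ⨅ f : 𝓕, penRisk T X Y σ lam τ ω f ≤ penRisk T X Y σ lam τ ω f :=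
  ciInf_le ⟨0, Set.forall_mem_range.2 fun _ : 𝓕 => penRisk_nonneg hlam hτ ω _⟩ (⟨f, hf⟩ : 𝓕)

lemma optGap_nonneg {𝓕 : Set (DNN d)} {fhat : Ω → DNN d} (hmem : ∀ ω, fhat ω ∈ 𝓕) :
    0 ≤ optGap P T X Y σ lam τ 𝓕 fhat :=
  integral_nonneg fun ω => sub_nonneg.2 (iInf_penRisk_le hlam hτ (hmem ω) ω)

/-- An infimum over an uncountable class is measurable because the empirical risk is continuous in
the data and the indicators of the cube, and an infimum of continuous functions is upper
semicontinuous. -/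
lemma measurable_iInf_penRisk (hσ : Continuous σ)
    (hX : ∀ t ∈ Finset.Icc 1 T, Measurable (X t)) (hY : ∀ t ∈ Finset.Icc 1 T, Measurable (Y t))
    (𝓕 : Set (DNN d)) : Measurable fun ω => ⨅ f : 𝓕, penRisk T X Y σ lam τ ω f := by
  rcases isEmpty_or_nonempty 𝓕 with _ | _
  · simp only [Real.iInf_of_isEmpty, measurable_const]
  let Φ (f : 𝓕) (z : (Finset.Icc 1 T → Fin d → ℝ) × (Finset.Icc 1 T → ℝ) ×
      (Finset.Icc 1 T → ℝ)) : ℝ :=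
    (1 / (T : ℝ)) * ∑ t, (z.2.2 t - z.2.1 t * f.1.eval σ (z.1 t)) ^ 2 + penalty lam τ f.1
  have hΦ (f : 𝓕) : Continuous (Φ f) := by
    have := continuous_eval hσ f.1
    fun_prop
  have hΦ_nonneg (f : 𝓕) (z) : 0 ≤ Φ f z :=
    add_nonneg (mul_nonneg (by positivity) (Finset.sum_nonneg fun _ _ => sq_nonneg _))
      (penalty_nonneg hlam hτ _)
  have husc : UpperSemicontinuous fun z => ⨅ f, Φ f z :=
    upperSemicontinuous_ciInf (fun z => ⟨0, Set.forall_mem_range.2 (hΦ_nonneg · z)⟩)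
      fun f => (hΦ f).upperSemicontinuous
  have hdata : Measurable fun ω => ((fun t : Finset.Icc 1 T => X t ω),
      (fun t : Finset.Icc 1 T => (cube d).indicator (1 : (Fin d → ℝ) → ℝ) (X t ω)),
      fun t : Finset.Icc 1 T => Y t ω) :=
    (measurable_pi_lambda _ fun t : Finset.Icc 1 T => hX t t.2).prodMk <|
      (measurable_pi_lambda _ fun t : Finset.Icc 1 T =>
        (measurable_one.indicator (measurableSet_cube d)).comp (hX t t.2)).prodMk
      (measurable_pi_lambda _ fun t : Finset.Icc 1 T => hY t t.2)
  convert husc.measurable.comp hdata with ω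
  refine iInf_congr fun f => ?_
  simp only [penRisk, ← Finset.sum_coe_sort (Finset.Icc 1 T), Φ]
  congr! 4 with t
  by_cases hx : X t ω ∈ cube d <;> simp [DNN.fn, hx]

end PenalizedRisk

section Noise

variable {Ω : Type*} {mΩ : MeasurableSpace Ω} {P : Measure Ω} {T : ℕ} {v : ℕ → Ω → ℝ}

/-- The mean `(1/T) ∑ₜ |v_t|` of the absolute noise variables, which controls the effect of a
uniform perturbation of the regression function on `noise`. -/
def meanAbs (T : ℕ) (v : ℕ → Ω → ℝ) (ω : Ω) : ℝ := (1 / (T : ℝ)) * ∑ t ∈ Finset.Icc 1 T, |v t ω|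

variable {E : Type*} {X : ℕ → Ω → E} {f₀ h h' : E → ℝ} {F δ : ℝ}

lemma sqDist_le_sqDist_add (hT : 0 < T) (hf₀ : ∀ x, |f₀ x| ≤ F) (hh : ∀ x, |h x| ≤ F)
    (hh' : ∀ x, |h' x| ≤ F) (hδ : ∀ x, |h x - h' x| ≤ δ) (ω : Ω) :
    sqDist T X f₀ h ω ≤ sqDist T X f₀ h' ω + 4 * F * δ := by
  rw [← sub_le_iff_le_add', sqDist, sqDist, ← mul_sub, ← Finset.sum_sub_distrib]
  refine mean_le hT fun t _ => ?_
  set x := X t ω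
  have hsum : |h x - f₀ x + (h' x - f₀ x)| ≤ 4 * F := by
    have := abs_le.1 (hf₀ x)
    have := abs_le.1 (hh x)
    have := abs_le.1 (hh' x)
    exact abs_le.2 ⟨by linarith, by linarith⟩
  calc (h x - f₀ x) ^ 2 - (h' x - f₀ x) ^ 2
      = (h x - f₀ x + (h' x - f₀ x)) * (h x - h' x) := by ring
    _ ≤ |h x - f₀ x + (h' x - f₀ x)| * |h x - h' x| := by
      rw [← abs_mul]; exact le_abs_self _
    _ ≤ 4 * F * δ := mul_le_mul hsum (hδ x) (abs_nonneg _) ((abs_nonneg _).trans hsum)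

lemma integral_sqDist_le_add [IsProbabilityMeasure P] [MeasurableSpace E] (hT : 0 < T)
    (hX : ∀ t ∈ Finset.Icc 1 T, Measurable (X t)) (hf₀ : Measurable f₀) (hh : Measurable h)
    (hh' : Measurable h') (hf₀_le : ∀ x, |f₀ x| ≤ F) (hh_le : ∀ x, |h x| ≤ F)
    (hh'_le : ∀ x, |h' x| ≤ F) (hδ : ∀ x, |h x - h' x| ≤ δ) :
    ∫ ω, sqDist T X f₀ h ω ∂P ≤ ∫ ω, sqDist T X f₀ h' ω ∂P + 4 * F * δ := by
  have hint' := integrable_sqDist (P := P) hT hX hf₀ hh' hf₀_le hh'_le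
  simpa [integral_add hint' (integrable_const _)] using
    integral_mono (integrable_sqDist hT hX hf₀ hh hf₀_le hh_le)
      (hint'.add (integrable_const (4 * F * δ)))
      (sqDist_le_sqDist_add hT hf₀_le hh_le hh'_le hδ)

end Noise

section RegressionModel

variable {Ω : Type*} {mΩ : MeasurableSpace Ω} {P : Measure Ω} {𝒢 : Filtration ℕ mΩ} {d T : ℕ}
  {m η : (Fin d → ℝ) → ℝ} {X : ℕ → Ω → Fin d → ℝ} {Y v : ℕ → Ω → ℝ} {Cη C₁ C₂ K : ℝ}
  {σ : ℝ → ℝ} {L N B F lam τ k : ℝ}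

namespace RegressionModel

variable (hm : RegressionModel P 𝒢 T m η X Y v Cη C₁ C₂ K)

include hm

lemma integrable_meanAbs : Integrable (meanAbs T v) P :=
  (integrable_finsetSum _ fun _ ht => (hm.integrable_v ht).abs).const_mul _

lemma integral_meanAbs_le [IsProbabilityMeasure P] (hT : 0 < T) :
    ∫ ω, meanAbs T v ω ∂P ≤ 1 := by
  simp only [meanAbs]
  rw [integral_const_mul, integral_finsetSum _ fun t ht => (hm.integrable_v ht).abs]
  exact mean_le hT fun t ht => hm.integral_abs_v_le ht

lemma abs_noise_sub_le (hk : 0 ≤ k) (hCη : Cη ≤ k) {f₀ h h' : (Fin d → ℝ) → ℝ} {δ : ℝ}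
    (hδ : ∀ x, |h x - h' x| ≤ δ) (ω : Ω) :
    |noise T X v η f₀ h ω - noise T X v η f₀ h' ω| ≤ 2 * k * δ * meanAbs T v ω := by
  calc |noise T X v η f₀ h ω - noise T X v η f₀ h' ω|
      = 2 / T * |∑ t ∈ Finset.Icc 1 T,
          (cube d).indicator η (X t ω) * v t ω * (h (X t ω) - h' (X t ω))| := by
        rw [noise, noise, ← mul_sub, ← Finset.sum_sub_distrib, abs_mul,
          abs_of_nonneg (by positivity : (0 : ℝ) ≤ 2 / T)]
        simp only [← mul_sub, sub_sub_sub_cancel_right]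
    _ ≤ 2 / T * ∑ t ∈ Finset.Icc 1 T, k * |v t ω| * δ := by
        gcongr
        refine (Finset.abs_sum_le_sum_abs _ _).trans (Finset.sum_le_sum fun t _ => ?_)
        rw [abs_mul, abs_mul]
        have := hm.abs_indicator_η_le hk hCη (X t ω)
        gcongr
        exact hδ _
    _ = 2 * k * δ * meanAbs T v ω := by
        rw [← Finset.sum_mul, ← Finset.mul_sum, meanAbs]
        ring

lemma abs_noise_le (hk : 0 ≤ k) (hCη : Cη ≤ k) {f₀ h : (Fin d → ℝ) → ℝ}
    (hf₀ : ∀ x, |f₀ x| ≤ F) (hh : ∀ x, |h x| ≤ F) (ω : Ω) :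
    |noise T X v η f₀ h ω| ≤ 2 * k * (F + F) * meanAbs T v ω := by
  simpa [noise] using hm.abs_noise_sub_le hk hCη (f₀ := f₀) (h' := f₀)
    (fun x => (abs_sub _ _).trans (add_le_add (hh x) (hf₀ x))) ω

lemma penRisk_sub_penRisk (ω : Ω) (f f' : DNN d) :
    penRisk T X Y σ lam τ ω f - penRisk T X Y σ lam τ ω f' =
      sqDist T X ((cube d).indicator m) (f.fn σ) ω
        - sqDist T X ((cube d).indicator m) (f'.fn σ) ω
        - noise T X v η ((cube d).indicator m) (f.fn σ) ω
        + noise T X v η ((cube d).indicator m) (f'.fn σ) ω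
        + penalty lam τ f - penalty lam τ f' := by
  have hterm : ∀ t ∈ Finset.Icc 1 T,
      (Y t ω - f.fn σ (X t ω)) ^ 2 - (Y t ω - f'.fn σ (X t ω)) ^ 2
        = (f.fn σ (X t ω) - (cube d).indicator m (X t ω)) ^ 2
          - (f'.fn σ (X t ω) - (cube d).indicator m (X t ω)) ^ 2
          - 2 * ((cube d).indicator η (X t ω) * v t ω *
            (f.fn σ (X t ω) - (cube d).indicator m (X t ω)))
          + 2 * ((cube d).indicator η (X t ω) * v t ω *
            (f'.fn σ (X t ω) - (cube d).indicator m (X t ω))) := by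
    intro t ht
    by_cases hx : X t ω ∈ cube d
    · rw [hm.model t ht ω, Set.indicator_of_mem hx, Set.indicator_of_mem hx]
      ring
    · simp only [DNN.fn, Set.indicator_of_notMem hx]
      ring
  have hsum := Finset.sum_congr rfl hterm
  simp only [Finset.sum_add_distrib, Finset.sum_sub_distrib, ← Finset.mul_sum] at hsum
  simp only [penRisk, sqDist, noise]
  linear_combination (1 / (T : ℝ)) * hsum

end RegressionModel

end RegressionModel

section Risk

variable {Ω : Type*} {mΩ : MeasurableSpace Ω} {P : Measure Ω} {d T : ℕ}
  {X : ℕ → Ω → Fin d → ℝ} {f₀ : (Fin d → ℝ) → ℝ} {φ : Ω → (Fin d → ℝ) → ℝ} {F : ℝ}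

lemma risk_const [IsProbabilityMeasure P] (h : (Fin d → ℝ) → ℝ) :
    risk P T X (fun _ => h) f₀ = ∫ ω, sqDist T X f₀ h ω ∂P :=
  (integral_fun_snd (sqDist T X f₀ h)).trans (by rw [probReal_univ, one_smul])

lemma risk_nonneg : 0 ≤ risk P T X φ f₀ :=
  integral_nonneg fun q => sqDist_nonneg (h := φ q.1) q.2

lemma integrable_integral_sqDist [IsProbabilityMeasure P] (hT : 0 < T)
    (hX : ∀ t ∈ Finset.Icc 1 T, Measurable (X t)) (hf₀ : Measurable f₀)
    (hφ : Measurable fun q : Ω × (Fin d → ℝ) => φ q.1 q.2) (hf₀_le : ∀ x, |f₀ x| ≤ F)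
    (hφ_le : ∀ ω x, |φ ω x| ≤ F) :
    Integrable (fun ω => ∫ ω', sqDist T X f₀ (φ ω) ω' ∂P) P ∧
      risk P T X φ f₀ = ∫ ω, ∫ ω', sqDist T X f₀ (φ ω) ω' ∂P ∂P := by
  have hmeas : Measurable fun q : Ω × Ω => sqDist T X f₀ (φ q.1) q.2 :=
    Measurable.const_mul (Finset.measurable_fun_sum _ fun t ht =>
      ((hφ.comp (measurable_fst.prodMk ((hX t ht).comp measurable_snd))).sub
        (hf₀.comp ((hX t ht).comp measurable_snd))).pow_const 2) _
  have hint : Integrable (fun q : Ω × Ω => sqDist T X f₀ (φ q.1) q.2) (P.prod P) :=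
    integrable_of_nonneg_of_le hmeas (fun q => sqDist_nonneg q.2)
      fun q => sqDist_le hT hf₀_le (hφ_le q.1) q.2
  exact ⟨hint.integral_prod_left, integral_prod _ hint⟩

lemma risk_le [IsProbabilityMeasure P] (hT : 0 < T) (hf₀_le : ∀ x, |f₀ x| ≤ F)
    (hφ_le : ∀ ω x, |φ ω x| ≤ F) : risk P T X φ f₀ ≤ 4 * F ^ 2 := by
  calc risk P T X φ f₀ ≤ ∫ _, 4 * F ^ 2 ∂P.prod P :=
        integral_mono_of_nonneg (.of_forall fun q => sqDist_nonneg (h := φ q.1) q.2)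
          (integrable_const _) (.of_forall fun q => sqDist_le hT hf₀_le (hφ_le q.1) q.2)
    _ = 4 * F ^ 2 := by rw [integral_const, probReal_univ, one_smul]

end Risk

section OracleInequality

variable {Ω : Type*} {mΩ : MeasurableSpace Ω} {P : Measure Ω} [IsProbabilityMeasure P]
  {𝒢 : Filtration ℕ mΩ} {d T : ℕ} {m η : (Fin d → ℝ) → ℝ} {X : ℕ → Ω → Fin d → ℝ}
  {Y v : ℕ → Ω → ℝ} {Cη C₁ C₂ K : ℝ} {σ : ℝ → ℝ} {L N B F lam τ k : ℝ}

namespace RegressionModel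

variable (hm : RegressionModel P 𝒢 T m η X Y v Cη C₁ C₂ K) (hT : 0 < T) (hF : 1 ≤ F)
  (hmF : ∀ x ∈ cube d, |m x| ≤ F) (hσ : Continuous σ)

include hm hT hF hmF hσ

lemma integrable_penRisk_sub_iInf (hlam : 0 ≤ lam) (hτ : 0 < τ) {fhat : Ω → DNN d}
    (hmem : ∀ ω, fhat ω ∈ dnnClass σ d L N B F)
    (hfhat : Measurable fun q : Ω × (Fin d → ℝ) => (fhat q.1).fn σ q.2)
    (hpen : Measurable fun ω => penalty lam τ (fhat ω)) :
    Integrable (fun ω => penRisk T X Y σ lam τ ω (fhat ω)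
      - ⨅ f : dnnClass σ d L N B F, penRisk T X Y σ lam τ ω f) P := by
  have hF₀ : 0 ≤ F := zero_le_one.trans hF
  have hf₀_le := abs_indicator_cube_le hF₀ hmF
  obtain ⟨J, hJ⟩ := exists_penalty_le hlam σ d L N B F τ
  set k := max 0 Cη
  have hmeas : Measurable fun ω => penRisk T X Y σ lam τ ω (fhat ω) :=
    (Measurable.const_mul (Finset.measurable_fun_sum _ fun t ht => ((hm.measurable_Y t ht).sub
      (hfhat.comp (measurable_id.prodMk (hm.measurable_X t ht)))).pow_const 2) _).add hpen
  refine Integrable.mono' (((hm.integrable_meanAbs.const_mul (8 * k * F)).add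
      (integrable_const (4 * F ^ 2 + J))))
    (hmeas.sub (measurable_iInf_penRisk hlam hτ hσ hm.measurable_X hm.measurable_Y
      _)).aestronglyMeasurable (.of_forall fun ω => ?_)
  have : Nonempty (dnnClass σ d L N B F) := ⟨⟨_, hmem ω⟩⟩
  rw [Real.norm_of_nonneg (sub_nonneg.2 (iInf_penRisk_le hlam hτ (hmem ω) ω)), sub_le_comm]
  refine le_ciInf fun f => ?_
  rw [sub_le_comm, hm.penRisk_sub_penRisk]
  have hle (f' : DNN d) (hf' : f' ∈ dnnClass σ d L N B F) :=
    hm.abs_noise_le (le_max_left 0 Cη) (le_max_right 0 Cη) hf₀_le (abs_fn_le hF₀ hf') ω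
  have h₁ := (abs_le.1 (hle _ (hmem ω))).1
  have h₂ := (abs_le.1 (hle _ f.2)).2
  have h₃ := sqDist_le (X := X) hT hf₀_le (abs_fn_le hF₀ (hmem ω)) ω
  have h₄ := sqDist_nonneg (T := T) (X := X) (f₀ := (cube d).indicator m) (h := f.1.fn σ) ω
  have h₅ := penalty_nonneg hlam hτ f.1
  have h₆ := hJ _ (hmem ω)
  simp only [Pi.add_apply]
  linarith

lemma exists_integral_sqDist_le_penRisk (hk : 1 ≤ k) (hCη : Cη ≤ k) (hKk : K ≤ k) {a : ℕ}
    (ha : 0 < a) {b : ℝ} (hb : 0 ≤ b) (hβ : betaMixing P T X a ≤ ENNReal.ofReal b)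
    {I : Type*} [Fintype I] {G : I → (Fin d → ℝ) → ℝ} {p : I → ℝ} {δ : ℝ}
    (hδ : 0 ≤ δ) (hG : ∀ i, Measurable (G i)) (hG_le : ∀ i x, |G i x| ≤ F) (hp : ∀ i, 0 ≤ p i)
    (hnet : ∀ f ∈ dnnClass σ d L N B F, ∃ i,
      (4 * a + 8 * k ^ 4) * F ^ 2 / T * p i ≤ penalty lam τ f ∧ ∀ x, |f.fn σ x - G i x| ≤ δ) :
    ∃ Z : Ω → ℝ, Integrable Z P ∧
      ∫ ω, Z ω ∂P ≤ 16 * F ^ 2 * b * (T + 1) +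
        (16 * a + 32 * k ^ 4) * F ^ 2 / T * ∑ i, Real.exp (-p i) + (20 * F + 8 * k) * δ ∧
      ∀ f' ∈ dnnClass σ d L N B F, ∀ f : DNN d, ∀ ω,
        ∫ ω', sqDist T X ((cube d).indicator m) (f'.fn σ) ω' ∂P ≤
          4 * (sqDist T X ((cube d).indicator m) (f.fn σ) ω
            + (penRisk T X Y σ lam τ ω f' - penRisk T X Y σ lam τ ω f)
            - noise T X v η ((cube d).indicator m) (f.fn σ) ω + penalty lam τ f) + Z ω := by
  have hF₀ : 0 ≤ F := zero_le_one.trans hF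
  have hk₀ : 0 ≤ k := zero_le_one.trans hk
  have hf₀ : Measurable ((cube d).indicator m) := hm.measurable_m.indicator (measurableSet_cube d)
  have hf₀_le := abs_indicator_cube_le hF₀ hmF
  obtain ⟨Z₁, hZ₁, hZ₁_le, hdecouple⟩ := exists_integral_sqDist_le (P := P) hT hm.measurable_X
    hf₀ hG (zero_lt_one.trans_le hF) hf₀_le hG_le ha hb hβ hp
  obtain ⟨Z₂, hZ₂, hZ₂_le, hnoise⟩ := hm.exists_noise_le hf₀ hf₀_le hT hF hk hCη hk hKk hG hG_le p
  have hM := hm.integrable_meanAbs.const_mul (8 * k * δ)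
  refine ⟨_, ((hZ₁.add (hZ₂.const_mul 4)).add hM).add (integrable_const (20 * F * δ)), ?_,
    fun f' hf' f ω => ?_⟩
  · rw [integral_add' ((hZ₁.add (hZ₂.const_mul 4)).add hM) (integrable_const _),
      integral_add' (hZ₁.add (hZ₂.const_mul 4)) hM, integral_add' hZ₁ (hZ₂.const_mul 4),
      integral_const_mul, integral_const_mul, integral_const, probReal_univ, one_smul]
    have hM_le : 8 * k * δ * ∫ ω, meanAbs T v ω ∂P ≤ 8 * k * δ * 1 := by
      gcongr; exact hm.integral_meanAbs_le hT
    linear_combination hZ₁_le + 4 * hZ₂_le + hM_le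
  obtain ⟨i, hi_pen, hi⟩ := hnet f' hf'
  have hi' (x) : |G i x - f'.fn σ x| ≤ δ := abs_sub_comm (G i x) _ ▸ hi x
  have hf'_le := abs_fn_le hF₀ hf'
  have hpop := integral_sqDist_le_add (P := P) hT hm.measurable_X hf₀ (measurable_fn hσ f')
    (hG i) hf₀_le hf'_le (hG_le i) hi
  have hemp := sqDist_le_sqDist_add (X := X) hT hf₀_le (hG_le i) hf'_le hi' ω
  have hbasic := hm.penRisk_sub_penRisk (σ := σ) (lam := lam) (τ := τ) ω f' f
  have hpert := (abs_le.1 (hm.abs_noise_sub_le hk₀ hCη (f₀ := (cube d).indicator m) hi ω)).2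
  have := hdecouple i ω
  have := hnoise i ω
  have hpen : 16 * a * F ^ 2 / T * p i + 4 * (8 * F ^ 2 * k ^ 2 * k ^ 2 / T * p i)
      = 4 * ((4 * a + 8 * k ^ 4) * F ^ 2 / T * p i) := by ring
  simp only [Pi.add_apply]
  linarith

lemma risk_le_optGap_add_iInf (hlam : 0 ≤ lam) (hτ : 0 < τ) (hk : 1 ≤ k) (hCη : Cη ≤ k)
    (hKk : K ≤ k) {a : ℕ} (ha : 0 < a) {b : ℝ} (hb : 0 ≤ b)
    (hβ : betaMixing P T X a ≤ ENNReal.ofReal b) {I : Type*} [Fintype I]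
    {G : I → (Fin d → ℝ) → ℝ} {p : I → ℝ} {δ : ℝ} (hδ : 0 ≤ δ) (hG : ∀ i, Measurable (G i))
    (hG_le : ∀ i x, |G i x| ≤ F) (hp : ∀ i, 0 ≤ p i)
    (hnet : ∀ f ∈ dnnClass σ d L N B F, ∃ i,
      (4 * a + 8 * k ^ 4) * F ^ 2 / T * p i ≤ penalty lam τ f ∧ ∀ x, |f.fn σ x - G i x| ≤ δ)
    {fhat : Ω → DNN d} (hmem : ∀ ω, fhat ω ∈ dnnClass σ d L N B F)
    (hfhat : Measurable fun q : Ω × (Fin d → ℝ) => (fhat q.1).fn σ q.2)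
    (hpen : Measurable fun ω => penalty lam τ (fhat ω)) :
    risk P T X (fun ω => (fhat ω).fn σ) ((cube d).indicator m) ≤
      4 * (optGap P T X Y σ lam τ (dnnClass σ d L N B F) fhat +
        ⨅ f : dnnClass σ d L N B F,
          (risk P T X (fun _ => f.1.fn σ) ((cube d).indicator m) + penalty lam τ f.1)) +
      (16 * F ^ 2 * b * (T + 1) +
        (16 * a + 32 * k ^ 4) * F ^ 2 / T * ∑ i, Real.exp (-p i) + (20 * F + 8 * k) * δ) := by
  have hF₀ : 0 ≤ F := zero_le_one.trans hF
  have hf₀ : Measurable ((cube d).indicator m) := hm.measurable_m.indicator (measurableSet_cube d)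
  have hf₀_le := abs_indicator_cube_le hF₀ hmF
  obtain ⟨ω₀⟩ := P.nonempty_of_neZero
  have : Nonempty (dnnClass σ d L N B F) := ⟨⟨_, hmem ω₀⟩⟩
  obtain ⟨Z, hZ, hZ_le, hle⟩ := hm.exists_integral_sqDist_le_penRisk hT hF hmF hσ hk hCη hKk ha hb
    hβ hδ hG hG_le hp hnet
  have hgap := hm.integrable_penRisk_sub_iInf hT hF hmF hσ hlam hτ hmem hfhat hpen
  obtain ⟨hrisk, hrisk_eq⟩ := integrable_integral_sqDist (P := P) hT hm.measurable_X hf₀ hfhat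
    hf₀_le fun ω => abs_fn_le hF₀ (hmem ω)
  rw [← sub_le_iff_le_add, ← div_le_iff₀' four_pos, ← sub_le_iff_le_add']
  refine le_ciInf fun ⟨f, hf⟩ => ?_
  have hf_meas := measurable_fn hσ f
  have hf_le := abs_fn_le hF₀ hf
  have hsq := integrable_sqDist (P := P) hT hm.measurable_X hf₀ hf_meas hf₀_le hf_le
  obtain ⟨hnoise, hnoise_eq⟩ := hm.integral_noise hf₀ hf₀_le hf_meas hf_le
  have hsum := (hsq.add hgap).sub hnoise
  have key := integral_mono hrisk (((hsum.add (integrable_const (penalty lam τ f))).const_mul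
    4).add hZ) fun ω => (hle _ (hmem ω) f ω).trans (by
      simp only [Pi.add_apply, Pi.sub_apply]
      gcongr
      exact iInf_penRisk_le hlam hτ hf ω)
  rw [integral_add' ((hsum.add (integrable_const _)).const_mul 4) hZ, integral_const_mul,
    integral_add' hsum (integrable_const _), integral_sub' (hsq.add hgap) hnoise,
    integral_add' hsq hgap, hnoise_eq, integral_const, probReal_univ, one_smul, ← hrisk_eq,
    ← risk_const] at key
  change _ ≤ 4 * (_ + optGap P T X Y σ lam τ _ fhat - 0 + _) + _ at key
  linarith

end RegressionModel

end OracleInequality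

/-! ### Rates -/

section Entropy

variable {a ℓ u c B ε : ℝ} {L N : ℕ} (hℓ : 1 ≤ ℓ) (hL : L + 1 ≤ a * u)
  (hN : N + 1 ≤ Real.exp (a * ℓ))

include hN

lemma add_one_mul_add_one_pow_le_exp : (L + 1) * (N + 1 : ℝ) ^ L ≤ Real.exp (L + a * ℓ * L) := by
  rw [Real.exp_add, Real.exp_mul, Real.rpow_natCast]
  gcongr
  exact Real.add_one_le_exp _

lemma div_grid_le_exp (hB : 0 < B) (hB_le : B ≤ Real.exp (a * ℓ)) (hε : 0 < ε)
    (hε_le : ε⁻¹ ≤ Real.exp (a * ℓ)) :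
    B / (ε / ((L + 1) * ((N + 1) * B) ^ (L + 1)) * Real.exp (-(8 * c ^ 2 * L))) ≤
      Real.exp (2 * (a * ℓ) + L + 2 * (a * ℓ) * (L + 1) + 8 * c ^ 2 * L) := by
  have hpow : ((N + 1) * B) ^ (L + 1) ≤ Real.exp (2 * (a * ℓ) * (L + 1)) := by
    rw [Real.exp_mul, two_mul, Real.exp_add]
    exact_mod_cast pow_le_pow_left₀ (by positivity) (mul_le_mul hN hB_le hB.le (by positivity)) _
  calc _ = B * ε⁻¹ * (L + 1) * ((N + 1) * B) ^ (L + 1) * Real.exp (8 * c ^ 2 * L) := by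
        rw [Real.exp_neg]; field_simp
    _ ≤ Real.exp (a * ℓ) * Real.exp (a * ℓ) * Real.exp L * Real.exp (2 * (a * ℓ) * (L + 1)) *
          Real.exp (8 * c ^ 2 * L) := by gcongr; exact Real.add_one_le_exp _
    _ = _ := by simp only [← Real.exp_add, two_mul]

include hℓ hL

lemma entropy_depth_le (ha : 1 ≤ a) (d : ℕ) (c : ℝ) :
    (L + 1) * (N + 1 : ℝ) ^ L ≤ Real.exp ((10 + 8 * c ^ 2 + d) * a ^ 2 * (ℓ * u)) := by
  refine (add_one_mul_add_one_pow_le_exp hN).trans (Real.exp_le_exp.2 ?_)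
  have hy : 1 ≤ a * ℓ := one_le_mul_of_one_le_of_one_le ha hℓ
  set z := a ^ 2 * (ℓ * u) with hz
  have hyz : a * ℓ * (L + 1) ≤ z := by rw [hz]; nlinarith
  have hLz : (L : ℝ) ≤ a * ℓ * L := le_mul_of_one_le_left L.cast_nonneg hy
  have hz₀ : 0 ≤ z := by linarith [(L.cast_nonneg : (0 : ℝ) ≤ L)]
  nlinarith [mul_nonneg (by positivity : 0 ≤ 8 * c ^ 2 + d) hz₀]

lemma entropy_grid_le (ha : 1 ≤ a) (d : ℕ) (hB : 0 < B)
    (hB_le : B ≤ Real.exp (a * ℓ)) (hε : 0 < ε) (hε_le : ε⁻¹ ≤ Real.exp (a * ℓ)) :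
    2 * (B / (ε / ((L + 1) * ((N + 1) * B) ^ (L + 1)) * Real.exp (-(8 * c ^ 2 * L))) + 1) *
        ((d + 1 + L) * (N + 1 : ℝ) ^ 2) ≤
      Real.exp ((10 + 8 * c ^ 2 + d) * a ^ 2 * (ℓ * u)) := by
  have h2 : (2 : ℝ) ≤ Real.exp 1 := by linarith [Real.add_one_le_exp 1]
  set x := 2 * (a * ℓ) + L + 2 * (a * ℓ) * (L + 1) + 8 * c ^ 2 * L
  have hx : 1 ≤ Real.exp x := Real.one_le_exp (by positivity)
  calc _ ≤ Real.exp 1 * (Real.exp 1 * Real.exp x) *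
        (Real.exp (d + L) * (Real.exp (a * ℓ) * Real.exp (a * ℓ))) := by
        have := div_grid_le_exp (L := L) (c := c) hN hB hB_le hε hε_le
        rw [← sq (Real.exp (a * ℓ))]
        gcongr
        · nlinarith
        · linarith [Real.add_one_le_exp (d + L : ℝ)]
    _ = Real.exp (2 + x + d + L + 2 * (a * ℓ)) := by simp only [← Real.exp_add]; ring_nf
    _ ≤ _ := Real.exp_le_exp.2 ?_
  have hy : 1 ≤ a * ℓ := one_le_mul_of_one_le_of_one_le ha hℓ
  set z := a ^ 2 * (ℓ * u) with hz
  have hyz : a * ℓ * (L + 1) ≤ z := by rw [hz]; nlinarith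
  have hLz : (L : ℝ) ≤ a * ℓ * L := le_mul_of_one_le_left L.cast_nonneg hy
  have hz₁ : 1 ≤ z := by linarith [(L.cast_nonneg : (0 : ℝ) ≤ L)]
  have hcz : 8 * c ^ 2 * L ≤ 8 * c ^ 2 * z := by gcongr; linarith
  have hdz : (d : ℝ) ≤ d * z := le_mul_of_one_le_right d.cast_nonneg hz₁
  linarith

end Entropy

lemma one_le_log {T : ℝ} (hT : 3 ≤ T) : 1 ≤ Real.log T :=
  (Real.le_log_iff_exp_le (by linarith)).2 (by linarith [Real.exp_one_lt_d9])

lemma mul_rpow_add_one_le_exp {C ν T : ℝ} (hT : 3 ≤ T) (hC : 0 ≤ C) :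
    C * T ^ ν + 1 ≤ Real.exp ((C + |ν|) * Real.log T) := by
  have hℓ := one_le_log hT
  have hrpow : T ^ ν ≤ Real.exp (|ν| * Real.log T) := by
    rw [Real.rpow_def_of_pos (by linarith), mul_comm]
    gcongr
    exact le_abs_self ν
  calc C * T ^ ν + 1 ≤ (C + 1) * Real.exp (|ν| * Real.log T) := by
        linarith [mul_le_mul_of_nonneg_left hrpow hC,
          Real.one_le_exp (by positivity : 0 ≤ |ν| * Real.log T)]
    _ ≤ Real.exp (C * Real.log T) * Real.exp (|ν| * Real.log T) := by
        gcongr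
        linarith [Real.add_one_le_exp (C * Real.log T), le_mul_of_one_le_right hC hℓ]
    _ = _ := by rw [← Real.exp_add, add_mul]

lemma dnnClass_floor (σ : ℝ → ℝ) (d : ℕ) {L N : ℝ} (hL : 0 ≤ L) (hN : 0 ≤ N) (B F : ℝ) :
    dnnClass σ d L N B F = dnnClass σ d ⌊L⌋₊ ⌊N⌋₊ B F := by
  ext f
  simp only [dnnClass, Set.mem_ofPred_eq, Nat.cast_le, ← Nat.le_floor_iff hL, ← Nat.le_floor_iff hN]

lemma floor_add_one_mul_pow_le {L N B : ℝ} (hL : 0 ≤ L) (hN : 0 ≤ N) (hB : 1 ≤ B) :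
    (⌊L⌋₊ + 1) * ((⌊N⌋₊ + 1) * B) ^ (⌊L⌋₊ + 1) ≤ (L + 1) * ((N + 1) * B) ^ (L + 1) := by
  have hL' := Nat.floor_le hL
  have hN' := Nat.floor_le hN
  have hbase : 1 ≤ (N + 1) * B := one_le_mul_of_one_le_of_one_le (by linarith) hB
  gcongr
  calc ((⌊N⌋₊ + 1) * B) ^ (⌊L⌋₊ + 1) ≤ ((N + 1) * B) ^ (⌊L⌋₊ + 1) := by gcongr
    _ = ((N + 1) * B) ^ (⌊L⌋₊ + 1 : ℝ) := by norm_cast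
    _ ≤ _ := Real.rpow_le_rpow_of_exponent_le hbase (by linarith)

lemma exists_net_of_le_exp {σ : ℝ → ℝ} {c : ℝ} (hc : 1 ≤ c)
    (hσ : ∀ x y, |σ x - σ y| ≤ c * |x - y|) (hσ₀ : |σ 0| ≤ c) (d : ℕ) {a ℓ u B F τ ε : ℝ}
    {L N : ℕ} (ha : 1 ≤ a) (hℓ : 1 ≤ ℓ) (hL : L + 1 ≤ a * u) (hN : N + 1 ≤ Real.exp (a * ℓ))
    (hB : 1 ≤ B) (hB_le : B ≤ Real.exp (a * ℓ)) (hF : 0 ≤ F) (hε : 0 < ε)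
    (hε_le : ε⁻¹ ≤ Real.exp (a * ℓ)) (hcε : 2 * c * ε ≤ 1) (hτ : 0 < τ)
    (hτε : τ * ((L + 1) * ((N + 1) * B) ^ (L + 1)) ≤ ε) :
    ∃ (I : Type) (_ : Fintype I) (G : I → (Fin d → ℝ) → ℝ) (p : I → ℝ),
      (∀ i, Measurable (G i)) ∧ (∀ i x, |G i x| ≤ F) ∧ (∀ i, 0 ≤ p i) ∧
      ∑ i, Real.exp (-p i) ≤ 4 ∧ ∀ f ∈ dnnClass σ d L N B F, ∃ i,
        p i ≤ 32 * c ^ 2 * (10 + 8 * c ^ 2 + d) * a ^ 2 * (ℓ * u) * clipNorm τ f.params ∧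
        ∀ x, |f.fn σ x - G i x| ≤ 4 * c ^ 2 * (d + 1) * Real.exp (8 * c ^ 2 * (d + 1)) * ε := by
  have hpos : 0 < (L + 1) * ((N + 1) * B) ^ (L + 1) := by positivity
  have hu : 0 ≤ u := by
    by_contra! hu
    nlinarith [(L.cast_nonneg : (0 : ℝ) ≤ L)]
  have hhalf : 2 * ((10 + 8 * c ^ 2 + d) * a ^ 2 * (ℓ * u)) / 2
      = (10 + 8 * c ^ 2 + d) * a ^ 2 * (ℓ * u) := mul_div_cancel_left₀ _ two_ne_zero
  obtain ⟨I, hI, G, p, hG, hG_le, hp, hsum, hnet⟩ := exists_net (d := d) hc hσ hσ₀ hB hτ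
    ((le_div_iff₀ hpos).2 hτε) (by rw [mul_assoc, div_mul_cancel₀ _ hpos.ne']) hcε rfl hF
    (E := 2 * ((10 + 8 * c ^ 2 + d) * a ^ 2 * (ℓ * u))) (by positivity)
    (by rw [hhalf]; exact entropy_depth_le hℓ hL hN ha d c)
    (by rw [hhalf]; exact entropy_grid_le hℓ hL hN ha d (by linarith) hB_le hε hε_le)
  refine ⟨I, hI, G, p, hG, hG_le, hp, hsum, fun f hf => ?_⟩
  obtain ⟨i, hi, hle⟩ := hnet f hf
  exact ⟨i, hi.trans_eq (by ring), hle⟩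

lemma inv_div_le_exp {C T : ℝ} (hT : 3 ≤ T) (hC : 0 < C) :
    (C / T)⁻¹ ≤ Real.exp ((C⁻¹ + 1) * Real.log T) := by
  have hC' := inv_pos.2 hC
  calc (C / T)⁻¹ = C⁻¹ * T := by rw [inv_div, div_eq_inv_mul]
    _ ≤ Real.exp (C⁻¹ * Real.log T) * Real.exp (Real.log T) := by
        rw [Real.exp_log (by linarith)]
        gcongr
        linarith [Real.add_one_le_exp (C⁻¹ * Real.log T),
          le_mul_of_one_le_right hC'.le (one_le_log hT)]
    _ = _ := by rw [← Real.exp_add, add_one_mul]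

lemma exists_net_of_rates {σ : ℝ → ℝ} {c : ℝ} (hc : 1 ≤ c)
    (hσ : ∀ x y, |σ x - σ y| ≤ c * |x - y|) (hσ₀ : |σ 0| ≤ c) (d : ℕ)
    {C_L C_N C_B C_τ ν₀ : ℝ} (ν₁ ν₂ : ℝ) (hC_L : 0 < C_L) (hC_N : 0 < C_N) (hC_B : 0 < C_B)
    (hC_τ : 0 < C_τ) (hν₀ : 0 ≤ ν₀) :
    ∃ A D : ℝ, 0 ≤ A ∧ 0 ≤ D ∧ ∀ T : ℕ, 3 ≤ T → 2 * c * C_τ ≤ T →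
      ∀ F L N B τ : ℝ, 0 ≤ F → 0 < L → L ≤ C_L * Real.log T ^ ν₀ →
      0 < N → N ≤ C_N * (T : ℝ) ^ ν₁ → 1 ≤ B → B ≤ C_B * (T : ℝ) ^ ν₂ →
      0 < τ → τ * (L + 1) * ((N + 1) * B) ^ (L + 1) ≤ C_τ * (T : ℝ)⁻¹ →
      ∃ (I : Type) (_ : Fintype I) (G : I → (Fin d → ℝ) → ℝ) (p : I → ℝ),
        (∀ i, Measurable (G i)) ∧ (∀ i x, |G i x| ≤ F) ∧ (∀ i, 0 ≤ p i) ∧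
        ∑ i, Real.exp (-p i) ≤ 4 ∧ ∀ f ∈ dnnClass σ d L N B F, ∃ i,
          p i ≤ A * Real.log T ^ (1 + ν₀) * clipNorm τ f.params ∧
          ∀ x, |f.fn σ x - G i x| ≤ D / T := by
  set a := 1 + C_L + (C_N + |ν₁|) + (C_B + |ν₂|) + C_τ⁻¹ with ha
  have := abs_nonneg ν₁
  have := abs_nonneg ν₂
  have := inv_pos.2 hC_τ
  refine ⟨32 * c ^ 2 * (10 + 8 * c ^ 2 + d) * a ^ 2,
    4 * c ^ 2 * (d + 1) * Real.exp (8 * c ^ 2 * (d + 1)) * C_τ, by positivity, by positivity, ?_⟩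
  intro T hT hTc F L N B τ hF hL hLT hN hNT hB hBT hτ hτT
  have hT₃ : (3 : ℝ) ≤ T := by exact_mod_cast hT
  have hT₀ : (0 : ℝ) < T := by linarith
  have hℓ := one_le_log hT₃
  have hu : 1 ≤ Real.log T ^ ν₀ := Real.one_le_rpow hℓ hν₀
  have hlogT : Real.log T ^ (1 + ν₀) = Real.log T * Real.log T ^ ν₀ := by
    rw [Real.rpow_add (by linarith), Real.rpow_one]
  have hexp {b : ℝ} (hb : b ≤ a) : Real.exp (b * Real.log T) ≤ Real.exp (a * Real.log T) := by
    gcongr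
  have hLa : (⌊L⌋₊ : ℝ) + 1 ≤ a * Real.log T ^ ν₀ := by
    calc (⌊L⌋₊ : ℝ) + 1 ≤ (1 + C_L) * Real.log T ^ ν₀ := by
          linarith [Nat.floor_le hL.le]
      _ ≤ _ := by gcongr; linarith
  have hNa : (⌊N⌋₊ : ℝ) + 1 ≤ Real.exp (a * Real.log T) := by
    have hle := mul_rpow_add_one_le_exp (ν := ν₁) hT₃ hC_N.le
    linarith [Nat.floor_le hN.le, hexp (b := C_N + |ν₁|) (by linarith)]
  have hBa : B ≤ Real.exp (a * Real.log T) := by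
    have hle := mul_rpow_add_one_le_exp (ν := ν₂) hT₃ hC_B.le
    linarith [hexp (b := C_B + |ν₂|) (by linarith)]
  have hεa : (C_τ / T)⁻¹ ≤ Real.exp (a * Real.log T) :=
    (inv_div_le_exp hT₃ hC_τ).trans (hexp (by linarith))
  have hcε : 2 * c * (C_τ / T) ≤ 1 := by rwa [← mul_div_assoc, div_le_one hT₀]
  have hτε : τ * ((⌊L⌋₊ + 1) * ((⌊N⌋₊ + 1) * B) ^ (⌊L⌋₊ + 1)) ≤ C_τ / T := by
    rw [mul_assoc, ← div_eq_mul_inv] at hτT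
    exact (mul_le_mul_of_nonneg_left (floor_add_one_mul_pow_le hL.le hN.le hB) hτ.le).trans hτT
  rw [dnnClass_floor σ d hL.le hN.le, hlogT, mul_div_assoc]
  exact exists_net_of_le_exp hc hσ hσ₀ d (by linarith) hℓ hLa hNa hB hBa hF (by positivity) hεa
    hcε hτ hτε

lemma exists_lag {C T : ℝ} (hC : 0 < C) (hT : 3 ≤ T) :
    ∃ a : ℕ, 0 < a ∧ a ≤ (2 / C + 2) * Real.log T ∧ Real.exp (-C * a) ≤ 1 / T ^ 2 := by
  have hℓ := one_le_log hT
  have hceil := Nat.ceil_lt_add_one (by positivity : 0 ≤ 2 / C * Real.log T)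
  refine ⟨⌈2 / C * Real.log T⌉₊ + 1, Nat.succ_pos _, ?_, ?_⟩
  · push_cast
    linarith
  · have hle : 2 * Real.log T ≤ C * (⌈2 / C * Real.log T⌉₊ + 1 : ℕ) := by
      calc 2 * Real.log T = C * (2 / C * Real.log T) := by field_simp
        _ ≤ _ := by
            gcongr
            push_cast
            linarith [Nat.le_ceil (2 / C * Real.log T)]
    calc _ ≤ Real.exp (-(2 * Real.log T)) := by gcongr; linarith
      _ = 1 / T ^ 2 := by
        rw [Real.exp_neg, two_mul, Real.exp_add, Real.exp_log (by linarith), one_div, sq]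

lemma remainder_le {T F k C q D b a S : ℝ} (hT : 3 ≤ T) (hF : 1 ≤ F) (hk : 0 ≤ k) (hC : 0 ≤ C)
    (hq : 0 ≤ q) (hD : 0 ≤ D) (hb : b ≤ C * (1 / T ^ 2)) (ha : a ≤ q * Real.log T)
    (hS₀ : 0 ≤ S) (hS : S ≤ 4) :
    16 * F ^ 2 * b * (T + 1) + (16 * a + 32 * k ^ 4) * F ^ 2 / T * S +
        (20 * F + 8 * k) * (D / T) ≤
      (32 * C + 64 * q + 128 * k ^ 4 + (20 + 8 * k) * D) * F ^ 2 * ((1 + Real.log T) / T) := by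
  have hT₀ : 0 < T := by linarith
  have hℓ := one_le_log hT
  have hmix : 16 * F ^ 2 * b * (T + 1) ≤ 32 * C * F ^ 2 / T := by
    calc _ ≤ 16 * F ^ 2 * (C * (1 / T ^ 2)) * (2 * T) := by gcongr; linarith
      _ = _ := by field_simp; ring
  have hnet : (16 * a + 32 * k ^ 4) * F ^ 2 / T * S ≤
      (16 * (q * Real.log T) + 32 * k ^ 4) * F ^ 2 / T * 4 := by gcongr
  have happrox : (20 * F + 8 * k) * (D / T) ≤ (20 + 8 * k) * F ^ 2 * (D / T) := by
    gcongr
    linarith [le_self_pow₀ hF two_ne_zero, mul_le_mul_of_nonneg_left (one_le_pow₀ hF (n := 2)) hk]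
  calc _ ≤ (32 * C + 64 * q * Real.log T + 128 * k ^ 4 + (20 + 8 * k) * D) * (F ^ 2 / T) := by
        linear_combination hmix + hnet + happrox
    _ ≤ (32 * C + 64 * q + 128 * k ^ 4 + (20 + 8 * k) * D) * (1 + Real.log T) * (F ^ 2 / T) := by
        gcongr
        linarith [(by positivity : 0 ≤ (32 * C + 128 * k ^ 4 + (20 + 8 * k) * D) * Real.log T)]
    _ = _ := by ring

lemma mul_le_penalty {A κ F T ν lam p s x : ℝ} (hT : 3 ≤ T)
    (hκ : 0 ≤ κ) (hs : 0 ≤ s) (hx : κ * A ≤ x) (hp : p ≤ A * Real.log T ^ (1 + ν) * s)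
    (hlam : F ^ 2 * x * Real.log T ^ (2 + ν) / T ≤ lam) :
    κ * Real.log T * F ^ 2 / T * p ≤ lam * s := by
  have hT₀ : 0 < T := by linarith
  have hℓ : 0 < Real.log T := zero_lt_one.trans_le (one_le_log hT)
  have hpow : Real.log T ^ (2 + ν) = Real.log T * Real.log T ^ (1 + ν) := by
    rw [← one_add_one_eq_two, add_assoc, Real.rpow_add hℓ, Real.rpow_one]
  calc _ ≤ κ * Real.log T * F ^ 2 / T * (A * Real.log T ^ (1 + ν) * s) := by gcongr
    _ = F ^ 2 * (κ * A) * (Real.log T * Real.log T ^ (1 + ν)) / T * s := by ring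
    _ ≤ F ^ 2 * x * Real.log T ^ (2 + ν) / T * s := by rw [hpow]; gcongr
    _ ≤ lam * s := by gcongr

section Rate

variable {Ω : Type*} {mΩ : MeasurableSpace Ω} {P : Measure Ω} [IsProbabilityMeasure P]
  {𝒢 : Filtration ℕ mΩ} {d T : ℕ} {m η : (Fin d → ℝ) → ℝ} {X : ℕ → Ω → Fin d → ℝ}
  {Y v : ℕ → Ω → ℝ} {Cη C₁ C₂ K : ℝ} {σ : ℝ → ℝ} {L N B F lam τ k : ℝ}

lemma RegressionModel.risk_le_of_net (hm : RegressionModel P 𝒢 T m η X Y v Cη C₁ C₂ K)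
    (hC₁ : 0 < C₁) (hC₂ : 0 < C₂) (hT : 3 ≤ T) (hF : 1 ≤ F) (hmF : ∀ x ∈ cube d, |m x| ≤ F)
    (hσ : Continuous σ) (hlam : 0 ≤ lam) (hτ : 0 < τ) (hk : 1 ≤ k) (hCη : Cη ≤ k) (hKk : K ≤ k)
    {D : ℝ} (hD : 0 ≤ D) {I : Type*} [Fintype I] {G : I → (Fin d → ℝ) → ℝ} {p : I → ℝ}
    (hG : ∀ i, Measurable (G i)) (hG_le : ∀ i x, |G i x| ≤ F) (hp : ∀ i, 0 ≤ p i)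
    (hsum : ∑ i, Real.exp (-p i) ≤ 4)
    (hnet : ∀ f ∈ dnnClass σ d L N B F, ∃ i,
      (4 * (2 / C₂ + 2) + 8 * k ^ 4) * Real.log T * F ^ 2 / T * p i ≤ penalty lam τ f ∧
        ∀ x, |f.fn σ x - G i x| ≤ D / T)
    {fhat : Ω → DNN d} (hmem : ∀ ω, fhat ω ∈ dnnClass σ d L N B F)
    (hfhat : Measurable fun q : Ω × (Fin d → ℝ) => (fhat q.1).fn σ q.2)
    (hpen : Measurable fun ω => penalty lam τ (fhat ω)) :
    risk P T X (fun ω => (fhat ω).fn σ) ((cube d).indicator m) ≤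
      4 * (optGap P T X Y σ lam τ (dnnClass σ d L N B F) fhat +
        ⨅ f : dnnClass σ d L N B F,
          (risk P T X (fun _ => f.1.fn σ) ((cube d).indicator m) + penalty lam τ f.1)) +
      (32 * C₁ + 64 * (2 / C₂ + 2) + 128 * k ^ 4 + (20 + 8 * k) * D) * F ^ 2 *
        ((1 + Real.log T) / T) := by
  have hT₃ : (3 : ℝ) ≤ T := by exact_mod_cast hT
  have hℓ := one_le_log hT₃
  obtain ⟨a, ha₀, ha, hexp⟩ := exists_lag hC₂ hT₃
  refine (hm.risk_le_optGap_add_iInf (by lia) hF hmF hσ hlam hτ hk hCη hKk ha₀ (by positivity)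
    (hm.mixing a ha₀) (div_nonneg hD T.cast_nonneg) hG hG_le hp (fun f hf => ?_) hmem hfhat
    hpen).trans ?_
  · obtain ⟨i, hi, hle⟩ := hnet f hf
    refine ⟨i, le_trans ?_ hi, hle⟩
    have := hp i
    gcongr
    linarith [le_mul_of_one_le_right (by positivity : 0 ≤ 8 * k ^ 4) hℓ]
  · gcongr
    exact remainder_le hT₃ hF (zero_le_one.trans hk) hC₁.le (by positivity) hD (by gcongr) ha
      (by positivity) hsum

omit [IsProbabilityMeasure P] in
lemma optGap_add_iInf_nonneg (hlam : 0 ≤ lam) (hτ : 0 < τ) {𝓕 : Set (DNN d)} {fhat : Ω → DNN d}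
    (hmem : ∀ ω, fhat ω ∈ 𝓕) {f₀ : (Fin d → ℝ) → ℝ} :
    0 ≤ optGap P T X Y σ lam τ 𝓕 fhat +
      ⨅ f : 𝓕, (risk P T X (fun _ => f.1.fn σ) f₀ + penalty lam τ f.1) :=
  add_nonneg (optGap_nonneg hlam hτ hmem)
    (Real.iInf_nonneg fun f => add_nonneg risk_nonneg (penalty_nonneg hlam hτ f.1))

omit [IsProbabilityMeasure P] in
lemma RegressionModel.measurable_uncurry (hm : RegressionModel P 𝒢 T m η X Y v Cη C₁ C₂ K)
    {𝓕 : Set (DNN d)} {fhat : Ω → DNN d} (he : IsEstimator T X Y σ lam τ 𝓕 fhat) :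
    Measurable fun q : Ω × (Fin d → ℝ) => (fhat q.1).fn σ q.2 :=
  he.measurable_fn.mono (sup_le_sup (MeasurableSpace.comap_mono (sup_le
    (iSup₂_le fun t ht => measurable_iff_comap_le.1 (hm.measurable_Y t ht))
    (iSup₂_le fun t ht => measurable_iff_comap_le.1 (hm.measurable_X t ht)))) le_rfl) le_rfl

lemma risk_le_of_lt {φ : Ω → (Fin d → ℝ) → ℝ} {f₀ : (Fin d → ℝ) → ℝ} {S : ℝ} (hT : 3 ≤ T)
    (hTS : T < S) (hf₀_le : ∀ x, |f₀ x| ≤ F) (hφ_le : ∀ ω x, |φ ω x| ≤ F) :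
    risk P T X φ f₀ ≤ 4 * S * F ^ 2 * ((1 + Real.log T) / T) := by
  have hT₃ : (3 : ℝ) ≤ T := by exact_mod_cast hT
  calc risk P T X φ f₀ ≤ 4 * F ^ 2 := risk_le (by lia) hf₀_le hφ_le
    _ = 4 * T * F ^ 2 * (1 / T) := by field_simp
    _ ≤ _ := by
        have : 0 ≤ S := by linarith
        gcongr
        linarith [one_le_log hT₃]

end Rate

end SparseDNN

end

theorem mainTheorem1_general (d : ℕ) {σ : ℝ → ℝ} {Cσ : ℝ≥0} (hσ : LipschitzWith Cσ σ)
    (Cη ν₁ ν₂ K : ℝ) {C₁ C₂ C_L C_N C_B C_τ ν₀ : ℝ} (hC₁ : 0 < C₁) (hC₂ : 0 < C₂)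
    (hC_L : 0 < C_L) (hC_N : 0 < C_N) (hC_B : 0 < C_B) (hC_τ : 0 < C_τ) (hν₀ : 0 ≤ ν₀)
    {ι : ℝ → ℝ} (hι : Tendsto ι atTop atTop) :
    ∃ C : ℝ, 0 < C ∧
      ∀ {Ω : Type*} {mΩ : MeasurableSpace Ω} (P : Measure Ω) [IsProbabilityMeasure P]
        (𝒢 : Filtration ℕ mΩ) (T : ℕ) (_ : 3 ≤ T) (m η : (Fin d → ℝ) → ℝ)
        (X : ℕ → Ω → Fin d → ℝ) (Y v : ℕ → Ω → ℝ)
        (_ : RegressionModel P 𝒢 T m η X Y v Cη C₁ C₂ K)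
        (F : ℝ) (_ : 1 ≤ F) (_ : ∀ x ∈ cube d, |m x| ≤ F)
        (L N B : ℝ) (_ : 0 < L) (_ : L ≤ C_L * Real.log T ^ ν₀)
        (_ : 0 < N) (_ : N ≤ C_N * (T : ℝ) ^ ν₁)
        (_ : 1 ≤ B) (_ : B ≤ C_B * (T : ℝ) ^ ν₂)
        (lam τ : ℝ) (_ : 0 ≤ lam) (_ : F ^ 2 * ι T * Real.log T ^ (2 + ν₀) / T ≤ lam)
        (_ : 0 < τ) (_ : τ * (L + 1) * ((N + 1) * B) ^ (L + 1) ≤ C_τ * (T : ℝ)⁻¹)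
        (fhat : Ω → DNN d) (_ : ∀ ω, fhat ω ∈ dnnClass σ d L N B F)
        (_ : Measurable fun q : Ω × (Fin d → ℝ) => (fhat q.1).fn σ q.2)
        (_ : Measurable fun ω => penalty lam τ (fhat ω)),
        risk P T X (fun ω => (fhat ω).fn σ) ((cube d).indicator m) ≤
          4 * (optGap P T X Y σ lam τ (dnnClass σ d L N B F) fhat +
            ⨅ f : dnnClass σ d L N B F,
              (risk P T X (fun _ => (f : DNN d).fn σ) ((cube d).indicator m) +
                penalty lam τ (f : DNN d))) +
          C * F ^ 2 * ((1 + Real.log T) / T) := by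
  set c : ℝ := max 1 (max Cσ |σ 0|) with hc
  have hc₁ : 1 ≤ c := le_max_left _ _
  have hσc x y : |σ x - σ y| ≤ c * |x - y| := (hσ.dist_le_mul x y).trans
    (mul_le_mul_of_nonneg_right (by simp [hc]) dist_nonneg)
  set k := max 1 (max Cη K) with hk
  have hk₁ : 1 ≤ k := le_max_left _ _
  obtain ⟨A, D, hA, hD, hnet⟩ := exists_net_of_rates hc₁ hσc (by simp [hc]) d ν₁ ν₂ hC_L hC_N hC_B
    hC_τ hν₀
  set κ := 4 * (2 / C₂ + 2) + 8 * k ^ 4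
  obtain ⟨S, hS⟩ := eventually_atTop.1 ((hι.eventually_ge_atTop (κ * A)).and
    ((eventually_ge_atTop (2 * c * C_τ)).and (eventually_gt_atTop 0)))
  have hS₀ : 0 < S := (hS S le_rfl).2.2
  set M := 32 * C₁ + 64 * (2 / C₂ + 2) + 128 * k ^ 4 + (20 + 8 * k) * D
  have hM : 0 < M := by positivity
  refine ⟨M + 4 * S, by positivity, ?_⟩
  intro Ω mΩ P _ 𝒢 T hT m η X Y v hm F hF hmF L N B hL hL_le hN hN_le hB hB_le lam τ hlam hlam_le
    hτ hτ_le fhat hmem hfhat hpen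
  have hF₀ : 0 ≤ F := by linarith
  have hT₃ : (3 : ℝ) ≤ T := by exact_mod_cast hT
  have hrate : 0 ≤ F ^ 2 * ((1 + Real.log T) / T) := by
    have := one_le_log hT₃
    positivity
  obtain hTS | hTS := lt_or_ge (T : ℝ) S
  · linarith [risk_le_of_lt (P := P) (X := X) hT hTS (abs_indicator_cube_le hF₀ hmF)
      fun ω => abs_fn_le hF₀ (hmem ω), mul_nonneg hM.le hrate,
      optGap_add_iInf_nonneg (P := P) (T := T) (X := X) (Y := Y) (σ := σ) hlam hτ hmem
        (f₀ := (cube d).indicator m)]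
  · obtain ⟨hιT, hcT, -⟩ := hS T hTS
    obtain ⟨I, _, G, p, hG, hG_le, hp, hsum, hf⟩ := hnet T hT hcT F L N B τ hF₀ hL hL_le hN
      hN_le hB hB_le hτ hτ_le
    refine (hm.risk_le_of_net hC₁ hC₂ hT hF hmF hσ.continuous hlam hτ hk₁ (by simp [hk])
      (by simp [hk]) hD hG hG_le hp hsum (fun f hfm => ?_) hmem hfhat hpen).trans ?_
    · obtain ⟨i, hi, hle⟩ := hf f hfm
      exact ⟨i, mul_le_penalty hT₃ (by positivity) (clipNorm_nonneg hτ _) hιT hi hlam_le, hle⟩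
    · linarith [mul_nonneg hS₀.le hrate]

theorem mainTheorem1 (d : ℕ) (hd : 1 ≤ d) (σ : ℝ → ℝ) (hσ : ∃ Cσ : NNReal, LipschitzWith Cσ σ)
    (Cη C₁ C₂ C_L C_N C_B C_τ ν₀ ν₁ ν₂ K : ℝ) (hC₁ : 0 < C₁) (hC₂ : 0 < C₂)
    (hC_L : 0 < C_L) (hC_N : 0 < C_N) (hC_B : 0 < C_B) (hC_τ : 0 < C_τ)
    (hν₀ : 0 < ν₀) (hν₁ : 0 < ν₁) (hν₂ : 0 < ν₂)
    (ι : ℝ → ℝ) (hι : StrictMonoOn ι (Set.Ici 3))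
    (hι_lim : Filter.Tendsto (fun x => ι x / Real.log x) Filter.atTop Filter.atTop) :
    ∃ C : ℝ, 0 < C ∧
      ∀ {Ω : Type*} {mΩ : MeasurableSpace Ω} (P : Measure Ω) [IsProbabilityMeasure P]
        (𝒢 : Filtration ℕ mΩ) (T : ℕ) (_ : 3 ≤ T) (m η : (Fin d → ℝ) → ℝ)
        (X : ℕ → Ω → Fin d → ℝ) (Y v : ℕ → Ω → ℝ)
        (_ : RegressionModel P 𝒢 T m η X Y v Cη C₁ C₂ K)
        (F : ℝ) (_ : 1 ≤ F) (_ : ∀ x ∈ cube d, |m x| ≤ F)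
        (L N B : ℝ) (_ : 0 < L) (_ : L ≤ C_L * Real.log T ^ ν₀)
        (_ : 0 < N) (_ : N ≤ C_N * (T : ℝ) ^ ν₁)
        (_ : 1 ≤ B) (_ : B ≤ C_B * (T : ℝ) ^ ν₂)
        (lam τ : ℝ) (_ : 0 < lam) (_ : lam = F ^ 2 * ι T * Real.log T ^ (2 + ν₀) / T)
        (_ : 0 < τ) (_ : τ * (L + 1) * ((N + 1) * B) ^ (L + 1) ≤ C_τ * (T : ℝ)⁻¹)
        (fhat : Ω → DNN d) (_ : IsEstimator T X Y σ lam τ (dnnClass σ d L N B F) fhat),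
        risk P T X (fun ω => (fhat ω).fn σ) ((cube d).indicator m) ≤
          6 * (optGap P T X Y σ lam τ (dnnClass σ d L N B F) fhat +
            ⨅ f : dnnClass σ d L N B F,
              (risk P T X (fun _ => (f : DNN d).fn σ) ((cube d).indicator m) +
                penalty lam τ (f : DNN d))) +
          C * F ^ 2 * ((1 + Real.log T) / T) := by
  obtain ⟨Cσ, hσ⟩ := hσ
  have hι_top : Tendsto ι atTop atTop :=
    (hι_lim.atTop_mul_atTop₀ Real.tendsto_log_atTop).congr' <| by
      filter_upwards [eventually_gt_atTop 1] with x hx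
      exact div_mul_cancel₀ _ (Real.log_pos hx).ne'
  obtain ⟨C, hC, hbound⟩ :=
    mainTheorem1_general d hσ Cη ν₁ ν₂ K hC₁ hC₂ hC_L hC_N hC_B hC_τ hν₀.le hι_top
  refine ⟨C, hC, ?_⟩
  intro Ω mΩ P _ 𝒢 T hT m η X Y v hm F hF hmF L N B hL hL_le hN hN_le hB hB_le lam τ hlam hlam_eq
    hτ hτ_le fhat he
  refine (hbound P 𝒢 T hT m η X Y v hm F hF hmF L N B hL hL_le hN hN_le hB hB_le lam τ hlam.le
    hlam_eq.ge hτ hτ_le fhat he.mem (hm.measurable_uncurry he) he.measurable_penalty).trans ?_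
  have := optGap_add_iInf_nonneg (P := P) (T := T) (X := X) (Y := Y) (σ := σ) hlam.le hτ he.mem
    (f₀ := (cube d).indicator m)
  linarith
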